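/- **Theorem (stochastic objective).** Let $(\mathcal M,\mathfrak g)$ be a finite-dimensional, geodesically complete, connected smooth Riemannian manifold. For $x,y\in\mathcal M$ let $\mathrm{Exp}_x^{-1}(y)$ be a vector of minimal norm among the $w\in T_x\mathcal M$ with $\mathrm{Exp}_x(w)=y$ (chosen measurably in $(x,y)$ where it is not unique), and let $\Gamma_x^y:T_x\mathcal M\to T_y\mathcal M$ be Levi-Civita parallel transport along the geodesic $t\mapsto \mathrm{Exp}_x(t\,\mathrm{Exp}_x^{-1}(y))$, $t\in[0,1]$. Let $\xi$ be a random variable and $f(x)=\mathbb E_\xi[f(x;\xi)]$, where $f(x;\xi)$ is integrable for every $x$ and $f$ is differentiable. Let $L,\sigma,\epsilon>0$ and $x_0\in\mathcal M$, and assume: 1. for every $\xi$, $f(\cdot;\xi)$ is geodesically $L$-smooth, i.e. differentiable with $\|\nabla f(x;\xi)-\Gamma_y^x\nabla f(y;\xi)\|\le L\|\mathrm{Exp}_x^{-1}(y)\|$ for all $x,y\in\mathcal M$; 2. $f$ is bounded below, and $M:=f(x_0)-\inf_{x\in\mathcal M}f(x)>0$; 3. $\mathbb E_\xi\|\nabla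 f(x)-\nabla f(x;\xi)\|^2\le\sigma^2$ for all $x\in\mathcal M$. Put $S_1=\lceil 2\sigma^2/\epsilon^2\rceil$, $\eta=\frac1{2L}$, $q=\lceil 1/\epsilon\rceil$, $T=\lceil 4ML/\epsilon^2\rceil$. The algorithm R-SPIDER-nonconvex does the following for $k=0,1,\dots,T-1$, where all samples are independent copies of $\xi$ and $\nabla f_S(x)$ denotes the average of $\nabla f(x;\xi_i)$ over the $S$ samples $\xi_1,\dots,\xi_S$ drawn in the current iteration. * If $q\mid k$, it draws $S_1$ samples and sets $v_k=\nabla f_{S_1}(x_k)$. * Otherwise it draws $S_2=\Big\lceil \frac{qL^2\|\mathrm{Exp}_{x_{k-1}}^{-1}(x_k)\|^2}{2\epsilon^2}\Big\rceil$ samples and sets $v_k=\nabla f_{S_2}(x_k)-\Gamma_{x_{k-1}}^{x_k}\big[\nabla f_{S_2}(x_{k-1})-v_{k-1}\big]$ (an average over no samples is $0$). * Then $x_{k+1}=\mathrm{Exp}_{x_k}(-\eta v_k)$. It returns a point $x$ chosen uniformly from $\{x_1,\dots,x_T\}$, independently of the samples. An iteration of the first kind costs $S_1$ incremental first-order oracle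 (IFO) calls, one of the second kind $2S_2$ (each sample is used at two points). Then: * the algorithm terminates after exactly $T$ iterations; * its output satisfies $\mathbb E\|\nabla f(x)\|^2\le 10\epsilon^2$; * the expected number of IFO calls is less than $\lceil T/q\rceil S_1+\dfrac{24ML}{\epsilon^3}$. In particular, if $2\sigma^2/\epsilon^2$, $1/\epsilon$ and $4ML/\epsilon^2$ are integers and $q\mid T$ (so that no rounding occurs), it is less than $\dfrac{8ML(\sigma^2+3)}{\epsilon^3}$. None of these bounds depends on the curvature or the diameter of $\mathcal M$. -/

import Mathlib

open Bundle MeasureTheory ProbabilityTheory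
open scoped Manifold ContDiff

noncomputable section

/-! ### Riemannian geometry: Levi-Civita parallel fields, geodesics, exponential map -/

section Geometry

variable {E : Type*} [NormedAddCommGroup E] [NormedSpace ℝ E]
  {M : Type*} [TopologicalSpace M] [ChartedSpace E M]

/-- The velocity `γ'(t) ∈ T_{γ(t)} M` of a curve. -/
def velocity (E : Type*) [NormedAddCommGroup E] [NormedSpace ℝ E]
    {M : Type*} [TopologicalSpace M] [ChartedSpace E M] (γ : ℝ → M) (t : ℝ) :
    TangentSpace 𝓘(ℝ, E) (γ t) :=
  mfderiv 𝓘(ℝ, ℝ) 𝓘(ℝ, E) γ t (1 : ℝ)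

/-- Coordinates, in the chart around `p`, of a vector field `V` along the curve `γ`. -/
def fieldInChart (p : M) (γ : ℝ → M) (V : ∀ t, TangentSpace 𝓘(ℝ, E) (γ t)) (t : ℝ) : E :=
  mfderiv 𝓘(ℝ, E) 𝓘(ℝ, E) (extChartAt 𝓘(ℝ, E) p) (γ t) (V t)

variable [RiemannianBundle (fun x : M ↦ TangentSpace 𝓘(ℝ, E) x)]

/-- The metric `g_y(u, w)` in the coordinates of the chart around `p`. -/
def chartMetric (p : M) (y u w : E) : ℝ :=
  inner ℝ
    (mfderiv 𝓘(ℝ, E) 𝓘(ℝ, E) (extChartAt 𝓘(ℝ, E) p).symm y u :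
      TangentSpace 𝓘(ℝ, E) ((extChartAt 𝓘(ℝ, E) p).symm y))
    (mfderiv 𝓘(ℝ, E) 𝓘(ℝ, E) (extChartAt 𝓘(ℝ, E) p).symm y w :
      TangentSpace 𝓘(ℝ, E) ((extChartAt 𝓘(ℝ, E) p).symm y))

/-- The derivative `∂_h g(u, w)` at `y` of the metric in the coordinates of the chart around `p`. -/
def chartMetricDeriv (p : M) (y h u w : E) : ℝ :=
  fderiv ℝ (fun z ↦ chartMetric p z u w) y h

/-- The Christoffel symbols of the first kind of the Levi-Civita connection,
`½ (∂_a g(b, c) + ∂_b g(a, c) - ∂_c g(a, b))`, in the chart around `p`. -/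
def christoffel (p : M) (y a b c : E) : ℝ :=
  (chartMetricDeriv p y a b c + chartMetricDeriv p y b a c - chartMetricDeriv p y c a b) / 2

/-- The vector field `V` along the differentiable curve `γ` is parallel for the Levi-Civita
connection: in every chart, `g(V̇ + Γ(ċ, V), a) = 0` for all `a`, where `c` is the curve in
coordinates. -/
def IsParallelAlong (γ : ℝ → M) (V : ∀ t, TangentSpace 𝓘(ℝ, E) (γ t)) : Prop :=
  MDifferentiable 𝓘(ℝ, ℝ) 𝓘(ℝ, E) γ ∧
  ∀ (t : ℝ) (p : M), γ t ∈ (extChartAt 𝓘(ℝ, E) p).source →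
    DifferentiableAt ℝ (fieldInChart p γ V) t ∧
    ∀ a : E,
      chartMetric p (extChartAt 𝓘(ℝ, E) p (γ t)) (deriv (fieldInChart p γ V) t) a +
        christoffel p (extChartAt 𝓘(ℝ, E) p (γ t))
          (deriv (fun s ↦ extChartAt 𝓘(ℝ, E) p (γ s)) t) (fieldInChart p γ V t) a = 0

/-- A geodesic, parametrized by `ℝ` with constant speed: its velocity is parallel along it. -/
def IsGeodesic (E : Type*) [NormedAddCommGroup E] [NormedSpace ℝ E]
    {M : Type*} [TopologicalSpace M] [ChartedSpace E M]
    [RiemannianBundle (fun x : M ↦ TangentSpace 𝓘(ℝ, E) x)] (γ : ℝ → M) : Prop :=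
  IsParallelAlong γ (velocity E γ)

/-- `γ` is a geodesic with `γ(0) = x` and `γ'(0) = w`. -/
def IsGeodesicFrom (γ : ℝ → M) (x : M) (w : TangentSpace 𝓘(ℝ, E) x) : Prop :=
  IsGeodesic E γ ∧ (⟨γ 0, velocity E γ 0⟩ : TangentBundle 𝓘(ℝ, E) M) = ⟨x, w⟩

variable (E M) in
/-- Every initial condition is the initial condition of a geodesic defined for all times. -/
def GeodesicallyComplete : Prop :=
  ∀ (x : M) (w : TangentSpace 𝓘(ℝ, E) x), ∃ γ : ℝ → M, IsGeodesicFrom γ x w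

open Classical in
/-- The exponential map `Exp_x(w) = γ(1)`, with `γ` the geodesic such that `γ(0) = x` and
`γ'(0) = w` (junk value `x` if there is none). -/
def expMap (x : M) (w : TangentSpace 𝓘(ℝ, E) x) : M :=
  if h : ∃ γ : ℝ → M, IsGeodesicFrom γ x w then h.choose 1 else x

open Classical in
/-- The parallel transport of `u ∈ T_x M` to `T_y M` along the geodesic `[0, 1] → M` that leaves
`x` with velocity `w` and arrives at `y` (junk value `0` if that geodesic does not arrive
at `y`). -/
def transportAlong (x y : M) (w u : TangentSpace 𝓘(ℝ, E) x) : TangentSpace 𝓘(ℝ, E) y :=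
  if h : ∃ (u' : TangentSpace 𝓘(ℝ, E) y) (γ : ℝ → M) (V : ∀ t, TangentSpace 𝓘(ℝ, E) (γ t)),
      IsGeodesicFrom γ x w ∧ IsParallelAlong γ V ∧
      (⟨γ 0, V 0⟩ : TangentBundle 𝓘(ℝ, E) M) = ⟨x, u⟩ ∧
      (⟨γ 1, V 1⟩ : TangentBundle 𝓘(ℝ, E) M) = ⟨y, u'⟩
  then h.choose else 0

/-- Measurability of a map into the tangent bundle, for its Borel σ-algebra. -/
def MeasurableToTangent [IsManifold 𝓘(ℝ, E) 1 M] {α : Type*} [mα : MeasurableSpace α]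
    (g : α → TangentBundle 𝓘(ℝ, E) M) : Prop :=
  @Measurable α (TangentBundle 𝓘(ℝ, E) M) mα (borel (TangentBundle 𝓘(ℝ, E) M)) g

/-- `log x y` is the inverse exponential map `Exp_x⁻¹(y)`: a vector of minimal norm among the
`w ∈ T_x M` with `Exp_x(w) = y`, chosen measurably in `(x, y)` where it is not unique. If any two
points are joined by a unique geodesic, then `log x` is the inverse of `Exp_x`. -/
structure IsInverseExp [IsManifold 𝓘(ℝ, E) 1 M] [MeasurableSpace M]
    (log : ∀ x : M, M → TangentSpace 𝓘(ℝ, E) x) : Prop where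
  exp_log : ∀ x y : M, expMap x (log x y) = y
  norm_le : ∀ (x : M) (w : TangentSpace 𝓘(ℝ, E) x), ‖log x (expMap x w)‖ ≤ ‖w‖
  measurable : MeasurableToTangent
    (fun z : M × M ↦ (⟨z.1, log z.1 z.2⟩ : TangentBundle 𝓘(ℝ, E) M))

/-- The parallel transport `Γ_x^y : T_x M → T_y M` along the geodesic with initial velocity
`Exp_x⁻¹(y)`. -/
def transport (log : ∀ x : M, M → TangentSpace 𝓘(ℝ, E) x) (x y : M)
    (u : TangentSpace 𝓘(ℝ, E) x) : TangentSpace 𝓘(ℝ, E) y :=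
  transportAlong x y (log x y) u

variable [FiniteDimensional ℝ E]

instance (x : M) : FiniteDimensional ℝ (TangentSpace 𝓘(ℝ, E) x) :=
  inferInstanceAs (FiniteDimensional ℝ E)

/-- The Riemannian gradient: `⟪∇h(x), u⟫ = dh_x(u)`. -/
def grad (E : Type*) [NormedAddCommGroup E] [NormedSpace ℝ E] [FiniteDimensional ℝ E]
    {M : Type*} [TopologicalSpace M] [ChartedSpace E M]
    [RiemannianBundle (fun x : M ↦ TangentSpace 𝓘(ℝ, E) x)] (h : M → ℝ) (x : M) :
    TangentSpace 𝓘(ℝ, E) x :=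
  haveI : CompleteSpace (TangentSpace 𝓘(ℝ, E) x) :=
    FiniteDimensional.complete ℝ (TangentSpace 𝓘(ℝ, E) x)
  (InnerProductSpace.toDual ℝ (TangentSpace 𝓘(ℝ, E) x)).symm
    (mfderiv 𝓘(ℝ, E) 𝓘(ℝ, ℝ) h x)

/-- `h` is geodesically `L`-smooth:
it is differentiable and `‖∇h(x) - Γ_y^x ∇h(y)‖ ≤ L ‖Exp_x⁻¹(y)‖`. -/
def GeodesicallySmooth (log : ∀ x : M, M → TangentSpace 𝓘(ℝ, E) x) (L : ℝ) (h : M → ℝ) : Prop :=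
  MDifferentiable 𝓘(ℝ, E) 𝓘(ℝ, ℝ) h ∧
  ∀ x y : M, ‖grad E h x - transport log y x (grad E h y)‖ ≤ L * ‖log x y‖

end Geometry

/-! ### The algorithm R-SPIDER-nonconvex in the stochastic setting -/

section Algorithm

variable {E : Type*} [NormedAddCommGroup E] [NormedSpace ℝ E] [FiniteDimensional ℝ E]
  {M : Type*} [TopologicalSpace M] [ChartedSpace E M]
  [RiemannianBundle (fun x : M ↦ TangentSpace 𝓘(ℝ, E) x)] {Ξ : Type*}

/-- The parameters of the algorithm: the size `S₁` of the large batches, the period `q`, the step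
size `η`, the accuracy `ε`, the smoothness constant `L`, and the number `T` of iterations. -/
structure SpiderParams where
  S₁ : ℕ
  q : ℕ
  η : ℝ
  ε : ℝ
  L : ℝ
  T : ℕ

/-- The state after `iter = k` iterations: the pair `prev = (x_{k-1}, v_{k-1})` (irrelevant for
`k = 0`), the iterate `cur = x_k`, and the number of IFO calls made so far. -/
structure SpiderState (E : Type*) [NormedAddCommGroup E] [NormedSpace ℝ E]
    (M : Type*) [TopologicalSpace M] [ChartedSpace E M] where
  iter : ℕ
  prev : TangentBundle 𝓘(ℝ, E) M
  cur : M
  calls : ℕ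

/-- The average `∇f_S(x)` of the gradients at `x` of the first `S` samples of the row `s`. -/
def batchGrad (E : Type*) [NormedAddCommGroup E] [NormedSpace ℝ E] [FiniteDimensional ℝ E]
    {M : Type*} [TopologicalSpace M] [ChartedSpace E M]
    [RiemannianBundle (fun x : M ↦ TangentSpace 𝓘(ℝ, E) x)] {Ξ : Type*}
    (f : M → Ξ → ℝ) (s : ℕ → Ξ) (S : ℕ) (x : M) : TangentSpace 𝓘(ℝ, E) x :=
  (S : ℝ)⁻¹ • ∑ i ∈ Finset.range S, grad E (fun y ↦ f y (s i)) x

/-- The size `S₂ = ⌈q L² ‖Exp_{x'}⁻¹(x)‖² / (2 ε²)⌉` of a small batch, where `x'` is the previous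
iterate and `x` the current one. -/
def smallBatch (log : ∀ x : M, M → TangentSpace 𝓘(ℝ, E) x) (par : SpiderParams) (x' x : M) : ℕ :=
  ⌈(par.q : ℝ) * par.L ^ 2 * ‖log x' x‖ ^ 2 / (2 * par.ε ^ 2)⌉₊

/-- The gradient estimator `v_k` computed from the samples in the row `s`. -/
def estimator (log : ∀ x : M, M → TangentSpace 𝓘(ℝ, E) x) (f : M → Ξ → ℝ) (par : SpiderParams)
    (s : ℕ → Ξ) (st : SpiderState E M) : TangentSpace 𝓘(ℝ, E) st.cur :=
  if st.iter % par.q = 0 then batchGrad E f s par.S₁ st.cur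
  else
    batchGrad E f s (smallBatch log par st.prev.proj st.cur) st.cur -
      transport log st.prev.proj st.cur
        (batchGrad E f s (smallBatch log par st.prev.proj st.cur) st.prev.proj - st.prev.snd)

/-- The number of IFO calls made in one iteration: one for each sample of a large batch, and two
for each sample of a small batch (its gradient is needed at `x_k` and at `x_{k-1}`). -/
def iterCalls (log : ∀ x : M, M → TangentSpace 𝓘(ℝ, E) x) (par : SpiderParams)
    (st : SpiderState E M) : ℕ :=
  if st.iter % par.q = 0 then par.S₁ else 2 * smallBatch log par st.prev.proj st.cur

/-- One iteration, with the samples in the row `s`; nothing happens once `T` iterations are done. -/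
def spiderStep (log : ∀ x : M, M → TangentSpace 𝓘(ℝ, E) x) (f : M → Ξ → ℝ) (par : SpiderParams)
    (s : ℕ → Ξ) (st : SpiderState E M) : SpiderState E M :=
  if st.iter < par.T then
    { iter := st.iter + 1
      prev := ⟨st.cur, estimator log f par s st⟩
      cur := expMap st.cur (-(par.η • estimator log f par s st))
      calls := st.calls + iterCalls log par st }
  else st

/-- The state after `k` steps from `x₀`, where the step `k` uses the samples `s k 0, s k 1, …`. -/
def spiderRun (log : ∀ x : M, M → TangentSpace 𝓘(ℝ, E) x) (f : M → Ξ → ℝ) (par : SpiderParams)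
    (x₀ : M) (s : ℕ → ℕ → Ξ) : ℕ → SpiderState E M
  | 0 => { iter := 0, prev := ⟨x₀, 0⟩, cur := x₀, calls := 0 }
  | k + 1 => spiderStep log f par (s k) (spiderRun log f par x₀ s k)

/-- The choice of parameters `S₁ = 2σ²/ε²`, `q = 1/ε`, `η = 1/(2L)`, `T = 4ΔL/ε²`, where
non-integral values of `S₁`, `q` and `T` are rounded up. -/
def spiderParams (L σ ε Δ : ℝ) : SpiderParams where
  S₁ := ⌈2 * σ ^ 2 / ε ^ 2⌉₊
  q := ⌈1 / ε⌉₊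
  η := 1 / (2 * L)
  ε := ε
  L := L
  T := ⌈4 * Δ * L / ε ^ 2⌉₊

end Algorithm

end

/-!
The proof has a geometric and a probabilistic half.

*Geometry.* Coordinates of a geodesic together with a parallel field along it solve the ordinary
differential equation of a `C¹` vector field, `geodesicField`. Its local flows give uniqueness
(`parallel_unique`), continuous dependence on initial conditions (`StateTendsto.all`) and, since the
equation of parallel fields is linear, existence along a whole geodesic (`exists_isParallelAlong`).
Hence parallel transport is a linear isometry (`exists_linearIsometry_transportAlong`), and the
exponential map and parallel transport are continuous; with the measurability of `log`, all iterates
are measurable functions of the samples (`StochasticObjective.measurable_spiderRun`).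

No injectivity radius, distance function or curvature is needed for the descent inequality. Geodesic
smoothness compares the gradients at `x` and `y` along the geodesic chosen by `log`, whereas the
inequality concerns a given geodesic `γ`, which need not be the chosen one. On short pieces of `γ`
the two agree, since the exponential map is injective near the origin
(`expMap_injective_near_zero`) and `log` does not increase norms. So `⟪∇h(γ), γ'⟫` is locally, hence
globally, Lipschitz with constant `L ‖γ'‖²`, and integration gives the two-sided inequality
`GeodesicallySmooth.abs_expMap_sub_le`.

*Probability.* The inequality is uniform in the sample, so it may be averaged: stochastic gradients
are unbiased (`StochasticObjective.integral_grad`), and `F` inherits geodesic `L`-smoothness. The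
samples of an iteration are independent of the state in which it starts. Averaging over `S₁` samples
makes the mean square error of the estimator at most `ε² / 2`, and a small batch adds at most
`L² ‖log x_{k-1} x_k‖² / S₂ ≤ 2 ε² / q` to it, transport being isometric. Since at most `q` small
batches follow each other, `𝔼 ‖v_k - ∇F(x_k)‖² ≤ 5 ε² / 2` for all `k`
(`StochasticObjective.integral_estimatorError_sq_le`). With the step size `1 / (2L)`, descent reads
`F(x_{k+1}) + ‖∇F(x_k)‖² / (4L) + ‖v_k‖² / (8L) ≤ F(x_k) + ‖v_k - ∇F(x_k)‖² / (4L)`, and telescoping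
(`StochasticObjective.sum_integral_le`) yields
`∑_{k<n} (2 𝔼 ‖∇F(x_k)‖² + 𝔼 ‖v_k‖²) ≤ 8 L Δ + 5 ε² n`.

This one estimate controls both conclusions. As `‖∇F(x_{k+1})‖² ≤ 2 ‖∇F(x_k)‖² + ‖v_k‖² / 2`, it
bounds the mean square gradient at the output, even by `7 ε²`
(`StochasticObjective.integral_output_le`); and as the size of a small batch is at most a multiple
of `‖v_{k-1}‖²` plus `1`, it bounds the expected number of oracle calls
(`StochasticObjective.integral_calls_le`, `smallBatch_cost_lt`).
-/

noncomputable section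

open Filter Topology Set

set_option linter.unusedSectionVars false

/-! ### Christoffel symbols of a metric on an open subset of a vector space -/

section ChristoffelAlgebra

variable {E : Type*} [NormedAddCommGroup E] [NormedSpace ℝ E] [FiniteDimensional ℝ E]
  (g : E → E →L[ℝ] E →L[ℝ] ℝ)

/-- The derivative `∂_h g(u, w)` at `y`. -/
def metricDeriv (y h u w : E) : ℝ := fderiv ℝ (fun z ↦ g z u w) y h

/-- The Christoffel symbols of the first kind of the metric `g`, as a linear form in the last
argument. The form is defined by its values on a basis, which makes it linear even at points
where `g` is not differentiable. -/
def christoffelForm (y a b : E) : E →L[ℝ] ℝ :=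
  LinearMap.toContinuousLinearMap ((Module.finBasis ℝ E).constr ℝ fun i ↦
    (metricDeriv g y a b (Module.finBasis ℝ E i) + metricDeriv g y b a (Module.finBasis ℝ E i) -
      metricDeriv g y (Module.finBasis ℝ E i) a b) / 2)

/-- The Christoffel symbols of the second kind of the metric `g`. -/
def christoffelVec (y a b : E) : E := (g y).inverse (christoffelForm g y a b)

variable {g} {s : Set E} {y : E}

theorem differentiableAt_metric (hg : DifferentiableAt ℝ g y) (u w : E) :
    DifferentiableAt ℝ (fun z ↦ g z u w) y :=
  (hg.clm_apply (differentiableAt_const u)).clm_apply (differentiableAt_const w)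

theorem metricDeriv_add_mid (hg : DifferentiableAt ℝ g y) (h u u' w : E) :
    metricDeriv g y h (u + u') w = metricDeriv g y h u w + metricDeriv g y h u' w := by
  simp only [metricDeriv, map_add, add_apply]
  rw [fderiv_fun_add (differentiableAt_metric hg u w) (differentiableAt_metric hg u' w), add_apply]

theorem metricDeriv_add_right (hg : DifferentiableAt ℝ g y) (h u w w' : E) :
    metricDeriv g y h u (w + w') = metricDeriv g y h u w + metricDeriv g y h u w' := by
  simp only [metricDeriv, map_add]
  rw [fderiv_fun_add (differentiableAt_metric hg u w) (differentiableAt_metric hg u w'), add_apply]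

theorem metricDeriv_smul_mid (hg : DifferentiableAt ℝ g y) (h u w : E) (r : ℝ) :
    metricDeriv g y h (r • u) w = r * metricDeriv g y h u w := by
  simp only [metricDeriv, map_smul, smul_apply]
  rw [fderiv_fun_const_smul (differentiableAt_metric hg u w), smul_apply, smul_eq_mul]

theorem metricDeriv_smul_right (hg : DifferentiableAt ℝ g y) (h u w : E) (r : ℝ) :
    metricDeriv g y h u (r • w) = r * metricDeriv g y h u w := by
  simp only [metricDeriv, map_smul]
  rw [fderiv_fun_const_smul (differentiableAt_metric hg u w), smul_apply, smul_eq_mul]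

theorem christoffelForm_apply (hg : DifferentiableAt ℝ g y) (a b c : E) :
    christoffelForm g y a b c =
      (metricDeriv g y a b c + metricDeriv g y b a c - metricDeriv g y c a b) / 2 := by
  let ℓ : E →ₗ[ℝ] ℝ :=
    { toFun := fun c ↦ (metricDeriv g y a b c + metricDeriv g y b a c - metricDeriv g y c a b) / 2
      map_add' := fun c c' ↦ by
        rw [metricDeriv_add_right hg, metricDeriv_add_right hg]
        simp only [metricDeriv, map_add]
        ring
      map_smul' := fun r c ↦ by
        rw [metricDeriv_smul_right hg, metricDeriv_smul_right hg]
        simp only [metricDeriv, map_smul, smul_eq_mul, RingHom.id_apply]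
        ring }
  have h : (Module.finBasis ℝ E).constr ℝ (fun i ↦ ℓ (Module.finBasis ℝ E i)) = ℓ :=
    (Module.finBasis ℝ E).constr_self ℝ ℓ
  exact DFunLike.congr_fun h c

theorem christoffelVec_smul_smul (hg : DifferentiableAt ℝ g y) (a b : E) (r s : ℝ) :
    christoffelVec g y (r • a) (s • b) = (r * s) • christoffelVec g y a b := by
  rw [christoffelVec, christoffelVec, ← map_smul]
  congr 1
  ext c
  rw [smul_apply, christoffelForm_apply hg, christoffelForm_apply hg]
  simp only [metricDeriv_smul_mid hg, metricDeriv_smul_right hg, smul_eq_mul]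
  simp only [metricDeriv, map_smul, smul_eq_mul]
  ring

theorem christoffelVec_add_right (hg : DifferentiableAt ℝ g y) (a b b' : E) :
    christoffelVec g y a (b + b') = christoffelVec g y a b + christoffelVec g y a b' := by
  rw [christoffelVec, christoffelVec, christoffelVec, ← map_add]
  congr 1
  ext c
  rw [add_apply, christoffelForm_apply hg, christoffelForm_apply hg, christoffelForm_apply hg]
  simp only [metricDeriv_add_mid hg, metricDeriv_add_right hg]
  simp only [metricDeriv, map_add]
  ring

theorem contDiffOn_metricDeriv (hs : IsOpen s) (hg : ContDiffOn ℝ ∞ g s) :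
    ContDiffOn ℝ 1 (fun z : E × E × E × E ↦ metricDeriv g z.1 z.2.1 z.2.2.1 z.2.2.2)
      (s ×ˢ univ) := by
  -- `∂_h g(u, w)` is a partial derivative of the smooth function `(y, u, w) ↦ g_y(u, w)`
  have hG : ContDiffOn ℝ ∞ (fun z : E × E × E ↦ g z.1 z.2.1 z.2.2) (s ×ˢ univ) := by
    refine ((hg.comp contDiff_fst.contDiffOn fun z hz ↦ hz.1).clm_apply ?_).clm_apply ?_
    · exact (contDiff_fst.comp contDiff_snd).contDiffOn
    · exact (contDiff_snd.comp contDiff_snd).contDiffOn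
  have hso : IsOpen (s ×ˢ (univ : Set (E × E))) := hs.prod isOpen_univ
  have hD := hG.fderiv_of_isOpen (m := 1) hso (by norm_cast)
  have h1 : ContDiff ℝ 1 (fun z : E × E × E × E ↦ (z.1, z.2.2.1, z.2.2.2)) := by fun_prop
  have h2 : ContDiff ℝ 1 (fun z : E × E × E × E ↦ (z.2.1, (0 : E), (0 : E))) := by fun_prop
  refine ((hD.comp h1.contDiffOn fun z hz ↦ ⟨hz.1, mem_univ _⟩).clm_apply h2.contDiffOn).congr ?_
  rintro ⟨y, h, u, w⟩ ⟨hy, -⟩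
  have hd : DifferentiableAt ℝ (fun z : E × E × E ↦ g z.1 z.2.1 z.2.2) (y, u, w) :=
    (hG.contDiffAt (hso.mem_nhds ⟨hy, mem_univ _⟩)).differentiableAt (by simp)
  have hi : HasFDerivAt (fun z : E ↦ (z, u, w)) (ContinuousLinearMap.inl ℝ E (E × E)) y :=
    (hasFDerivAt_id y).prodMk (hasFDerivAt_const _ _)
  have hc := HasFDerivAt.comp (g := fun z : E × E × E ↦ g z.1 z.2.1 z.2.2) y hd.hasFDerivAt hi
  change metricDeriv g y h u w = _
  change fderiv ℝ ((fun z : E × E × E ↦ g z.1 z.2.1 z.2.2) ∘ fun z ↦ (z, u, w)) y h = _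
  rw [hc.fderiv]
  rfl

set_option synthInstance.maxHeartbeats 400000 in
/-- The Christoffel symbols are `C¹` jointly in the point and in both arguments; this regularity
is what the Picard-Lindelöf theorem needs. -/
theorem contDiffOn_christoffelVec (hs : IsOpen s) (hg : ContDiffOn ℝ ∞ g s)
    (hinv : ∀ y ∈ s, (g y).IsInvertible) :
    ContDiffOn ℝ 1 (fun z : E × E × E ↦ christoffelVec g z.1 z.2.1 z.2.2) (s ×ˢ univ) := by
  have hg' : ContDiffOn ℝ 1 (fun z : E × E × E ↦ g z.1) (s ×ˢ univ) :=
    (hg.of_le (by simp)).comp contDiff_fst.contDiffOn fun z hz ↦ hz.1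
  have hinv' : ContDiffOn ℝ 1 (fun z : E × E × E ↦ (g z.1).inverse) (s ×ˢ univ) := by
    intro z hz
    obtain ⟨e, he⟩ := hinv z.1 hz.1
    have h := contDiffAt_map_inverse (n := 1) e
    rw [he] at h
    exact h.comp_contDiffWithinAt z (hg' z hz)
  refine hinv'.clm_apply ?_
  rw [contDiffOn_clm_apply]
  intro c
  have hD := contDiffOn_metricDeriv hs hg
  have h1 : ContDiff ℝ 1 (fun z : E × E × E ↦ (z.1, z.2.1, z.2.2, c)) := by fun_prop
  have h2 : ContDiff ℝ 1 (fun z : E × E × E ↦ (z.1, z.2.2, z.2.1, c)) := by fun_prop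
  have h3 : ContDiff ℝ 1 (fun z : E × E × E ↦ (z.1, c, z.2.1, z.2.2)) := by fun_prop
  refine ((((hD.comp h1.contDiffOn fun z hz ↦ ⟨hz.1, mem_univ _⟩).add
    (hD.comp h2.contDiffOn fun z hz ↦ ⟨hz.1, mem_univ _⟩)).sub
    (hD.comp h3.contDiffOn fun z hz ↦ ⟨hz.1, mem_univ _⟩)).div_const 2).congr fun z hz ↦ ?_
  exact christoffelForm_apply
    ((hg.contDiffAt (hs.mem_nhds hz.1)).differentiableAt (by simp)) _ _ _

end ChristoffelAlgebra

/-! ### The metric and its Christoffel symbols in a chart -/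

section ChartMetric

variable {E : Type*} [NormedAddCommGroup E] [NormedSpace ℝ E]
  {M : Type*} [TopologicalSpace M] [ChartedSpace E M]

/-- The derivative `T_x M → E` at `x` of the chart around `p`. -/
def dchart (p x : M) : TangentSpace 𝓘(ℝ, E) x →L[ℝ] E :=
  mfderiv 𝓘(ℝ, E) 𝓘(ℝ, E) (extChartAt 𝓘(ℝ, E) p) x

/-- The derivative at `y` of the inverse of the chart around `p`. -/
def dchartSymm (p : M) (y : E) : E →L[ℝ] TangentSpace 𝓘(ℝ, E) ((extChartAt 𝓘(ℝ, E) p).symm y) :=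
  mfderiv 𝓘(ℝ, E) 𝓘(ℝ, E) (extChartAt 𝓘(ℝ, E) p).symm y

theorem fieldInChart_eq (p : M) (γ : ℝ → M) (V : ∀ t, TangentSpace 𝓘(ℝ, E) (γ t)) (t : ℝ) :
    fieldInChart p γ V t = dchart p (γ t) (V t) := rfl

variable [IsManifold 𝓘(ℝ, E) ∞ M]

theorem dchart_dchartSymm {p : M} {y : E} (hy : y ∈ (extChartAt 𝓘(ℝ, E) p).target) (v : E) :
    dchart p _ (dchartSymm p y v) = v := by
  have h := mfderiv_extChartAt_comp_mfderivWithin_extChartAt_symm (I := 𝓘(ℝ, E)) hy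
  rw [modelWithCornersSelf_coe, range_id, mfderivWithin_univ] at h
  exact DFunLike.congr_fun h v

theorem dchartSymm_dchart {p : M} {y : E} (hy : y ∈ (extChartAt 𝓘(ℝ, E) p).target)
    (v : TangentSpace 𝓘(ℝ, E) ((extChartAt 𝓘(ℝ, E) p).symm y)) :
    dchartSymm p y (dchart p _ v) = v := by
  have h := mfderivWithin_extChartAt_symm_comp_mfderiv_extChartAt (I := 𝓘(ℝ, E)) hy
  rw [modelWithCornersSelf_coe, range_id, mfderivWithin_univ] at h
  exact DFunLike.congr_fun h v

theorem dchart_injective {p x : M} (hx : x ∈ (extChartAt 𝓘(ℝ, E) p).source) :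
    Function.Injective (dchart (E := E) p x) := by
  obtain ⟨y, hy, rfl⟩ := (extChartAt 𝓘(ℝ, E) p).symm.surjOn hx
  exact Function.LeftInverse.injective (g := dchartSymm p y) (dchartSymm_dchart hy)

theorem dchart_surjective {p x : M} (hx : x ∈ (extChartAt 𝓘(ℝ, E) p).source) :
    Function.Surjective (dchart (E := E) p x) := by
  obtain ⟨y, hy, rfl⟩ := (extChartAt 𝓘(ℝ, E) p).symm.surjOn hx
  exact Function.RightInverse.surjective (g := dchartSymm p y) (dchart_dchartSymm hy)

theorem trivializationAt_eq_dchart {p x : M} (hx : x ∈ (extChartAt 𝓘(ℝ, E) p).source)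
    (v : TangentSpace 𝓘(ℝ, E) x) :
    trivializationAt E (TangentSpace 𝓘(ℝ, E)) p (⟨x, v⟩ : TangentBundle 𝓘(ℝ, E) M) =
      (x, dchart p x v) := by
  have hx' : x ∈ (chartAt E p).source := by simpa using hx
  have h := TangentBundle.continuousLinearMapAt_trivializationAt (I := 𝓘(ℝ, E)) hx'
  have h2 := DFunLike.congr_fun h v
  rw [Trivialization.continuousLinearMapAt_apply, Trivialization.linearMapAt_apply,
    if_pos (by simpa using hx')] at h2
  exact Prod.ext rfl h2

variable [RiemannianBundle (fun x : M ↦ TangentSpace 𝓘(ℝ, E) x)]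

theorem chartMetric_eq (p : M) (y u w : E) :
    chartMetric p y u w = inner ℝ (dchartSymm p y u) (dchartSymm p y w) := rfl

theorem chartMetric_dchart {p x : M} (hx : x ∈ (extChartAt 𝓘(ℝ, E) p).source)
    (u w : TangentSpace 𝓘(ℝ, E) x) :
    chartMetric p (extChartAt 𝓘(ℝ, E) p x) (dchart p x u) (dchart p x w) = inner ℝ u w := by
  obtain ⟨y, hy, rfl⟩ := (extChartAt 𝓘(ℝ, E) p).symm.surjOn hx
  have hy : y ∈ (extChartAt 𝓘(ℝ, E) p).target := hy
  rw [(extChartAt 𝓘(ℝ, E) p).right_inv hy, chartMetric_eq, dchartSymm_dchart hy,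
    dchartSymm_dchart hy]

variable [FiniteDimensional ℝ E]

/-- The metric in the coordinates of the chart around `p`, as a continuous bilinear form. -/
def metricForm (p : M) (y : E) : E →L[ℝ] E →L[ℝ] ℝ :=
  LinearMap.toContinuousLinearMap
    ((LinearMap.toContinuousLinearMap : (E →ₗ[ℝ] ℝ) ≃ₗ[ℝ] E →L[ℝ] ℝ).toLinearMap ∘ₗ
      LinearMap.mk₂ ℝ (chartMetric p y)
        (fun _ _ _ ↦ by simp only [chartMetric_eq, map_add, inner_add_left])
        (fun _ _ _ ↦ by simp only [chartMetric_eq, map_smul, real_inner_smul_left, smul_eq_mul])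
        (fun _ _ _ ↦ by simp only [chartMetric_eq, map_add, inner_add_right])
        (fun _ _ _ ↦ by simp only [chartMetric_eq, map_smul, real_inner_smul_right, smul_eq_mul]))

theorem metricForm_apply (p : M) (y u w : E) : metricForm p y u w = chartMetric p y u w := rfl

theorem metricForm_symm (p : M) (y u w : E) : metricForm p y u w = metricForm p y w u := by
  simp only [metricForm_apply, chartMetric_eq, real_inner_comm]

theorem metricForm_isInvertible {p : M} {y : E} (hy : y ∈ (extChartAt 𝓘(ℝ, E) p).target) :
    (metricForm p y).IsInvertible := by
  have hinj : Function.Injective (metricForm p y) := by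
    rw [injective_iff_map_eq_zero]
    intro u hu
    have h : chartMetric p y u u = 0 := by rw [← metricForm_apply, hu]; rfl
    rw [chartMetric_eq, inner_self_eq_zero] at h
    rw [← dchart_dchartSymm hy u, h, map_zero]
  have hdim : Module.finrank ℝ E = Module.finrank ℝ (E →L[ℝ] ℝ) := by
    rw [← (LinearMap.toContinuousLinearMap : (E →ₗ[ℝ] ℝ) ≃ₗ[ℝ] E →L[ℝ] ℝ).finrank_eq,
      Subspace.dual_finrank_eq.symm]
  refine ⟨(LinearEquiv.ofInjectiveOfFinrankEq (metricForm p y).toLinearMap hinj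
    hdim).toContinuousLinearEquiv, ?_⟩
  ext u w
  rfl

variable [IsContMDiffRiemannianBundle 𝓘(ℝ, E) ∞ E (fun x : M ↦ TangentSpace 𝓘(ℝ, E) x)]

theorem contDiffOn_metricForm (p : M) :
    ContDiffOn ℝ ∞ (metricForm (E := E) p) (extChartAt 𝓘(ℝ, E) p).target := by
  rw [contDiffOn_clm_apply]
  intro u
  rw [contDiffOn_clm_apply]
  intro w
  have key : ∀ v : E, ContMDiffOn 𝓘(ℝ, E) 𝓘(ℝ, E).tangent ∞
      (fun y ↦ (⟨(extChartAt 𝓘(ℝ, E) p).symm y, dchartSymm p y v⟩ : TangentBundle 𝓘(ℝ, E) M))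
      (extChartAt 𝓘(ℝ, E) p).target := by
    intro v y hy
    have hs : (extChartAt 𝓘(ℝ, E) p).symm y ∈ (extChartAt 𝓘(ℝ, E) p).source :=
      (extChartAt 𝓘(ℝ, E) p).map_target hy
    have hmem : (⟨(extChartAt 𝓘(ℝ, E) p).symm y, dchartSymm p y v⟩ : TangentBundle 𝓘(ℝ, E) M) ∈
        (trivializationAt E (TangentSpace 𝓘(ℝ, E)) p).source := by
      simpa using hs
    refine (Trivialization.contMDiffWithinAt_iff (F := E) (IB := 𝓘(ℝ, E)) (IM := 𝓘(ℝ, E))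
      (f := fun y ↦ (⟨(extChartAt 𝓘(ℝ, E) p).symm y, dchartSymm p y v⟩ : TangentBundle 𝓘(ℝ, E) M))
      hmem).2 ⟨contMDiffOn_extChartAt_symm p y hy, ?_⟩
    refine (contMDiffWithinAt_const (c := v)).congr_of_eventuallyEq ?_ ?_
    · filter_upwards [self_mem_nhdsWithin] with z hz
      rw [trivializationAt_eq_dchart ((extChartAt 𝓘(ℝ, E) p).map_target hz), dchart_dchartSymm hz]
    · rw [trivializationAt_eq_dchart hs, dchart_dchartSymm hy]
  rw [← contMDiffOn_iff_contDiffOn]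
  exact ContMDiffOn.inner_bundle (IB := 𝓘(ℝ, E)) (F := E)
    (E := fun x : M ↦ TangentSpace 𝓘(ℝ, E) x) (b := (extChartAt 𝓘(ℝ, E) p).symm)
    (v := fun y ↦ dchartSymm p y u) (w := fun y ↦ dchartSymm p y w) (key u) (key w)

theorem differentiableAt_metricForm {p : M} {y : E}
    (hy : y ∈ (extChartAt 𝓘(ℝ, E) p).target) : DifferentiableAt ℝ (metricForm p) y :=
  ((contDiffOn_metricForm p).contDiffAt
    ((isOpen_extChartAt_target p).mem_nhds hy)).differentiableAt (by simp)

theorem christoffel_eq {p : M} {y : E} (hy : y ∈ (extChartAt 𝓘(ℝ, E) p).target) (a b c : E) :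
    christoffel p y a b c = christoffelForm (metricForm p) y a b c := by
  rw [christoffelForm_apply (differentiableAt_metricForm hy)]
  rfl

theorem metricForm_christoffelVec {p : M} {y : E} (hy : y ∈ (extChartAt 𝓘(ℝ, E) p).target)
    (a b c : E) :
    metricForm p y (christoffelVec (metricForm p) y a b) c = christoffel p y a b c := by
  rw [christoffel_eq hy, christoffelVec, (metricForm_isInvertible hy).self_apply_inverse]

/-- The equation of a parallel field, in weak form on the left and solved for the derivative on the
right. -/
theorem parallel_eq_iff {p : M} {y : E} (hy : y ∈ (extChartAt 𝓘(ℝ, E) p).target) (v a b : E) :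
    (∀ c, chartMetric p y v c + christoffel p y a b c = 0) ↔
      v = -christoffelVec (metricForm p) y a b := by
  rw [eq_neg_iff_add_eq_zero]
  constructor
  · intro h
    apply (metricForm_isInvertible hy).injective
    ext c
    rw [map_add, add_apply, metricForm_christoffelVec hy, metricForm_apply, h]
    simp
  · intro h c
    rw [← metricForm_christoffelVec hy, ← metricForm_apply, ← add_apply, ← map_add, h]
    simp

end ChartMetric

/-! ### Derivatives of the metric and change of coordinates -/

section ChristoffelCalculus

variable {E : Type*} [NormedAddCommGroup E] [NormedSpace ℝ E] [FiniteDimensional ℝ E]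
  {g g' : E → E →L[ℝ] E →L[ℝ] ℝ} {y : E}

/-- The Leibniz rule for `g_y(u, w)`, all three arguments varying. -/
theorem hasFDerivAt_metric (hg : ContDiffAt ℝ 1 g y) (u w : E) :
    ∃ D : E × E × E →L[ℝ] ℝ,
      HasFDerivAt (fun z : E × E × E ↦ g z.1 z.2.1 z.2.2) D (y, u, w) ∧
      ∀ h u' w', D (h, u', w') = metricDeriv g y h u w + g y u' w + g y u w' := by
  have hd : DifferentiableAt ℝ (fun z : E × E × E ↦ g z.1 z.2.1 z.2.2) (y, u, w) := by
    have h1 : ContDiffAt ℝ 1 (fun z : E × E × E ↦ g z.1) (y, u, w) :=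
      ContDiffAt.comp (f := fun z : E × E × E ↦ z.1) (g := g) (y, u, w) hg contDiffAt_fst
    have h2 : ContDiffAt ℝ 1 (fun z : E × E × E ↦ z.2.1) (y, u, w) := by fun_prop
    have h3 : ContDiffAt ℝ 1 (fun z : E × E × E ↦ z.2.2) (y, u, w) := by fun_prop
    exact ((h1.clm_apply h2).clm_apply h3).differentiableAt (by simp)
  refine ⟨_, hd.hasFDerivAt, fun h u' w' ↦ ?_⟩
  have e1 : HasFDerivAt (fun z : E ↦ (z, u, w)) (ContinuousLinearMap.inl ℝ E (E × E)) y :=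
    (hasFDerivAt_id y).prodMk (hasFDerivAt_const _ _)
  have e2 : HasFDerivAt (fun z : E × E ↦ (y, z))
      (ContinuousLinearMap.inr ℝ E (E × E)) (u, w) :=
    (hasFDerivAt_const _ _).prodMk (hasFDerivAt_id _)
  have c1 := HasFDerivAt.comp (g := fun z : E × E × E ↦ g z.1 z.2.1 z.2.2) y hd.hasFDerivAt e1
  have c2 := HasFDerivAt.comp (g := fun z : E × E × E ↦ g z.1 z.2.1 z.2.2) (u, w)
    hd.hasFDerivAt e2
  have c2' : HasFDerivAt (fun z : E × E ↦ g y z.1 z.2) _ (u, w) :=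
    (g y).isBoundedBilinearMap.hasFDerivAt (u, w)
  have r1 := DFunLike.congr_fun c1.fderiv h
  have r2 := DFunLike.congr_fun (c2.unique c2') (u', w')
  have hsplit : ((h, u', w') : E × E × E) = ContinuousLinearMap.inl ℝ E (E × E) h +
    ContinuousLinearMap.inr ℝ E (E × E) (u', w') := by simp
  rw [hsplit, map_add, add_assoc]
  refine congrArg₂ _ r1.symm (r2.trans ?_)
  simp [IsBoundedBilinearMap.deriv_apply]
  rw [add_comm]

theorem hasDerivAt_metric {c u w : ℝ → E} {c' u' w' : E} {t : ℝ}
    (hg : ContDiffAt ℝ 1 g (c t)) (hc : HasDerivAt c c' t) (hu : HasDerivAt u u' t)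
    (hw : HasDerivAt w w' t) :
    HasDerivAt (fun s ↦ g (c s) (u s) (w s))
      (metricDeriv g (c t) c' (u t) (w t) + g (c t) u' (w t) + g (c t) (u t) w') t := by
  obtain ⟨D, hD, hD'⟩ := hasFDerivAt_metric hg (u t) (w t)
  rw [← hD']
  exact HasFDerivAt.comp_hasDerivAt (l := fun z : E × E × E ↦ g z.1 z.2.1 z.2.2) t hD
    (hc.prodMk (hu.prodMk hw))

theorem hasDerivAt_fderiv_apply {φ : E → E} {c v : ℝ → E} {c' v' : E} {t : ℝ} (hcy : c t = y)
    (hd : DifferentiableAt ℝ (fderiv ℝ φ) y) (hc : HasDerivAt c c' t) (hv : HasDerivAt v v' t) :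
    HasDerivAt (fun s ↦ fderiv ℝ φ (c s) (v s))
      (fderiv ℝ (fderiv ℝ φ) y c' (v t) + fderiv ℝ φ y v') t := by
  subst hcy
  exact (hd.hasFDerivAt.comp_hasDerivAt t hc).clm_apply hv

/-- Compatibility of the Levi-Civita connection with the metric. -/
theorem metricDeriv_eq_add (hg : ContDiffAt ℝ 1 g y) (hinv : (g y).IsInvertible)
    (hsymm : ∀ z u w, g z u w = g z w u) (a u w : E) :
    metricDeriv g y a u w =
      g y (christoffelVec g y a u) w + g y u (christoffelVec g y a w) := by
  rw [hsymm y u, christoffelVec, christoffelVec, hinv.self_apply_inverse, hinv.self_apply_inverse,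
    christoffelForm_apply (hg.differentiableAt (by simp)),
    christoffelForm_apply (hg.differentiableAt (by simp))]
  have h : ∀ a b c, metricDeriv g y a b c = metricDeriv g y a c b := fun a b c ↦ by
    simp only [metricDeriv, hsymm _ b c]
  rw [h a w u]
  ring

/-- The transformation law of the Christoffel symbols of the first kind under a change of
coordinates `φ` that carries the metric `g` to `g'`. -/
theorem christoffelForm_transform {φ : E → E} (hφ : ContDiffAt ℝ ∞ φ y)
    (hg : ContDiffAt ℝ 1 g y) (hg' : ContDiffAt ℝ 1 g' (φ y))
    (hsymm : ∀ z u w, g' z u w = g' z w u)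
    (h : ∀ᶠ z in 𝓝 y, ∀ a b, g z a b = g' (φ z) (fderiv ℝ φ z a) (fderiv ℝ φ z b))
    (a b c : E) :
    christoffelForm g y a b c =
      christoffelForm g' (φ y) (fderiv ℝ φ y a) (fderiv ℝ φ y b) (fderiv ℝ φ y c) +
        g' (φ y) (fderiv ℝ (fderiv ℝ φ) y a b) (fderiv ℝ φ y c) := by
  have hd : DifferentiableAt ℝ (fderiv ℝ φ) y :=
    (hφ.fderiv_right (m := 1) (by norm_cast)).differentiableAt (by simp)
  have hD : ∀ k u w : E, metricDeriv g y k u w =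
      metricDeriv g' (φ y) (fderiv ℝ φ y k) (fderiv ℝ φ y u) (fderiv ℝ φ y w) +
        g' (φ y) (fderiv ℝ (fderiv ℝ φ) y k u) (fderiv ℝ φ y w) +
        g' (φ y) (fderiv ℝ φ y u) (fderiv ℝ (fderiv ℝ φ) y k w) := by
    intro k u w
    have hline : HasDerivAt (fun s : ℝ ↦ y + s • k) k 0 := by
      simpa using ((hasDerivAt_id (0 : ℝ)).smul_const k).const_add y
    have hy0 : y + (0 : ℝ) • k = y := by simp
    have hφl : HasDerivAt (fun s : ℝ ↦ φ (y + s • k)) (fderiv ℝ φ y k) 0 := by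
      have h1 := (hφ.differentiableAt (by simp)).hasFDerivAt
      nth_rw 2 [← hy0] at h1
      exact h1.comp_hasDerivAt 0 hline
    have hdl : ∀ u : E, HasDerivAt (fun s : ℝ ↦ fderiv ℝ φ (y + s • k) u)
        (fderiv ℝ (fderiv ℝ φ) y k u) 0 := by
      intro u
      have h1 := hasDerivAt_fderiv_apply hy0 hd hline (hasDerivAt_const (0 : ℝ) u)
      rwa [map_zero, add_zero] at h1
    have e1 := hasDerivAt_metric (g := g') (by simpa using! hg') hφl (hdl u) (hdl w)
    have e2 := hasDerivAt_metric (g := g) (by simpa using! hg) hline (hasDerivAt_const 0 u)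
      (hasDerivAt_const 0 w)
    have hev : (fun s : ℝ ↦ g (y + s • k) u w) =ᶠ[𝓝 0] fun s ↦
        g' (φ (y + s • k)) (fderiv ℝ φ (y + s • k) u) (fderiv ℝ φ (y + s • k) w) := by
      have ht : Tendsto (fun s : ℝ ↦ y + s • k) (𝓝 0) (𝓝 y) := by
        simpa using hline.continuousAt.tendsto
      filter_upwards [ht.eventually h] with s hs using hs u w
    have e3 := e2.unique (e1.congr_of_eventuallyEq hev)
    simpa using e3
  have hs : ∀ a b, fderiv ℝ (fderiv ℝ φ) y a b = fderiv ℝ (fderiv ℝ φ) y b a := fun a b ↦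
    (hφ.isSymmSndFDerivAt (by rw [minSmoothness_of_isRCLikeNormedField]; norm_cast)) a b
  rw [christoffelForm_apply (hg.differentiableAt (by simp)),
    christoffelForm_apply (hg'.differentiableAt (by simp)), hD, hD, hD, hs b a, hs c a, hs c b,
    hsymm (φ y) (fderiv ℝ φ y b), hsymm (φ y) (fderiv ℝ φ y a)
      (fderiv ℝ (fderiv ℝ φ) y b c)]
  ring

end ChristoffelCalculus

/-! ### The equation of parallel fields in one chart and in all charts -/

section ParallelAt

variable {E : Type*} [NormedAddCommGroup E] [NormedSpace ℝ E]
  {M : Type*} [TopologicalSpace M] [ChartedSpace E M]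
  [RiemannianBundle (fun x : M ↦ TangentSpace 𝓘(ℝ, E) x)]

/-- The equation of a parallel field, at the single time `t`. -/
def ParallelAt (γ : ℝ → M) (V : ∀ t, TangentSpace 𝓘(ℝ, E) (γ t)) (t : ℝ) : Prop :=
  ∀ p : M, γ t ∈ (extChartAt 𝓘(ℝ, E) p).source →
    DifferentiableAt ℝ (fieldInChart p γ V) t ∧
    ∀ a : E,
      chartMetric p (extChartAt 𝓘(ℝ, E) p (γ t)) (deriv (fieldInChart p γ V) t) a +
        christoffel p (extChartAt 𝓘(ℝ, E) p (γ t))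
          (deriv (fun s ↦ extChartAt 𝓘(ℝ, E) p (γ s)) t) (fieldInChart p γ V t) a = 0

variable {γ : ℝ → M} {V W : ∀ t, TangentSpace 𝓘(ℝ, E) (γ t)} {t : ℝ}

theorem ParallelAt.congr (h : ParallelAt γ V t) (hVW : ∀ᶠ s in 𝓝 t, V s = W s) :
    ParallelAt γ W t := by
  intro p hp
  have he : fieldInChart p γ V =ᶠ[𝓝 t] fieldInChart p γ W := by
    filter_upwards [hVW] with s hs
    rw [fieldInChart, fieldInChart, hs]
  obtain ⟨h1, h2⟩ := h p hp
  refine ⟨h1.congr_of_eventuallyEq he.symm, ?_⟩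
  rw [← he.deriv_eq, ← he.eq_of_nhds]
  exact h2

variable [IsManifold 𝓘(ℝ, E) ∞ M]

theorem hasDerivAt_chart (hγ : MDifferentiableAt 𝓘(ℝ, ℝ) 𝓘(ℝ, E) γ t) {p : M}
    (hp : γ t ∈ (extChartAt 𝓘(ℝ, E) p).source) :
    HasDerivAt (fun s ↦ extChartAt 𝓘(ℝ, E) p (γ s)) (fieldInChart p γ (velocity E γ) t) t := by
  have h1 : MDifferentiableAt 𝓘(ℝ, E) 𝓘(ℝ, E) (extChartAt 𝓘(ℝ, E) p) (γ t) :=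
    mdifferentiableAt_extChartAt (by simpa using hp)
  have h2 := h1.hasMFDerivAt.comp t hγ.hasMFDerivAt
  have h3 : HasFDerivAt (fun s ↦ extChartAt 𝓘(ℝ, E) p (γ s))
      ((dchart p (γ t)).comp (mfderiv 𝓘(ℝ, ℝ) 𝓘(ℝ, E) γ t) : ℝ →L[ℝ] E) t :=
    hasMFDerivAt_iff_hasFDerivAt.1 h2
  exact h3.hasDerivAt

theorem eventually_mem_source (hγ : MDifferentiableAt 𝓘(ℝ, ℝ) 𝓘(ℝ, E) γ t) {p : M}
    (hp : γ t ∈ (extChartAt 𝓘(ℝ, E) p).source) :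
    ∀ᶠ s in 𝓝 t, γ s ∈ (extChartAt 𝓘(ℝ, E) p).source :=
  hγ.continuousAt.eventually_mem ((isOpen_extChartAt_source p).mem_nhds hp)

variable [FiniteDimensional ℝ E]
  [IsContMDiffRiemannianBundle 𝓘(ℝ, E) ∞ E (fun x : M ↦ TangentSpace 𝓘(ℝ, E) x)]

theorem contDiffAt_metricForm {p : M} {y : E} (hy : y ∈ (extChartAt 𝓘(ℝ, E) p).target) :
    ContDiffAt ℝ 1 (metricForm p) y :=
  ((contDiffOn_metricForm p).contDiffAt
    ((isOpen_extChartAt_target p).mem_nhds hy)).of_le (by simp)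

theorem ParallelAt.hasDerivAt (h : ParallelAt γ V t)
    (hγ : MDifferentiableAt 𝓘(ℝ, ℝ) 𝓘(ℝ, E) γ t) {p : M}
    (hp : γ t ∈ (extChartAt 𝓘(ℝ, E) p).source) :
    HasDerivAt (fieldInChart p γ V)
      (-christoffelVec (metricForm p) (extChartAt 𝓘(ℝ, E) p (γ t))
        (fieldInChart p γ (velocity E γ) t) (fieldInChart p γ V t)) t := by
  obtain ⟨h1, h2⟩ := h p hp
  rw [(hasDerivAt_chart hγ hp).deriv] at h2
  rw [← (parallel_eq_iff ((extChartAt 𝓘(ℝ, E) p).map_source hp) _ _ _).1 h2]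
  exact h1.hasDerivAt

/-- The inner product of two fields that are parallel at time `t` has derivative zero there, because
the connection is compatible with the metric. -/
theorem ParallelAt.hasDerivAt_inner (hV : ParallelAt γ V t) (hW : ParallelAt γ W t)
    (hγ : MDifferentiableAt 𝓘(ℝ, ℝ) 𝓘(ℝ, E) γ t) :
    HasDerivAt (fun s ↦ inner ℝ (V s) (W s)) 0 t := by
  have hp : γ t ∈ (extChartAt 𝓘(ℝ, E) (γ t)).source := mem_extChartAt_source _
  have hy := (extChartAt 𝓘(ℝ, E) (γ t)).map_source hp
  have h := hasDerivAt_metric (g := metricForm (γ t)) (contDiffAt_metricForm hy)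
    (hasDerivAt_chart hγ hp) (hV.hasDerivAt hγ hp) (hW.hasDerivAt hγ hp)
  rw [metricDeriv_eq_add (contDiffAt_metricForm hy) (metricForm_isInvertible hy)
    (metricForm_symm _)] at h
  have h0 : ∀ a b : ℝ, a + b + -a + -b = 0 := fun a b ↦ by ring
  simp only [map_neg, neg_apply, h0] at h
  refine h.congr_of_eventuallyEq ?_
  filter_upwards [eventually_mem_source hγ hp] with s hs
  rw [metricForm_apply, fieldInChart_eq, fieldInChart_eq, chartMetric_dchart hs]

/-- Coordinates of a tangent vector change by the derivative of the transition map. -/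
theorem dchart_transition {p q x : M} (hp : x ∈ (extChartAt 𝓘(ℝ, E) p).source)
    (hq : x ∈ (extChartAt 𝓘(ℝ, E) q).source) (v : TangentSpace 𝓘(ℝ, E) x) :
    dchart q x v = fderiv ℝ (extChartAt 𝓘(ℝ, E) q ∘ (extChartAt 𝓘(ℝ, E) p).symm)
      (extChartAt 𝓘(ℝ, E) p x) (dchart p x v) := by
  obtain ⟨y, hy, rfl⟩ := (extChartAt 𝓘(ℝ, E) p).symm.surjOn hp
  have hy : y ∈ (extChartAt 𝓘(ℝ, E) p).target := hy
  have h1 : MDifferentiableAt 𝓘(ℝ, E) 𝓘(ℝ, E) (extChartAt 𝓘(ℝ, E) q)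
      ((extChartAt 𝓘(ℝ, E) p).symm y) :=
    mdifferentiableAt_extChartAt (by simpa using hq)
  have h2 : MDifferentiableAt 𝓘(ℝ, E) 𝓘(ℝ, E) (extChartAt 𝓘(ℝ, E) p).symm y :=
    ((contMDiffOn_extChartAt_symm (n := 1) p).mdifferentiableOn (by simp)).mdifferentiableAt
      ((isOpen_extChartAt_target p).mem_nhds hy)
  have h3 : HasFDerivAt (extChartAt 𝓘(ℝ, E) q ∘ (extChartAt 𝓘(ℝ, E) p).symm)
      ((dchart q _).comp (dchartSymm p y) : E →L[ℝ] E) y :=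
    hasMFDerivAt_iff_hasFDerivAt.1 (h1.hasMFDerivAt.comp y h2.hasMFDerivAt)
  rw [(extChartAt 𝓘(ℝ, E) p).right_inv hy, h3.fderiv]
  exact congrArg (dchart q _) (dchartSymm_dchart hy v).symm

theorem contDiffAt_transition {p q x : M} (hp : x ∈ (extChartAt 𝓘(ℝ, E) p).source)
    (hq : x ∈ (extChartAt 𝓘(ℝ, E) q).source) :
    ContDiffAt ℝ ∞ (extChartAt 𝓘(ℝ, E) q ∘ (extChartAt 𝓘(ℝ, E) p).symm)
      (extChartAt 𝓘(ℝ, E) p x) := by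
  have hy := (extChartAt 𝓘(ℝ, E) p).map_source hp
  have h1 : ContMDiffAt 𝓘(ℝ, E) 𝓘(ℝ, E) ∞ (extChartAt 𝓘(ℝ, E) q)
      ((extChartAt 𝓘(ℝ, E) p).symm (extChartAt 𝓘(ℝ, E) p x)) := by
    rw [(extChartAt 𝓘(ℝ, E) p).left_inv hp]
    exact contMDiffAt_extChartAt' (by simpa using hq)
  have h2 : ContMDiffAt 𝓘(ℝ, E) 𝓘(ℝ, E) ∞ (extChartAt 𝓘(ℝ, E) p).symm
      (extChartAt 𝓘(ℝ, E) p x) :=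
    (contMDiffOn_extChartAt_symm p).contMDiffAt ((isOpen_extChartAt_target p).mem_nhds hy)
  exact (h1.comp _ h2).contDiffAt

/-- The equation of parallel fields in one chart implies the equation in all charts. -/
theorem parallelAt_of_hasDerivAt (hγ : MDifferentiableAt 𝓘(ℝ, ℝ) 𝓘(ℝ, E) γ t) {p : M}
    (hp : γ t ∈ (extChartAt 𝓘(ℝ, E) p).source)
    (h : HasDerivAt (fieldInChart p γ V)
      (-christoffelVec (metricForm p) (extChartAt 𝓘(ℝ, E) p (γ t))
        (fieldInChart p γ (velocity E γ) t) (fieldInChart p γ V t)) t) :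
    ParallelAt γ V t := by
  intro q hq
  set φ := extChartAt 𝓘(ℝ, E) q ∘ (extChartAt 𝓘(ℝ, E) p).symm with hφdef
  have hyp := (extChartAt 𝓘(ℝ, E) p).map_source hp
  have hyq := (extChartAt 𝓘(ℝ, E) q).map_source hq
  have hφ := contDiffAt_transition hp hq
  have hφy : φ (extChartAt 𝓘(ℝ, E) p (γ t)) = extChartAt 𝓘(ℝ, E) q (γ t) := by
    simp only [φ, Function.comp_apply, (extChartAt 𝓘(ℝ, E) p).left_inv hp]
  have hd : DifferentiableAt ℝ (fderiv ℝ φ) (extChartAt 𝓘(ℝ, E) p (γ t)) :=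
    (hφ.fderiv_right (m := 1) (by norm_cast)).differentiableAt (by simp)
  have hev : fieldInChart q γ V =ᶠ[𝓝 t] fun s ↦
      fderiv ℝ φ (extChartAt 𝓘(ℝ, E) p (γ s)) (fieldInChart p γ V s) := by
    filter_upwards [eventually_mem_source hγ hp, eventually_mem_source hγ hq] with s h1 h2
    exact dchart_transition h1 h2 (V s)
  have hder := (hasDerivAt_fderiv_apply rfl hd (hasDerivAt_chart hγ hp) h).congr_of_eventuallyEq
    hev
  refine ⟨hder.differentiableAt, ?_⟩
  have hvel : fieldInChart q γ (velocity E γ) t = fderiv ℝ φ (extChartAt 𝓘(ℝ, E) p (γ t))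
      (fieldInChart p γ (velocity E γ) t) := dchart_transition hp hq _
  rw [hder.deriv, (hasDerivAt_chart hγ hq).deriv, hvel, hev.eq_of_nhds, ← hφy]
  have htrans : ∀ᶠ z in 𝓝 (extChartAt 𝓘(ℝ, E) p (γ t)), ∀ a b,
      metricForm p z a b = metricForm q (φ z) (fderiv ℝ φ z a) (fderiv ℝ φ z b) := by
    have hs := (continuousAt_extChartAt_symm'' hyp).eventually_mem
      ((isOpen_extChartAt_source q).mem_nhds
        (by rw [(extChartAt 𝓘(ℝ, E) p).left_inv hp]; exact hq))
    filter_upwards [(isOpen_extChartAt_target p).mem_nhds hyp, hs] with z hz hzq a b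
    have hzp := (extChartAt 𝓘(ℝ, E) p).map_target hz
    have e1 := dchart_transition hzp hzq (dchartSymm p z a)
    have e2 := dchart_transition hzp hzq (dchartSymm p z b)
    rw [(extChartAt 𝓘(ℝ, E) p).right_inv hz, dchart_dchartSymm hz] at e1 e2
    rw [metricForm_apply, metricForm_apply, ← e1, ← e2]
    exact (chartMetric_dchart hzq _ _).symm
  have hsurj : Function.Surjective (fderiv ℝ φ (extChartAt 𝓘(ℝ, E) p (γ t))) := by
    intro b
    obtain ⟨v, rfl⟩ := dchart_surjective hq b
    exact ⟨dchart p _ v, (dchart_transition hp hq v).symm⟩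
  intro a'
  obtain ⟨a, rfl⟩ := hsurj a'
  have hyq' : φ (extChartAt 𝓘(ℝ, E) p (γ t)) ∈ (extChartAt 𝓘(ℝ, E) q).target := hφy ▸ hyq
  have key := christoffelForm_transform (g := metricForm p) (g' := metricForm q) hφ
    (contDiffAt_metricForm hyp) (contDiffAt_metricForm hyq') (metricForm_symm q)
    htrans (fieldInChart p γ (velocity E γ) t) (fieldInChart p γ V t) a
  rw [christoffel_eq hyq', ← metricForm_apply, ContinuousLinearMap.map_add₂,
    ← htrans.self_of_nhds, ContinuousLinearMap.map_neg₂, metricForm_christoffelVec hyp,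
    christoffel_eq hyp, key]
  ring

end ParallelAt

/-! ### Local flows of `C¹` vector fields -/

section LocalFlow

variable {F : Type*} [NormedAddCommGroup F] [NormedSpace ℝ F] [CompleteSpace F]

/-- The local flow of a `C¹` vector field. The ball of radius `ρ` traps the flow lines and carries
the Lipschitz bound that makes them unique. -/
theorem exists_localFlow {X : F → F} {z₀ : F} (hX : ContDiffAt ℝ 1 X z₀) {O : Set F}
    (hO : O ∈ 𝓝 z₀) :
    ∃ ρ > 0, Metric.ball z₀ ρ ⊆ O ∧ (∃ K, LipschitzOnWith K X (Metric.ball z₀ ρ)) ∧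
      ∃ r > 0, ∃ ε > 0, ∃ α : F → ℝ → F,
        (∀ z ∈ Metric.ball z₀ r, α z 0 = z ∧
          ∀ s ∈ Ioo (-ε) ε, α z s ∈ Metric.ball z₀ ρ ∧ HasDerivAt (α z) (X (α z s)) s) ∧
        ∀ s ∈ Ioo (-ε) ε, ContinuousOn (fun z ↦ α z s) (Metric.ball z₀ r) := by
  obtain ⟨K, S, hS, hK⟩ := hX.exists_lipschitzOnWith
  obtain ⟨ρ, hρ, hUS⟩ := Metric.mem_nhds_iff.1 (inter_mem hS hO)
  obtain ⟨ε, hε, a, r, L, K', hr, hPL⟩ := IsPicardLindelof.of_contDiffAt_one hX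
  obtain ⟨α, hα, hαc⟩ := (hPL 0).exists_forall_mem_closedBall_eq_hasDerivWithinAt_continuousOn
  simp only [zero_sub, zero_add] at hα hαc
  have hr' : (0 : ℝ) < r := hr
  have hnhds : Metric.closedBall z₀ r ×ˢ Icc (-ε) ε ∈ 𝓝 (z₀, (0 : ℝ)) :=
    prod_mem_nhds (Metric.closedBall_mem_nhds z₀ hr') (Icc_mem_nhds (by linarith) hε)
  have hα0 : α (z₀, 0) = z₀ := (hα z₀ (Metric.mem_closedBall_self hr'.le)).1
  have hev : ∀ᶠ x in 𝓝 (z₀, (0 : ℝ)), α x ∈ Metric.ball z₀ ρ :=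
    (hαc.continuousAt hnhds).eventually_mem (by rw [hα0]; exact Metric.ball_mem_nhds _ hρ)
  obtain ⟨δ, hδ, hball⟩ := Metric.eventually_nhds_iff_ball.1 hev
  refine ⟨ρ, hρ, fun x hx ↦ (hUS hx).2, ⟨K, hK.mono fun x hx ↦ (hUS hx).1⟩, min r δ,
    lt_min hr' hδ, min ε δ, lt_min hε hδ, fun z s ↦ α (z, s), ?_, ?_⟩
  · intro z hz
    have hzr : z ∈ Metric.closedBall z₀ r :=
      Metric.ball_subset_closedBall (Metric.ball_subset_ball (min_le_left _ _) hz)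
    refine ⟨(hα z hzr).1, fun s hs ↦ ⟨hball _ ?_, ?_⟩⟩
    · rw [Metric.mem_ball, Prod.dist_eq, max_lt_iff]
      refine ⟨(Metric.mem_ball.1 hz).trans_le (min_le_right _ _), ?_⟩
      rw [dist_zero_right, Real.norm_eq_abs, abs_lt]
      exact ⟨(neg_le_neg (min_le_right ε δ)).trans_lt hs.1, hs.2.trans_le (min_le_right _ _)⟩
    · have h1 : -ε < s := (neg_le_neg (min_le_left ε δ)).trans_lt hs.1
      have h2 : s < ε := hs.2.trans_le (min_le_left _ _)
      exact ((hα z hzr).2 s ⟨h1.le, h2.le⟩).hasDerivAt (Icc_mem_nhds h1 h2)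
  · intro s hs
    have h1 : -ε < s := (neg_le_neg (min_le_left ε δ)).trans_lt hs.1
    have h2 : s < ε := hs.2.trans_le (min_le_left _ _)
    refine hαc.comp (by fun_prop) fun z hz ↦ ⟨?_, h1.le, h2.le⟩
    exact Metric.ball_subset_closedBall (Metric.ball_subset_ball (min_le_left _ _) hz)

end LocalFlow

/-! ### Uniqueness and continuous dependence for geodesics and parallel fields -/

section GeodesicField

variable {E : Type*} [NormedAddCommGroup E] [NormedSpace ℝ E]
  {M : Type*} [TopologicalSpace M] [ChartedSpace E M]

/-- The position, the velocity and the value of the field `V`, in the chart around `p`. -/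
def stateCoord (p : M) (γ : ℝ → M) (V : ∀ t, TangentSpace 𝓘(ℝ, E) (γ t)) (t : ℝ) : E × E × E :=
  (extChartAt 𝓘(ℝ, E) p (γ t), fieldInChart p γ (velocity E γ) t, fieldInChart p γ V t)

variable [RiemannianBundle (fun x : M ↦ TangentSpace 𝓘(ℝ, E) x)] [FiniteDimensional ℝ E]

/-- The vector field whose integral curves are the geodesics with a parallel field along them,
in the chart around `p`. -/
def geodesicField (p : M) (z : E × E × E) : E × E × E :=
  (z.2.1, -christoffelVec (metricForm p) z.1 z.2.1 z.2.1,
    -christoffelVec (metricForm p) z.1 z.2.1 z.2.2)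

variable [IsManifold 𝓘(ℝ, E) ∞ M]
  [IsContMDiffRiemannianBundle 𝓘(ℝ, E) ∞ E (fun x : M ↦ TangentSpace 𝓘(ℝ, E) x)]

theorem contDiffOn_geodesicField (p : M) :
    ContDiffOn ℝ 1 (geodesicField (E := E) p) ((extChartAt 𝓘(ℝ, E) p).target ×ˢ univ) := by
  have h := contDiffOn_christoffelVec (isOpen_extChartAt_target (I := 𝓘(ℝ, E)) p)
    (contDiffOn_metricForm p)
    (fun y hy ↦ metricForm_isInvertible (E := E) (p := p) hy)
  have h1 : ContDiff ℝ 1 (fun z : E × E × E ↦ z.2.1) := by fun_prop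
  have h2 : ContDiff ℝ 1 (fun z : E × E × E ↦ (z.1, z.2.1, z.2.1)) := by fun_prop
  exact h1.contDiffOn.prodMk ((h.comp h2.contDiffOn fun z hz ↦ ⟨hz.1, mem_univ _⟩).neg.prodMk h.neg)

theorem exists_localFlow_geodesicField {p : M} {z₀ : E × E × E}
    (hz₀ : z₀.1 ∈ (extChartAt 𝓘(ℝ, E) p).target) :
    ∃ ρ > 0, Metric.ball z₀ ρ ⊆ (extChartAt 𝓘(ℝ, E) p).target ×ˢ univ ∧
      (∃ K, LipschitzOnWith K (geodesicField p) (Metric.ball z₀ ρ)) ∧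
      ∃ r > 0, ∃ ε > 0, ∃ α : E × E × E → ℝ → E × E × E,
        (∀ z ∈ Metric.ball z₀ r, α z 0 = z ∧
          ∀ s ∈ Ioo (-ε) ε, α z s ∈ Metric.ball z₀ ρ ∧
            HasDerivAt (α z) (geodesicField p (α z s)) s) ∧
        ∀ s ∈ Ioo (-ε) ε, ContinuousOn (fun z ↦ α z s) (Metric.ball z₀ r) := by
  have ho : (extChartAt 𝓘(ℝ, E) p).target ×ˢ (univ : Set (E × E)) ∈ 𝓝 z₀ :=
    ((isOpen_extChartAt_target p).prod isOpen_univ).mem_nhds ⟨hz₀, mem_univ _⟩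
  have : CompleteSpace E := FiniteDimensional.complete ℝ E
  exact exists_localFlow ((contDiffOn_geodesicField p).contDiffAt ho) ho

variable {γ : ℝ → M} {V : ∀ t, TangentSpace 𝓘(ℝ, E) (γ t)} {t : ℝ}

theorem hasDerivAt_stateCoord (hγ : IsGeodesic E γ) (hV : IsParallelAlong γ V) {p : M}
    (hp : γ t ∈ (extChartAt 𝓘(ℝ, E) p).source) :
    HasDerivAt (stateCoord p γ V) (geodesicField p (stateCoord p γ V t)) t :=
  (hasDerivAt_chart (hγ.1 t) hp).prodMk
    ((ParallelAt.hasDerivAt (hγ.2 t) (hγ.1 t) hp).prodMk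
      (ParallelAt.hasDerivAt (hV.2 t) (hV.1 t) hp))

variable [T2Space M]

/-- A geodesic with a parallel field follows the local flow in a chart for as long as the flow
is defined; in particular it does not leave the chart before. -/
theorem stateCoord_eq_of_flow {p : M} (hγ : IsGeodesic E γ) (hV : IsParallelAlong γ V)
    (hp : γ t ∈ (extChartAt 𝓘(ℝ, E) p).source) {U : Set (E × E × E)} (hU : IsOpen U)
    (hUt : U ⊆ (extChartAt 𝓘(ℝ, E) p).target ×ˢ univ)
    (hUL : ∃ K, LipschitzOnWith K (geodesicField p) U) {ε : ℝ} (hε : 0 < ε) {c : ℝ → E × E × E}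
    (hc0 : c 0 = stateCoord p γ V t)
    (hc : ∀ s ∈ Ioo (-ε) ε, c s ∈ U ∧ HasDerivAt c (geodesicField p (c s)) s) :
    ∀ s ∈ Ioo (-ε) ε, γ (t + s) ∈ (extChartAt 𝓘(ℝ, E) p).source ∧
      stateCoord p γ V (t + s) = c s := by
  obtain ⟨K, hK⟩ := hUL
  have hderiv : ∀ s, γ (t + s) ∈ (extChartAt 𝓘(ℝ, E) p).source →
      HasDerivAt (fun s ↦ stateCoord p γ V (t + s))
        (geodesicField p (stateCoord p γ V (t + s))) s := fun s hs ↦ by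
    simpa using (hasDerivAt_stateCoord hγ hV hs).comp_const_add t s
  have hγc : ∀ s, ContinuousAt (fun s ↦ γ (t + s)) s := fun s ↦
    (hγ.1.continuous.comp (continuous_const.add continuous_id)).continuousAt
  set A : Set ℝ := {s | s ∈ Ioo (-ε) ε ∧ γ (t + s) ∈ (extChartAt 𝓘(ℝ, E) p).source ∧
      stateCoord p γ V (t + s) = c s} with hA
  suffices h : Ioo (-ε) ε ⊆ A from fun s hs ↦ (h hs).2
  -- `A` is open by uniqueness for the equation, and closed in the interval because the flow line
  -- stays in the target of the chart, so that `γ` cannot reach the boundary of the source.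
  refine isPreconnected_Ioo.subset_of_closure_inter_subset ?_ ⟨0, ?_, ?_⟩ ?_
  · rw [isOpen_iff_mem_nhds]
    rintro s ⟨hs, hsp, hsc⟩
    have e0 : ∀ᶠ s' in 𝓝 s, s' ∈ Ioo (-ε) ε := isOpen_Ioo.mem_nhds hs
    have e1 : ∀ᶠ s' in 𝓝 s, γ (t + s') ∈ (extChartAt 𝓘(ℝ, E) p).source :=
      (hγc s).eventually_mem ((isOpen_extChartAt_source p).mem_nhds hsp)
    have e2 : ∀ᶠ s' in 𝓝 s, stateCoord p γ V (t + s') ∈ U :=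
      (hderiv s hsp).continuousAt.eventually_mem (by rw [hsc]; exact hU.mem_nhds (hc s hs).1)
    have e3 := ODE_solution_unique_of_eventually (v := fun _ ↦ geodesicField p) (s := fun _ ↦ U)
      (Eventually.of_forall fun _ ↦ hK) (f := fun s ↦ stateCoord p γ V (t + s)) (g := c)
      (by filter_upwards [e1, e2] with s' h1 h2 using ⟨hderiv s' h1, h2⟩)
      (by filter_upwards [e0] with s' h0 using ⟨(hc s' h0).2, (hc s' h0).1⟩) hsc
    filter_upwards [e0, e1, e3] with s' h0 h1 h3 using ⟨h0, h1, h3⟩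
  · exact ⟨by linarith, hε⟩
  · exact ⟨⟨by linarith, hε⟩, by simpa using hp, by simpa using hc0.symm⟩
  · rintro s ⟨hsA, hs⟩
    have hne : (𝓝[A] s).NeBot := mem_closure_iff_nhdsWithin_neBot.1 hsA
    have hcs := (hc s hs).2.continuousAt
    have ht : (c s).1 ∈ (extChartAt 𝓘(ℝ, E) p).target := (hUt (hc s hs).1).1
    have h1 : Tendsto (fun s ↦ (extChartAt 𝓘(ℝ, E) p).symm (c s).1) (𝓝[A] s)
        (𝓝 ((extChartAt 𝓘(ℝ, E) p).symm (c s).1)) :=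
      ((continuousAt_extChartAt_symm'' ht).tendsto.comp
        (continuous_fst.continuousAt.tendsto.comp hcs)).mono_left nhdsWithin_le_nhds
    have h2 : Tendsto (fun s ↦ γ (t + s)) (𝓝[A] s) (𝓝 (γ (t + s))) :=
      (hγc s).tendsto.mono_left nhdsWithin_le_nhds
    have h3 : (fun s ↦ γ (t + s)) =ᶠ[𝓝[A] s] fun s ↦ (extChartAt 𝓘(ℝ, E) p).symm (c s).1 := by
      filter_upwards [self_mem_nhdsWithin] with s' hs'
      rw [← hs'.2.2]
      exact ((extChartAt 𝓘(ℝ, E) p).left_inv hs'.2.1).symm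
    have h4 : γ (t + s) = (extChartAt 𝓘(ℝ, E) p).symm (c s).1 :=
      tendsto_nhds_unique h2 (h1.congr' h3.symm)
    have h5 : γ (t + s) ∈ (extChartAt 𝓘(ℝ, E) p).source := by
      rw [h4]; exact (extChartAt 𝓘(ℝ, E) p).map_target ht
    refine ⟨hs, h5, tendsto_nhds_unique (f := fun s ↦ stateCoord p γ V (t + s)) (l := 𝓝[A] s)
      ((hderiv s h5).continuousAt.tendsto.mono_left nhdsWithin_le_nhds)
      ((hcs.tendsto.mono_left nhdsWithin_le_nhds).congr' ?_)⟩
    filter_upwards [self_mem_nhdsWithin] with s' hs' using hs'.2.2.symm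

/-- Convergence at time `t` of the positions, of the velocities and of the values of the fields. -/
def StateTendsto {ι : Type*} (l : Filter ι) (γs : ι → ℝ → M)
    (Vs : ∀ i t, TangentSpace 𝓘(ℝ, E) (γs i t)) (γ : ℝ → M)
    (V : ∀ t, TangentSpace 𝓘(ℝ, E) (γ t)) (t : ℝ) : Prop :=
  Tendsto (fun i ↦ (⟨γs i t, velocity E (γs i) t⟩ : TangentBundle 𝓘(ℝ, E) M)) l
      (𝓝 ⟨γ t, velocity E γ t⟩) ∧
    Tendsto (fun i ↦ (⟨γs i t, Vs i t⟩ : TangentBundle 𝓘(ℝ, E) M)) l (𝓝 ⟨γ t, V t⟩)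

theorem tendsto_tangent_iff {ι : Type*} {l : Filter ι} {x : ι → M}
    {v : ∀ i, TangentSpace 𝓘(ℝ, E) (x i)} {x₀ : M} {v₀ : TangentSpace 𝓘(ℝ, E) x₀} {p : M}
    (hp : x₀ ∈ (extChartAt 𝓘(ℝ, E) p).source) :
    Tendsto (fun i ↦ (⟨x i, v i⟩ : TangentBundle 𝓘(ℝ, E) M)) l (𝓝 ⟨x₀, v₀⟩) ↔
      Tendsto x l (𝓝 x₀) ∧ Tendsto (fun i ↦ dchart p (x i) (v i)) l (𝓝 (dchart p x₀ v₀)) := by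
  have hmem : (⟨x₀, v₀⟩ : TangentBundle 𝓘(ℝ, E) M) ∈
      (trivializationAt E (TangentSpace 𝓘(ℝ, E)) p).source := by simpa using hp
  rw [Trivialization.tendsto_nhds_iff _ hmem, trivializationAt_eq_dchart hp]
  refine and_congr_right fun h ↦ tendsto_congr' ?_
  have hx : Tendsto x l (𝓝 x₀) := h
  filter_upwards [hx.eventually_mem ((isOpen_extChartAt_source (I := 𝓘(ℝ, E)) p).mem_nhds hp)]
    with i hi
  rw [trivializationAt_eq_dchart hi]

variable {ι : Type*} {l : Filter ι} {γs : ι → ℝ → M}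
  {Vs : ∀ i t, TangentSpace 𝓘(ℝ, E) (γs i t)}

theorem tendsto_chart_iff {x : ι → M} {x₀ p : M} (hp : x₀ ∈ (extChartAt 𝓘(ℝ, E) p).source) :
    Tendsto x l (𝓝 x₀) ↔ (∀ᶠ i in l, x i ∈ (extChartAt 𝓘(ℝ, E) p).source) ∧
      Tendsto (fun i ↦ extChartAt 𝓘(ℝ, E) p (x i)) l (𝓝 (extChartAt 𝓘(ℝ, E) p x₀)) := by
  constructor
  · intro h
    exact ⟨h.eventually_mem ((isOpen_extChartAt_source (I := 𝓘(ℝ, E)) p).mem_nhds hp),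
      (continuousAt_extChartAt' hp).tendsto.comp h⟩
  · rintro ⟨h1, h2⟩
    have h3 := (continuousAt_extChartAt_symm' hp).tendsto.comp h2
    rw [(extChartAt 𝓘(ℝ, E) p).left_inv hp] at h3
    refine h3.congr' ?_
    filter_upwards [h1] with i hi using (extChartAt 𝓘(ℝ, E) p).left_inv hi

theorem stateTendsto_iff {p : M} (hp : γ t ∈ (extChartAt 𝓘(ℝ, E) p).source) :
    StateTendsto l γs Vs γ V t ↔
      (∀ᶠ i in l, γs i t ∈ (extChartAt 𝓘(ℝ, E) p).source) ∧
        Tendsto (fun i ↦ stateCoord p (γs i) (Vs i) t) l (𝓝 (stateCoord p γ V t)) := by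
  rw [StateTendsto, tendsto_tangent_iff hp, tendsto_tangent_iff hp, tendsto_chart_iff hp]
  simp only [stateCoord, nhds_prod_eq, tendsto_prod_iff', fieldInChart_eq]
  tauto

/-- Continuous dependence of geodesics and of parallel fields on the initial conditions. -/
theorem StateTendsto.all (hγ : IsGeodesic E γ) (hV : IsParallelAlong γ V)
    (hγs : ∀ i, IsGeodesic E (γs i)) (hVs : ∀ i, IsParallelAlong (γs i) (Vs i)) {t₀ : ℝ}
    (h0 : StateTendsto l γs Vs γ V t₀) (t : ℝ) : StateTendsto l γs Vs γ V t := by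
  -- Near each time one local flow carries the states at `t` to the states at `t'`. The
  -- neighbourhood `W` serves both directions, so the times of convergence form a clopen set.
  have hloc : ∀ t₁ : ℝ, ∃ W ∈ 𝓝 t₁, ∀ t ∈ W, ∀ t' ∈ W,
      StateTendsto l γs Vs γ V t → StateTendsto l γs Vs γ V t' := by
    intro t₁
    have hp : γ t₁ ∈ (extChartAt 𝓘(ℝ, E) (γ t₁)).source := mem_extChartAt_source _
    obtain ⟨ρ, hρ, hUt, hUL, r, hr, ε, hε, α, hα, hαc⟩ := exists_localFlow_geodesicField
      (z₀ := stateCoord (γ t₁) γ V t₁) ((extChartAt 𝓘(ℝ, E) (γ t₁)).map_source hp)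
    have e1 : ∀ᶠ t in 𝓝 t₁, stateCoord (γ t₁) γ V t ∈
        Metric.ball (stateCoord (γ t₁) γ V t₁) r :=
      (hasDerivAt_stateCoord hγ hV hp).continuousAt.eventually_mem (Metric.ball_mem_nhds _ hr)
    refine ⟨_, inter_mem (inter_mem (eventually_mem_source (hγ.1 t₁) hp) e1)
      (Metric.ball_mem_nhds t₁ (half_pos hε)), ?_⟩
    rintro t ⟨⟨htp, htb⟩, htε⟩ t' ⟨⟨ht'p, -⟩, ht'ε⟩ hst
    simp only [mem_ofPred_eq] at htp htb ht'p
    have hs : t' - t ∈ Ioo (-ε) ε := by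
      rw [Metric.mem_ball, Real.dist_eq, abs_lt] at htε ht'ε
      constructor <;> linarith [htε.1, htε.2, ht'ε.1, ht'ε.2]
    rw [stateTendsto_iff htp] at hst
    rw [stateTendsto_iff ht'p]
    have e2 := hst.2.eventually_mem (Metric.isOpen_ball.mem_nhds htb)
    have key : ∀ᶠ i in l, γs i t' ∈ (extChartAt 𝓘(ℝ, E) (γ t₁)).source ∧
        stateCoord (γ t₁) (γs i) (Vs i) t' =
          α (stateCoord (γ t₁) (γs i) (Vs i) t) (t' - t) := by
      filter_upwards [hst.1, e2] with i hi1 hi2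
      have := stateCoord_eq_of_flow (hγs i) (hVs i) hi1 Metric.isOpen_ball hUt hUL hε (hα _ hi2).1
        (hα _ hi2).2 (t' - t) hs
      rwa [add_sub_cancel] at this
    refine ⟨key.mono fun i hi ↦ hi.1, ?_⟩
    have h1 := stateCoord_eq_of_flow hγ hV htp Metric.isOpen_ball hUt hUL hε (hα _ htb).1
      (hα _ htb).2 (t' - t) hs
    rw [add_sub_cancel] at h1
    rw [h1.2]
    refine (((hαc _ hs).continuousAt (Metric.isOpen_ball.mem_nhds htb)).tendsto.comp
      hst.2).congr' ?_
    filter_upwards [key] with i hi using hi.2.symm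
  have hclopen : IsClopen {t | StateTendsto l γs Vs γ V t} := by
    constructor
    · rw [← isOpen_compl_iff, isOpen_iff_mem_nhds]
      intro t₁ ht₁
      obtain ⟨W, hW, h⟩ := hloc t₁
      filter_upwards [hW] with t ht hst
      exact ht₁ (h t ht t₁ (mem_of_mem_nhds hW) hst)
    · rw [isOpen_iff_mem_nhds]
      intro t₁ ht₁
      obtain ⟨W, hW, h⟩ := hloc t₁
      filter_upwards [hW] with t ht using h t₁ (mem_of_mem_nhds hW) t ht ht₁
  have := hclopen.eq_univ ⟨t₀, h0⟩
  exact (eq_univ_iff_forall.1 this) t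

/-- Uniqueness of geodesics and of parallel fields with given initial conditions: continuous
dependence for a constant family. Equality is stated in the tangent bundle, since the two fields
live along different curves. -/
theorem parallel_unique {γ' : ℝ → M} {V' : ∀ t, TangentSpace 𝓘(ℝ, E) (γ' t)}
    (hγ : IsGeodesic E γ) (hV : IsParallelAlong γ V)
    (hγ' : IsGeodesic E γ') (hV' : IsParallelAlong γ' V') {t₀ : ℝ}
    (h0 : (⟨γ t₀, velocity E γ t₀⟩ : TangentBundle 𝓘(ℝ, E) M) = ⟨γ' t₀, velocity E γ' t₀⟩)
    (h1 : (⟨γ t₀, V t₀⟩ : TangentBundle 𝓘(ℝ, E) M) = ⟨γ' t₀, V' t₀⟩) (t : ℝ) :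
    (⟨γ t, V t⟩ : TangentBundle 𝓘(ℝ, E) M) = ⟨γ' t, V' t⟩ := by
  have h : StateTendsto (pure ()) (fun _ ↦ γ) (fun _ ↦ V) γ' V' t := by
    refine StateTendsto.all hγ' hV' (fun _ ↦ hγ) (fun _ ↦ hV) (t₀ := t₀) ⟨?_, ?_⟩ t
    · rw [← h0]; exact tendsto_const_nhds
    · rw [← h1]; exact tendsto_const_nhds
  have hp : γ' t ∈ (extChartAt 𝓘(ℝ, E) (γ' t)).source := mem_extChartAt_source _
  have h2 := ((tendsto_tangent_iff hp).1 h.2)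
  have h3 : γ t = γ' t := tendsto_nhds_unique tendsto_const_nhds h2.1
  have h4 := tendsto_nhds_unique tendsto_const_nhds h2.2
  have hmem : ∀ z : TangentBundle 𝓘(ℝ, E) M, z.1 = γ' t → z ∈
      (trivializationAt E (TangentSpace 𝓘(ℝ, E)) (γ' t)).source := by
    intro z hz
    simp [hz]
  refine (trivializationAt E (TangentSpace 𝓘(ℝ, E)) (γ' t)).injOn (hmem _ h3) (hmem _ rfl) ?_
  rw [Trivialization.coe_coe, trivializationAt_eq_dchart hp,
    trivializationAt_eq_dchart (by rw [h3]; exact hp), h4, h3]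

end GeodesicField

/-! ### Existence of parallel fields along geodesics -/

section ParallelTransport

variable {E : Type*} [NormedAddCommGroup E] [NormedSpace ℝ E] [FiniteDimensional ℝ E]
  {M : Type*} [TopologicalSpace M] [ChartedSpace E M]
  [RiemannianBundle (fun x : M ↦ TangentSpace 𝓘(ℝ, E) x)]
  [IsManifold 𝓘(ℝ, E) ∞ M]
  [IsContMDiffRiemannianBundle 𝓘(ℝ, E) ∞ E (fun x : M ↦ TangentSpace 𝓘(ℝ, E) x)]
  {γ : ℝ → M} {V W : ∀ t, TangentSpace 𝓘(ℝ, E) (γ t)} {t : ℝ}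

theorem ParallelAt.add (hV : ParallelAt γ V t) (hW : ParallelAt γ W t)
    (hγ : MDifferentiableAt 𝓘(ℝ, ℝ) 𝓘(ℝ, E) γ t) : ParallelAt γ (fun s ↦ V s + W s) t := by
  have hp : γ t ∈ (extChartAt 𝓘(ℝ, E) (γ t)).source := mem_extChartAt_source _
  have hg := differentiableAt_metricForm ((extChartAt 𝓘(ℝ, E) (γ t)).map_source hp)
  have he : fieldInChart (γ t) γ (fun s ↦ V s + W s) =
      fun s ↦ fieldInChart (γ t) γ V s + fieldInChart (γ t) γ W s := by
    ext s
    simp only [fieldInChart_eq, map_add]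
  refine parallelAt_of_hasDerivAt hγ hp ?_
  rw [he]
  simp only
  rw [christoffelVec_add_right hg, neg_add]
  exact (hV.hasDerivAt hγ hp).add (hW.hasDerivAt hγ hp)

theorem ParallelAt.smul (r : ℝ) (hV : ParallelAt γ V t)
    (hγ : MDifferentiableAt 𝓘(ℝ, ℝ) 𝓘(ℝ, E) γ t) : ParallelAt γ (fun s ↦ r • V s) t := by
  have hp : γ t ∈ (extChartAt 𝓘(ℝ, E) (γ t)).source := mem_extChartAt_source _
  have hg := differentiableAt_metricForm ((extChartAt 𝓘(ℝ, E) (γ t)).map_source hp)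
  have he : fieldInChart (γ t) γ (fun s ↦ r • V s) = fun s ↦ r • fieldInChart (γ t) γ V s := by
    ext s
    simp only [fieldInChart_eq, map_smul]
  refine parallelAt_of_hasDerivAt hγ hp ?_
  have h := christoffelVec_smul_smul hg (fieldInChart (γ t) γ (velocity E γ) t)
    (fieldInChart (γ t) γ V t) 1 r
  rw [one_smul, one_mul] at h
  rw [he]
  simp only
  rw [h, ← smul_neg]
  exact (hV.hasDerivAt hγ hp).const_smul r

theorem ParallelAt.zero (hγ : MDifferentiableAt 𝓘(ℝ, ℝ) 𝓘(ℝ, E) γ t) :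
    ParallelAt (E := E) γ (fun _ ↦ 0) t := by
  have hp : γ t ∈ (extChartAt 𝓘(ℝ, E) (γ t)).source := mem_extChartAt_source _
  have hg := differentiableAt_metricForm ((extChartAt 𝓘(ℝ, E) (γ t)).map_source hp)
  have he : fieldInChart (γ t) γ (fun s ↦ (0 : TangentSpace 𝓘(ℝ, E) (γ s))) = fun _ ↦ 0 := by
    ext s
    simp only [fieldInChart_eq, map_zero]
  refine parallelAt_of_hasDerivAt hγ hp ?_
  have h := christoffelVec_smul_smul hg (fieldInChart (γ t) γ (velocity E γ) t) 0 1 0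
  rw [he]
  simp only
  rw [one_smul, zero_smul, mul_zero, zero_smul] at h
  rw [h, neg_zero]
  exact hasDerivAt_const t 0

theorem mdifferentiable_comp_affine (hγ : MDifferentiable 𝓘(ℝ, ℝ) 𝓘(ℝ, E) γ) (a b : ℝ) :
    MDifferentiable 𝓘(ℝ, ℝ) 𝓘(ℝ, E) (fun s ↦ γ (a + b * s)) := by
  have h : Differentiable ℝ (fun s : ℝ ↦ a + b * s) := by fun_prop
  exact hγ.comp h.mdifferentiable

theorem velocity_comp_affine (hγ : MDifferentiable 𝓘(ℝ, ℝ) 𝓘(ℝ, E) γ) (a b s : ℝ) :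
    velocity E (fun s ↦ γ (a + b * s)) s = b • velocity E γ (a + b * s) := by
  have h : HasDerivAt (fun s : ℝ ↦ a + b * s) b s := by
    simpa using ((hasDerivAt_id s).const_mul b).const_add a
  have h1 := ((hγ (a + b * s)).hasMFDerivAt.comp s h.hasFDerivAt.hasMFDerivAt).mfderiv
  have h2 : mfderiv 𝓘(ℝ, ℝ) 𝓘(ℝ, E) (fun s ↦ γ (a + b * s)) s (1 : ℝ) =
      mfderiv 𝓘(ℝ, ℝ) 𝓘(ℝ, E) γ (a + b * s) (b : ℝ) := by
    refine (DFunLike.congr_fun h1 (1 : ℝ)).trans ?_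
    refine congrArg (mfderiv 𝓘(ℝ, ℝ) 𝓘(ℝ, E) γ (a + b * s)) ?_
    exact one_mul b
  exact h2.trans ((congrArg (mfderiv 𝓘(ℝ, ℝ) 𝓘(ℝ, E) γ (a + b * s)) (mul_one b).symm).trans
    (map_smul (mfderiv 𝓘(ℝ, ℝ) 𝓘(ℝ, E) γ (a + b * s)) b (1 : ℝ)))

theorem ParallelAt.comp_affine {a b s : ℝ} (hV : ParallelAt γ V (a + b * s))
    (hγ : MDifferentiable 𝓘(ℝ, ℝ) 𝓘(ℝ, E) γ) :
    ParallelAt (fun s ↦ γ (a + b * s)) (fun s ↦ V (a + b * s)) s := by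
  set p := γ (a + b * s)
  have hp : γ (a + b * s) ∈ (extChartAt 𝓘(ℝ, E) p).source := mem_extChartAt_source _
  have hg := differentiableAt_metricForm ((extChartAt 𝓘(ℝ, E) p).map_source hp)
  refine parallelAt_of_hasDerivAt (mdifferentiable_comp_affine hγ a b s) hp ?_
  have h : HasDerivAt (fun s : ℝ ↦ a + b * s) b s := by
    simpa using ((hasDerivAt_id s).const_mul b).const_add a
  have h1 := (hV.hasDerivAt (hγ _) hp).scomp s h
  have h2 := christoffelVec_smul_smul hg (fieldInChart p γ (velocity E γ) (a + b * s))
    (fieldInChart p γ V (a + b * s)) b 1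
  rw [one_smul, mul_one] at h2
  have h3 : fieldInChart p (fun s ↦ γ (a + b * s)) (velocity E fun s ↦ γ (a + b * s)) s =
      b • fieldInChart p γ (velocity E γ) (a + b * s) := by
    rw [fieldInChart_eq, velocity_comp_affine hγ, map_smul, fieldInChart_eq]
  rw [h3]
  change HasDerivAt _ (-christoffelVec (metricForm p) (extChartAt 𝓘(ℝ, E) p (γ (a + b * s)))
    (b • fieldInChart p γ (velocity E γ) (a + b * s)) (fieldInChart p γ V (a + b * s))) s
  rw [h2, ← smul_neg]
  exact h1

theorem IsParallelAlong.comp_affine (hV : IsParallelAlong γ V) (a b : ℝ) :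
    IsParallelAlong (fun s ↦ γ (a + b * s)) (fun s ↦ V (a + b * s)) :=
  ⟨mdifferentiable_comp_affine hV.1 a b, fun s ↦
    ParallelAt.comp_affine (s := s) (hV.2 (a + b * s)) hV.1⟩

theorem IsGeodesic.comp_affine (hγ : IsGeodesic E γ) (a b : ℝ) :
    IsGeodesic E (fun s ↦ γ (a + b * s)) := by
  refine ⟨mdifferentiable_comp_affine hγ.1 a b, fun s ↦ ?_⟩
  have h : ParallelAt γ (velocity E γ) (a + b * s) := hγ.2 _
  have h1 := (h.comp_affine (s := s) hγ.1).smul b (mdifferentiable_comp_affine hγ.1 a b s)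
  exact h1.congr (Eventually.of_forall fun s ↦ (velocity_comp_affine hγ.1 a b s).symm)

/-- Rescaled pieces of a geodesic are geodesics on `[0, 1]`. -/
theorem IsGeodesic.isGeodesicFrom (hγ : IsGeodesic E γ) (a b : ℝ) :
    IsGeodesicFrom (fun s ↦ γ (a + b * s)) (γ a) (b • velocity E γ a) := by
  refine ⟨hγ.comp_affine a b, ?_⟩
  change (⟨γ (a + b * 0), _⟩ : TangentBundle 𝓘(ℝ, E) M) = _
  rw [velocity_comp_affine hγ.1, mul_zero, add_zero]

theorem inner_eq_of_parallelAt {a b : ℝ} (hγ : MDifferentiable 𝓘(ℝ, ℝ) 𝓘(ℝ, E) γ)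
    (hV : ∀ s ∈ Ioo a b, ParallelAt γ V s) (hW : ∀ s ∈ Ioo a b, ParallelAt γ W s) {s t : ℝ}
    (hs : s ∈ Ioo a b) (ht : t ∈ Ioo a b) : inner ℝ (V s) (W s) = inner ℝ (V t) (W t) := by
  have hd : ∀ s ∈ Ioo a b, HasDerivAt (fun s ↦ inner ℝ (V s) (W s)) 0 s := fun s hs ↦
    (hV s hs).hasDerivAt_inner (hW s hs) (hγ s)
  exact isOpen_Ioo.is_const_of_deriv_eq_zero isPreconnected_Ioo
    (fun s hs ↦ (hd s hs).differentiableAt.differentiableWithinAt)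
    (fun s hs ↦ (hd s hs).deriv) hs ht

/-- Uniqueness of parallel fields on an interval of the same curve, from the constancy of
`‖V - W‖²`. -/
theorem eq_of_parallelAt {a b : ℝ} (hγ : MDifferentiable 𝓘(ℝ, ℝ) 𝓘(ℝ, E) γ)
    (hV : ∀ s ∈ Ioo a b, ParallelAt γ V s) (hW : ∀ s ∈ Ioo a b, ParallelAt γ W s) {s t : ℝ}
    (hs : s ∈ Ioo a b) (ht : t ∈ Ioo a b) (h : V t = W t) : V s = W s := by
  have h1 := inner_eq_of_parallelAt hγ hV hV hs ht
  have h2 := inner_eq_of_parallelAt hγ hV hW hs ht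
  have h3 := inner_eq_of_parallelAt hγ hW hW hs ht
  rw [← sub_eq_zero, ← inner_self_eq_zero (𝕜 := ℝ), inner_sub_left, inner_sub_right,
    inner_sub_right, real_inner_comm (V s) (W s), h1, h2, h3, h]
  ring

theorem inner_eq_of_isParallelAlong (hV : IsParallelAlong γ V) (hW : IsParallelAlong γ W)
    (s t : ℝ) : inner ℝ (V s) (W s) = inner ℝ (V t) (W t) := by
  have hs : s ∈ Ioo (min s t - 1) (max s t + 1) := by
    constructor <;> linarith [min_le_left s t, le_max_left s t]
  have ht : t ∈ Ioo (min s t - 1) (max s t + 1) := by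
    constructor <;> linarith [min_le_right s t, le_max_right s t]
  exact inner_eq_of_parallelAt hV.1 (fun s _ ↦ hV.2 s) (fun s _ ↦ hW.2 s) hs ht

variable [T2Space M]

/-- Around each time there is an interval on which parallel fields exist with any value at any time
of it. Since one interval serves all initial times and values, local solutions can be extended. -/
theorem exists_parallelAt_local (hγ : IsGeodesic E γ) (t₁ : ℝ) :
    ∃ δ > 0, ∀ t ∈ Ioo (t₁ - δ) (t₁ + δ), ∀ v : TangentSpace 𝓘(ℝ, E) (γ t),
      ∃ V : ∀ s, TangentSpace 𝓘(ℝ, E) (γ s), V t = v ∧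
        ∀ s ∈ Ioo (t₁ - δ) (t₁ + δ), ParallelAt γ V s := by
  set p := γ t₁ with hpdef
  have hp : γ t₁ ∈ (extChartAt 𝓘(ℝ, E) p).source := mem_extChartAt_source _
  have h0 : IsParallelAlong γ (fun s ↦ (0 : TangentSpace 𝓘(ℝ, E) (γ s))) :=
    ⟨hγ.1, fun s ↦ ParallelAt.zero (hγ.1 s)⟩
  obtain ⟨ρ, hρ, hUt, hUL, r, hr, ε, hε, α, hα, hαc⟩ := exists_localFlow_geodesicField
    (z₀ := stateCoord p γ (fun _ ↦ 0) t₁) ((extChartAt 𝓘(ℝ, E) p).map_source hp)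
  have hz : ∀ s, stateCoord p γ (fun _ ↦ 0) s = (extChartAt 𝓘(ℝ, E) p (γ s),
      fieldInChart p γ (velocity E γ) s, 0) := fun s ↦ by
    simp only [stateCoord, fieldInChart_eq, map_zero]
  have e1 : ∀ᶠ t in 𝓝 t₁, stateCoord p γ (fun _ ↦ 0) t ∈
      Metric.ball (stateCoord p γ (fun _ ↦ 0) t₁) r :=
    (hasDerivAt_stateCoord hγ h0 hp).continuousAt.eventually_mem (Metric.ball_mem_nhds _ hr)
  obtain ⟨δ, hδ, hδ'⟩ := Metric.eventually_nhds_iff_ball.1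
    ((eventually_mem_source (hγ.1 t₁) hp).and e1)
  rw [Real.ball_eq_Ioo] at hδ'
  refine ⟨min δ (ε / 2), lt_min hδ (half_pos hε), fun t ht v ↦ ?_⟩
  have hsub : ∀ s ∈ Ioo (t₁ - min δ (ε / 2)) (t₁ + min δ (ε / 2)),
      s ∈ Ioo (t₁ - δ) (t₁ + δ) ∧ s - t ∈ Ioo (-ε) ε := fun s hs ↦ by
    have h1 := min_le_left δ (ε / 2)
    have h2 := min_le_right δ (ε / 2)
    obtain ⟨hs1, hs2⟩ := hs
    obtain ⟨ht1, ht2⟩ := ht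
    refine ⟨⟨?_, ?_⟩, ?_, ?_⟩ <;> linarith
  obtain ⟨htp, htb⟩ := hδ' t (hsub t ht).1
  -- By linearity it suffices to solve for a small multiple `k • v`, which lies in the domain of the
  -- flow around the zero field.
  set u := dchart p (γ t) v
  set k : ℝ := r / (2 * (‖u‖ + 1)) with hk
  have hk0 : 0 < k := by positivity
  have hku : ‖k • u‖ < r := by
    rw [norm_smul, Real.norm_of_nonneg hk0.le, hk, div_mul_eq_mul_div, div_lt_iff₀ (by positivity)]
    nlinarith [norm_nonneg u]
  set z : E × E × E := (extChartAt 𝓘(ℝ, E) p (γ t), fieldInChart p γ (velocity E γ) t, k • u)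
    with hzdef
  have hzb : z ∈ Metric.ball (stateCoord p γ (fun _ ↦ 0) t₁) r := by
    rw [hz] at htb ⊢
    rw [hz, Metric.mem_ball, Prod.dist_eq, Prod.dist_eq, max_lt_iff, max_lt_iff] at htb
    rw [Metric.mem_ball, Prod.dist_eq, Prod.dist_eq, max_lt_iff, max_lt_iff]
    exact ⟨htb.1, htb.2.1, by simpa using hku⟩
  obtain ⟨hz0, hzα⟩ := hα z hzb
  -- The first two components of the flow line are the geodesic, whose equation does not involve
  -- the third one.
  have hflow : ∀ s ∈ Ioo (-ε) ε, γ (t + s) ∈ (extChartAt 𝓘(ℝ, E) p).source ∧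
      stateCoord p γ (fun _ ↦ 0) (t + s) = ((α z s).1, (α z s).2.1, 0) := by
    refine stateCoord_eq_of_flow hγ h0 htp Metric.isOpen_ball hUt hUL hε ?_ ?_
    · rw [hz0, hz]
    · intro s hs
      obtain ⟨h1, h2⟩ := hzα s hs
      refine ⟨?_, ?_⟩
      · rw [hz, Metric.mem_ball, Prod.dist_eq, Prod.dist_eq, max_lt_iff, max_lt_iff] at h1
        rw [hz, Metric.mem_ball, Prod.dist_eq, Prod.dist_eq, max_lt_iff, max_lt_iff]
        exact ⟨h1.1, h1.2.1, by simpa using hρ⟩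
      · have h3 : (α z s).1 ∈ (extChartAt 𝓘(ℝ, E) p).target := (hUt h1).1
        have h4 := christoffelVec_smul_smul (differentiableAt_metricForm h3) (α z s).2.1 0 1 0
        rw [one_smul, zero_smul, mul_zero, zero_smul] at h4
        have h5 := h2.fst.prodMk (h2.snd.fst.prodMk (hasDerivAt_const s (0 : E)))
        simp only [geodesicField] at h5 ⊢
        rw [h4, neg_zero]
        exact h5
  have hflow' : ∀ s ∈ Ioo (t₁ - min δ (ε / 2)) (t₁ + min δ (ε / 2)),
      γ s ∈ (extChartAt 𝓘(ℝ, E) p).source ∧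
        extChartAt 𝓘(ℝ, E) p (γ s) = (α z (s - t)).1 ∧
        fieldInChart p γ (velocity E γ) s = (α z (s - t)).2.1 := by
    intro s hs
    obtain ⟨h1, h2⟩ := hflow (s - t) (hsub s hs).2
    rw [add_sub_cancel] at h1 h2
    rw [hz] at h2
    simp only [Prod.mk.injEq] at h2
    exact ⟨h1, h2.1, h2.2.1⟩
  refine ⟨fun s ↦ Function.invFun (dchart p (γ s)) (k⁻¹ • (α z (s - t)).2.2), ?_, ?_⟩
  · refine dchart_injective htp ?_
    rw [Function.rightInverse_invFun (dchart_surjective htp), sub_self, hz0, smul_smul,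
      inv_mul_cancel₀ hk0.ne', one_smul]
  · intro s hs
    have hsp := (hflow' s hs).1
    refine parallelAt_of_hasDerivAt (hγ.1 s) hsp ?_
    have hev : fieldInChart p γ
        (fun s ↦ Function.invFun (dchart p (γ s)) (k⁻¹ • (α z (s - t)).2.2)) =ᶠ[𝓝 s]
        fun s ↦ k⁻¹ • (α z (s - t)).2.2 := by
      filter_upwards [eventually_mem_source (hγ.1 s) hsp] with s' hs'
      rw [fieldInChart_eq, Function.rightInverse_invFun (dchart_surjective hs')]
    rw [hev.eq_of_nhds, (hflow' s hs).2.1, (hflow' s hs).2.2]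
    obtain ⟨h1, h2⟩ := hzα (s - t) (hsub s hs).2
    have h3 : (α z (s - t)).1 ∈ (extChartAt 𝓘(ℝ, E) p).target := (hUt h1).1
    have h4 := christoffelVec_smul_smul (differentiableAt_metricForm h3) (α z (s - t)).2.1
      (α z (s - t)).2.2 1 k⁻¹
    rw [one_smul, one_mul] at h4
    rw [h4, ← smul_neg]
    have h5 := ((ContinuousLinearMap.snd ℝ E E).comp
      (ContinuousLinearMap.snd ℝ E (E × E))).hasFDerivAt.comp_hasDerivAt s (h2.comp_sub_const s t)
    exact HasDerivAt.congr_of_eventuallyEq (HasDerivAt.const_smul k⁻¹ h5) hev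

/-- Parallel fields with a given value exist along the whole of a geodesic. -/
theorem exists_isParallelAlong (hγ : IsGeodesic E γ) (t₀ : ℝ) (v : TangentSpace 𝓘(ℝ, E) (γ t₀)) :
    ∃ V : ∀ s, TangentSpace 𝓘(ℝ, E) (γ s), V t₀ = v ∧ IsParallelAlong γ V := by
  set A : Set ℝ := {t | ∃ a b, t₀ ∈ Ioo a b ∧ t ∈ Ioo a b ∧
    ∃ V : ∀ s, TangentSpace 𝓘(ℝ, E) (γ s), V t₀ = v ∧ ∀ s ∈ Ioo a b, ParallelAt γ V s} with hA
  -- `A` is the set of the times that a solution on an interval around `t₀` reaches; it is open and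
  -- closed, and solutions on different intervals are glued by uniqueness.
  have hopen : IsOpen A := by
    rw [isOpen_iff_mem_nhds]
    rintro t ⟨a, b, h0, ht, V, hV⟩
    filter_upwards [isOpen_Ioo.mem_nhds ht] with s hs using ⟨a, b, h0, hs, V, hV⟩
  have hclosed : IsClosed A := by
    rw [← closure_subset_iff_isClosed]
    intro t₁ ht₁
    obtain ⟨δ, hδ, hloc⟩ := exists_parallelAt_local hγ t₁
    obtain ⟨t, htJ, a, b, h0, ht, V, hV0, hV⟩ := mem_closure_iff.1 ht₁ (Ioo (t₁ - δ) (t₁ + δ))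
      isOpen_Ioo ⟨by linarith, by linarith⟩
    obtain ⟨W, hWt, hW⟩ := hloc t htJ (V t)
    classical
    -- on the overlap the two fields agree
    have hVW : ∀ s ∈ Ioo a b, s ∈ Ioo (t₁ - δ) (t₁ + δ) → V s = W s := by
      intro s hs hsJ
      refine eq_of_parallelAt (a := max a (t₁ - δ)) (b := min b (t₁ + δ)) hγ.1
        (fun s hs ↦ hV s ?_) (fun s hs ↦ hW s ?_) (t := t) ?_ ?_ hWt.symm
      · exact ⟨(le_max_left _ _).trans_lt hs.1, hs.2.trans_le (min_le_left _ _)⟩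
      · exact ⟨(le_max_right _ _).trans_lt hs.1, hs.2.trans_le (min_le_right _ _)⟩
      · exact ⟨max_lt hs.1 hsJ.1, lt_min hs.2 hsJ.2⟩
      · exact ⟨max_lt ht.1 htJ.1, lt_min ht.2 htJ.2⟩
    refine ⟨min a (t₁ - δ), max b (t₁ + δ),
      ⟨(min_le_left _ _).trans_lt h0.1, h0.2.trans_le (le_max_left _ _)⟩,
      ⟨(min_le_right _ _).trans_lt (by linarith), lt_of_lt_of_le (by linarith) (le_max_right _ _)⟩,
      fun s ↦ if s ∈ Ioo a b then V s else W s, by simp only [if_pos h0, hV0], fun s hs ↦ ?_⟩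
    have hcase : s ∈ Ioo a b ∨ s ∈ Ioo (t₁ - δ) (t₁ + δ) := by
      obtain ⟨hs1, hs2⟩ := hs
      obtain ⟨ht1, ht2⟩ := ht
      obtain ⟨htJ1, htJ2⟩ := htJ
      rcases le_total s t with hst | hst
      · rcases min_lt_iff.1 hs1 with h | h
        · exact Or.inl ⟨h, by linarith⟩
        · exact Or.inr ⟨h, by linarith⟩
      · rcases lt_max_iff.1 hs2 with h | h
        · exact Or.inl ⟨by linarith, h⟩
        · exact Or.inr ⟨by linarith, h⟩
    rcases hcase with h | h
    · refine (hV s h).congr ?_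
      filter_upwards [isOpen_Ioo.mem_nhds h] with s' hs'
      rw [if_pos hs']
    · refine (hW s h).congr ?_
      filter_upwards [isOpen_Ioo.mem_nhds h] with s' hs'
      split_ifs with h'
      · exact (hVW s' h' hs').symm
      · rfl
  have hall : ∀ t, t ∈ A := by
    obtain ⟨δ, hδ, hloc⟩ := exists_parallelAt_local hγ t₀
    have ht : t₀ ∈ Ioo (t₀ - δ) (t₀ + δ) := ⟨by linarith, by linarith⟩
    obtain ⟨V, hV⟩ := hloc t₀ ht v
    exact eq_univ_iff_forall.1
      (IsClopen.eq_univ ⟨hclosed, hopen⟩ ⟨t₀, t₀ - δ, t₀ + δ, ht, ht, V, hV⟩)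
  choose a b h0 ht V hV0 hV using hall
  have hloc : ∀ t, ∀ s ∈ Ioo (a t) (b t), V s s = V t s := by
    intro t s hs
    refine eq_of_parallelAt (a := max (a s) (a t)) (b := min (b s) (b t)) hγ.1
      (fun u hu ↦ hV s u ?_) (fun u hu ↦ hV t u ?_) (t := t₀) ?_ ?_ ((hV0 s).trans (hV0 t).symm)
    · exact ⟨(le_max_left _ _).trans_lt hu.1, hu.2.trans_le (min_le_left _ _)⟩
    · exact ⟨(le_max_right _ _).trans_lt hu.1, hu.2.trans_le (min_le_right _ _)⟩
    · exact ⟨max_lt (ht s).1 hs.1, lt_min (ht s).2 hs.2⟩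
    · exact ⟨max_lt (h0 s).1 (h0 t).1, lt_min (h0 s).2 (h0 t).2⟩
  refine ⟨fun t ↦ V t t, hV0 t₀, hγ.1, fun t ↦ (hV t t (ht t)).congr ?_⟩
  filter_upwards [isOpen_Ioo.mem_nhds (ht t)] with s hs using (hloc t s hs).symm

end ParallelTransport

/-! ### The exponential map and parallel transport -/

section ExpMap

variable {E : Type*} [NormedAddCommGroup E] [NormedSpace ℝ E] [FiniteDimensional ℝ E]
  {M : Type*} [TopologicalSpace M] [ChartedSpace E M]
  [RiemannianBundle (fun x : M ↦ TangentSpace 𝓘(ℝ, E) x)]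
  [IsManifold 𝓘(ℝ, E) ∞ M]
  [IsContMDiffRiemannianBundle 𝓘(ℝ, E) ∞ E (fun x : M ↦ TangentSpace 𝓘(ℝ, E) x)]
  [T2Space M] {γ γ' : ℝ → M}

theorem IsGeodesicFrom.unique {x : M} {w : TangentSpace 𝓘(ℝ, E) x} (h : IsGeodesicFrom γ x w)
    (h' : IsGeodesicFrom γ' x w) (t : ℝ) :
    (⟨γ t, velocity E γ t⟩ : TangentBundle 𝓘(ℝ, E) M) = ⟨γ' t, velocity E γ' t⟩ :=
  parallel_unique h.1 h.1 h'.1 h'.1 (h.2.trans h'.2.symm) (h.2.trans h'.2.symm) t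

/-- The value of `expMap` does not depend on the geodesic chosen in its definition. -/
theorem expMap_eq {x : M} {w : TangentSpace 𝓘(ℝ, E) x} (h : IsGeodesicFrom γ x w) :
    expMap x w = γ 1 := by
  have hex : ∃ γ : ℝ → M, IsGeodesicFrom γ x w := ⟨γ, h⟩
  rw [expMap, dif_pos hex]
  exact congrArg TotalSpace.proj (hex.choose_spec.unique h 1)

theorem IsGeodesic.expMap_smul (hγ : IsGeodesic E γ) (a b : ℝ) :
    expMap (γ a) (b • velocity E γ a) = γ (a + b) := by
  rw [expMap_eq (hγ.isGeodesicFrom a b), mul_one]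

theorem IsGeodesic.norm_velocity (hγ : IsGeodesic E γ) (s t : ℝ) :
    ‖velocity E γ s‖ = ‖velocity E γ t‖ := by
  have h := inner_eq_of_isParallelAlong hγ hγ s t
  rw [real_inner_self_eq_norm_sq, real_inner_self_eq_norm_sq] at h
  exact (sq_eq_sq₀ (norm_nonneg _) (norm_nonneg _)).1 h

/-- The value of `transportAlong` does not depend on the parallel field chosen in its definition. -/
theorem transportAlong_eq {x y : M} {w u : TangentSpace 𝓘(ℝ, E) x} {u' : TangentSpace 𝓘(ℝ, E) y}
    {V : ∀ t, TangentSpace 𝓘(ℝ, E) (γ t)} (hγ : IsGeodesicFrom γ x w) (hV : IsParallelAlong γ V)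
    (h0 : (⟨γ 0, V 0⟩ : TangentBundle 𝓘(ℝ, E) M) = ⟨x, u⟩)
    (h1 : (⟨γ 1, V 1⟩ : TangentBundle 𝓘(ℝ, E) M) = ⟨y, u'⟩) : transportAlong x y w u = u' := by
  have hex : ∃ (u' : TangentSpace 𝓘(ℝ, E) y) (γ : ℝ → M) (V : ∀ t, TangentSpace 𝓘(ℝ, E) (γ t)),
      IsGeodesicFrom γ x w ∧ IsParallelAlong γ V ∧
      (⟨γ 0, V 0⟩ : TangentBundle 𝓘(ℝ, E) M) = ⟨x, u⟩ ∧
      (⟨γ 1, V 1⟩ : TangentBundle 𝓘(ℝ, E) M) = ⟨y, u'⟩ := ⟨u', γ, V, hγ, hV, h0, h1⟩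
  rw [transportAlong, dif_pos hex]
  obtain ⟨γ₂, V₂, hγ₂, hV₂, h02, h12⟩ := hex.choose_spec
  have h := parallel_unique hγ₂.1 hV₂ hγ.1 hV (hγ₂.2.trans hγ.2.symm) (h02.trans h0.symm) 1
  rw [h12, h1] at h
  exact eq_of_heq (TotalSpace.mk.inj h).2

theorem IsGeodesic.transportAlong_smul {V : ∀ t, TangentSpace 𝓘(ℝ, E) (γ t)}
    (hγ : IsGeodesic E γ) (hV : IsParallelAlong γ V) (a b : ℝ) :
    transportAlong (γ a) (γ (a + b)) (b • velocity E γ a) (V a) = V (a + b) := by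
  refine transportAlong_eq (hγ.isGeodesicFrom a b) (hV.comp_affine a b) ?_ ?_
  · rw [mul_zero, add_zero]
  · rw [mul_one]

/-- Parallel transport along a complete geodesic is a linear isometry. -/
theorem exists_linearIsometry_transportAlong (hc : GeodesicallyComplete E M) {x y : M}
    {w : TangentSpace 𝓘(ℝ, E) x} (hw : expMap x w = y) :
    ∃ T : TangentSpace 𝓘(ℝ, E) x →ₗᵢ[ℝ] TangentSpace 𝓘(ℝ, E) y,
      ∀ u, transportAlong x y w u = T u := by
  obtain ⟨γ, hγ⟩ := hc x w
  have hy : γ 1 = y := (expMap_eq hγ).symm.trans hw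
  subst hy
  obtain ⟨hγ', h0⟩ := hγ
  cases h0
  have hfrom : IsGeodesicFrom γ (γ 0) (velocity E γ 0) := ⟨hγ', rfl⟩
  choose V hV0 hV using exists_isParallelAlong hγ' 0
  have htr : ∀ u, transportAlong (γ 0) (γ 1) (velocity E γ 0) u = V u 1 := fun u ↦
    transportAlong_eq hfrom (hV u) (by rw [hV0]) rfl
  refine ⟨⟨⟨⟨fun u ↦ transportAlong (γ 0) (γ 1) (velocity E γ 0) u, fun u v ↦ ?_⟩,
    fun r u ↦ ?_⟩, fun u ↦ ?_⟩, fun u ↦ rfl⟩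
  · rw [htr u, htr v]
    exact transportAlong_eq hfrom
      ⟨hγ'.1, fun t ↦ ParallelAt.add ((hV u).2 t) ((hV v).2 t) (hγ'.1 t)⟩
      (by rw [hV0, hV0]) rfl
  · change transportAlong (γ 0) (γ 1) (velocity E γ 0) (r • u) =
      r • transportAlong (γ 0) (γ 1) (velocity E γ 0) u
    rw [htr u]
    exact transportAlong_eq hfrom
      ⟨hγ'.1, fun t ↦ ParallelAt.smul r ((hV u).2 t) (hγ'.1 t)⟩ (by rw [hV0]) rfl
  · have h := inner_eq_of_isParallelAlong (hV u) (hV u) 1 0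
    rw [real_inner_self_eq_norm_sq, real_inner_self_eq_norm_sq, hV0] at h
    change ‖transportAlong (γ 0) (γ 1) (velocity E γ 0) u‖ = ‖u‖
    rw [htr u]
    exact (sq_eq_sq₀ (norm_nonneg _) (norm_nonneg _)).1 h

/-- Two solutions of a second-order equation that have the same position at times `0` and `ε`
have the same initial velocity, provided that `ε` is small compared to the Lipschitz constant. -/
theorem velocity_eq_of_position_eq {X : E × E × E → E × E × E} {U : Set (E × E × E)} {K : NNReal}
    (hK : LipschitzOnWith K X U) (hX : ∀ z, (X z).1 = z.2.1) {c c' : ℝ → E × E × E} {ε : ℝ}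
    (hε : 0 < ε) (hε1 : ε ≤ 1) (hKε : 2 * (K * ε) < 1)
    (hc : ∀ s ∈ Icc 0 ε, c s ∈ U ∧ HasDerivAt c (X (c s)) s ∧ (c s).2.2 = 0)
    (hc' : ∀ s ∈ Icc 0 ε, c' s ∈ U ∧ HasDerivAt c' (X (c' s)) s ∧ (c' s).2.2 = 0)
    (h0 : (c 0).1 = (c' 0).1) (h1 : (c ε).1 = (c' ε).1) : (c 0).2.1 = (c' 0).2.1 := by
  -- With `D` the maximum of `‖d‖`, the Lipschitz bound gives `‖d - d 0‖ ≤ K ε D`. Since `e` returns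
  -- to `0` at `ε`, also `‖d 0‖ ≤ K ε D`, so `D ≤ 2 K ε D` and `D = 0`.
  set e : ℝ → E := fun s ↦ (c s).1 - (c' s).1 with he
  set d : ℝ → E := fun s ↦ (c s).2.1 - (c' s).2.1 with hd
  have hsub : ∀ s ∈ Icc 0 ε, HasDerivAt (fun s ↦ c s - c' s) (X (c s) - X (c' s)) s :=
    fun s hs ↦ (hc s hs).2.1.sub (hc' s hs).2.1
  have hed : ∀ s ∈ Icc 0 ε, HasDerivAt e (d s) s := fun s hs ↦ by
    have h := (ContinuousLinearMap.fst ℝ E (E × E)).hasFDerivAt.comp_hasDerivAt s (hsub s hs)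
    have h' : (X (c s) - X (c' s)).1 = d s := by simp [hd, hX]
    rw [← h']
    exact h
  have hdd : ∀ s ∈ Icc 0 ε, HasDerivAt d (X (c s) - X (c' s)).2.1 s := fun s hs ↦
    ((ContinuousLinearMap.fst ℝ E E).comp
      (ContinuousLinearMap.snd ℝ E (E × E))).hasFDerivAt.comp_hasDerivAt s (hsub s hs)
  have hdc : ContinuousOn d (Icc 0 ε) := fun s hs ↦ (hdd s hs).continuousAt.continuousWithinAt
  obtain ⟨m, hm, hmax⟩ := isCompact_Icc.exists_isMaxOn ⟨0, left_mem_Icc.2 hε.le⟩ hdc.norm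
  set D := ‖d m‖ with hD
  have hD0 : 0 ≤ D := norm_nonneg _
  have hdD : ∀ s ∈ Icc 0 ε, ‖d s‖ ≤ D := fun s hs ↦ hmax hs
  have he0 : e 0 = 0 := by simp [he, h0]
  have heD : ∀ s ∈ Icc 0 ε, ‖e s‖ ≤ D := fun s hs ↦ by
    have h := norm_image_sub_le_of_norm_deriv_le_segment'
      (fun s hs ↦ (hed s hs).hasDerivWithinAt) (fun s hs ↦ hdD s (Ico_subset_Icc_self hs)) s hs
    rw [he0, sub_zero, sub_zero] at h
    nlinarith [hs.1, hs.2]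
  have hd' : ∀ s ∈ Icc 0 ε, ‖(X (c s) - X (c' s)).2.1‖ ≤ K * D := fun s hs ↦ by
    have h2 : ‖c s - c' s‖ ≤ D := by
      rw [Prod.norm_def, Prod.norm_def]
      refine max_le (heD s hs) (max_le (hdD s hs) ?_)
      simp [(hc s hs).2.2, (hc' s hs).2.2, hD0]
    calc ‖(X (c s) - X (c' s)).2.1‖ ≤ ‖X (c s) - X (c' s)‖ :=
          (norm_fst_le _).trans (norm_snd_le _)
      _ ≤ K * ‖c s - c' s‖ := hK.norm_sub_le (hc s hs).1 (hc' s hs).1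
      _ ≤ K * D := by gcongr
  have hd0 : ∀ s ∈ Icc 0 ε, ‖d s - d 0‖ ≤ K * D * ε := fun s hs ↦ by
    have h := norm_image_sub_le_of_norm_deriv_le_segment'
      (fun s hs ↦ (hdd s hs).hasDerivWithinAt) (fun s hs ↦ hd' s (Ico_subset_Icc_self hs)) s hs
    refine h.trans ?_
    rw [sub_zero]
    exact mul_le_mul_of_nonneg_left hs.2 (by positivity)
  have hlin : ∀ s ∈ Icc 0 ε, HasDerivAt (fun s ↦ e s - s • d 0) (d s - d 0) s := fun s hs ↦ by
    have h := (hed s hs).sub ((hasDerivAt_id s).smul_const (d 0))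
    rwa [one_smul] at h
  have hend := norm_image_sub_le_of_norm_deriv_le_segment'
    (fun s hs ↦ (hlin s hs).hasDerivWithinAt) (fun s hs ↦ hd0 s (Ico_subset_Icc_self hs)) ε
    (right_mem_Icc.2 hε.le)
  have heε : e ε = 0 := by simp [he, h1]
  rw [heε, he0, zero_smul, sub_zero, sub_zero, sub_zero, zero_sub, norm_neg, norm_smul,
    Real.norm_of_nonneg hε.le] at hend
  have hd00 : ‖d 0‖ ≤ K * D * ε := by
    have : ε * ‖d 0‖ ≤ ε * (K * D * ε) := by linarith
    exact le_of_mul_le_mul_left this hε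
  have hDle : D ≤ 2 * (K * ε) * D := by
    have h3 : ‖d m‖ ≤ ‖d m - d 0‖ + ‖d 0‖ := norm_le_norm_sub_add _ _
    have := hd0 m hm
    linarith
  have hDz : D = 0 := by nlinarith
  have : d 0 = 0 := norm_le_zero_iff.1 (by rw [hDz] at hd00; simpa using hd00)
  exact sub_eq_zero.1 this

/-- The exponential map is injective near the origin of each tangent space. Instead of
differentiating it, one compares two geodesics from `x` in a chart: if they meet again after the
same short time, then they have the same initial velocity. -/
theorem expMap_injective_near_zero (hc : GeodesicallyComplete E M) (x : M) :
    ∃ r > 0, ∀ w w' : TangentSpace 𝓘(ℝ, E) x, ‖w‖ < r → ‖w'‖ < r →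
      expMap x w = expMap x w' → w = w' := by
  have hx : x ∈ (extChartAt 𝓘(ℝ, E) x).source := mem_extChartAt_source _
  obtain ⟨ρ, hρ, hUt, ⟨K, hK⟩, r, hr, ε, hε, α, hα, hαc⟩ := exists_localFlow_geodesicField
    (z₀ := (extChartAt 𝓘(ℝ, E) x x, (0 : E), (0 : E))) ((extChartAt 𝓘(ℝ, E) x).map_source hx)
  set ε₁ : ℝ := min (ε / 2) (1 / (2 * (K + 1))) with hε₁
  have hK0 : (0 : ℝ) ≤ K := K.2
  have h1 : 0 < ε₁ := lt_min (half_pos hε) (by positivity)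
  have h2 : ε₁ < ε := (min_le_left _ _).trans_lt (half_lt_self hε)
  have h3 : ε₁ * (2 * (K + 1)) ≤ 1 := (le_div_iff₀ (by positivity)).1 (min_le_right _ _)
  have h4 : ε₁ ≤ 1 := by nlinarith
  have h5 : 2 * (K * ε₁) < 1 := by nlinarith
  obtain ⟨C, hC0, hC⟩ := (dchart (E := E) x x).isBoundedLinearMap.bound
  refine ⟨ε₁ * r / (C + 1), by positivity, ?_⟩
  -- The geodesic with initial velocity `w / ε₁`, which is at `Exp_x(w)` at the time `ε₁`, where the
  -- flow is still defined.
  have key : ∀ w : TangentSpace 𝓘(ℝ, E) x, ‖w‖ < ε₁ * r / (C + 1) →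
      ∃ c : ℝ → E × E × E, (∀ s ∈ Icc 0 ε₁, c s ∈ Metric.ball
        (extChartAt 𝓘(ℝ, E) x x, (0 : E), (0 : E)) ρ ∧
        HasDerivAt c (geodesicField x (c s)) s ∧ (c s).2.2 = 0) ∧
        c 0 = (extChartAt 𝓘(ℝ, E) x x, ε₁⁻¹ • dchart x x w, 0) ∧
        (c ε₁).1 = extChartAt 𝓘(ℝ, E) x (expMap x w) ∧
        expMap x w ∈ (extChartAt 𝓘(ℝ, E) x).source := by
    intro w hw
    obtain ⟨γ, hγ, h0⟩ := hc x (ε₁⁻¹ • w)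
    have hγ0 : γ 0 = x := congrArg TotalSpace.proj h0
    have hV : IsParallelAlong γ (fun s ↦ (0 : TangentSpace 𝓘(ℝ, E) (γ s))) :=
      ⟨hγ.1, fun s ↦ ParallelAt.zero (hγ.1 s)⟩
    have hexp : expMap x w = γ ε₁ := by
      have h := hγ.expMap_smul 0 ε₁
      subst hγ0
      have h0' : velocity E γ 0 = ε₁⁻¹ • w := eq_of_heq (TotalSpace.mk.inj h0).2
      rwa [h0', smul_smul, mul_inv_cancel₀ h1.ne', one_smul, zero_add] at h
    have hs0 : stateCoord x γ (fun _ ↦ 0) 0 =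
        (extChartAt 𝓘(ℝ, E) x x, ε₁⁻¹ • dchart x x w, 0) := by
      subst hγ0
      have h0' : velocity E γ 0 = ε₁⁻¹ • w := eq_of_heq (TotalSpace.mk.inj h0).2
      simp only [stateCoord, fieldInChart_eq, h0', map_smul, map_zero]
    have hmem : stateCoord x γ (fun _ ↦ 0) 0 ∈
        Metric.ball (extChartAt 𝓘(ℝ, E) x x, (0 : E), (0 : E)) r := by
      rw [hs0, Metric.mem_ball, Prod.dist_eq, Prod.dist_eq, max_lt_iff, max_lt_iff]
      refine ⟨by simpa using hr, ?_, by simpa using hr⟩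
      rw [dist_zero_right, norm_smul, Real.norm_of_nonneg (inv_nonneg.2 h1.le),
        inv_mul_lt_iff₀ h1]
      calc ‖dchart (E := E) x x w‖ ≤ C * ‖w‖ := hC w
        _ ≤ (C + 1) * ‖w‖ := by nlinarith [norm_nonneg w]
        _ < ε₁ * r := by rwa [lt_div_iff₀ (by positivity), mul_comm] at hw
    have hflow := stateCoord_eq_of_flow hγ hV (t := 0) (by rw [hγ0]; exact hx) Metric.isOpen_ball
      hUt ⟨K, hK⟩ hε (hα _ hmem).1 (hα _ hmem).2
    refine ⟨α (stateCoord x γ (fun _ ↦ 0) 0), fun s hs ↦ ?_, (hα _ hmem).1.trans hs0, ?_⟩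
    · have hs' : s ∈ Ioo (-ε) ε := ⟨by linarith [hs.1], by linarith [hs.2]⟩
      refine ⟨((hα _ hmem).2 s hs').1, ((hα _ hmem).2 s hs').2, ?_⟩
      rw [← (hflow s hs').2]
      simp only [stateCoord, fieldInChart_eq, map_zero]
    · have hs' : ε₁ ∈ Ioo (-ε) ε := ⟨by linarith, h2⟩
      have hf := hflow ε₁ hs'
      rw [zero_add] at hf
      rw [hexp, ← hf.2]
      exact ⟨rfl, hf.1⟩
  intro w w' hw hw' hww'
  obtain ⟨c, hc1, hc2, hc3, -⟩ := key w hw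
  obtain ⟨c', hc1', hc2', hc3', -⟩ := key w' hw'
  have h := velocity_eq_of_position_eq hK (fun z ↦ rfl) h1 h4 h5 hc1 hc1' (by rw [hc2, hc2'])
    (by rw [hc3, hc3', hww'])
  rw [hc2, hc2'] at h
  exact dchart_injective hx (smul_right_injective E (inv_ne_zero h1.ne') h)

end ExpMap

/-! ### The descent inequality for geodesically smooth functions -/

section Descent

variable {E : Type*} [NormedAddCommGroup E] [NormedSpace ℝ E] [FiniteDimensional ℝ E]
  {M : Type*} [TopologicalSpace M] [ChartedSpace E M]
  [RiemannianBundle (fun x : M ↦ TangentSpace 𝓘(ℝ, E) x)]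

theorem inner_grad (h : M → ℝ) (x : M) (u : TangentSpace 𝓘(ℝ, E) x) :
    inner ℝ (grad E h x) u = mfderiv 𝓘(ℝ, E) 𝓘(ℝ, ℝ) h x u := by
  have : CompleteSpace (TangentSpace 𝓘(ℝ, E) x) :=
    FiniteDimensional.complete ℝ (TangentSpace 𝓘(ℝ, E) x)
  exact InnerProductSpace.toDual_symm_apply

variable {γ : ℝ → M} {h : M → ℝ}

theorem hasDerivAt_comp_curve (hh : MDifferentiable 𝓘(ℝ, E) 𝓘(ℝ, ℝ) h)
    (hγ : MDifferentiable 𝓘(ℝ, ℝ) 𝓘(ℝ, E) γ) (t : ℝ) :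
    HasDerivAt (fun s ↦ h (γ s)) (inner ℝ (grad E h (γ t)) (velocity E γ t)) t := by
  have hcomp := (hh (γ t)).hasMFDerivAt.comp t (hγ t).hasMFDerivAt
  rw [inner_grad]
  obtain ⟨D, hD, hD1⟩ : ∃ D : ℝ →L[ℝ] ℝ, HasFDerivAt (fun s ↦ h (γ s)) D t ∧
      D 1 = mfderiv 𝓘(ℝ, E) 𝓘(ℝ, ℝ) h (γ t) (velocity E γ t) :=
    ⟨_, hasMFDerivAt_iff_hasFDerivAt.1 hcomp, rfl⟩
  rw [← hD1]
  exact hD.hasDerivAt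

variable [IsManifold 𝓘(ℝ, E) ∞ M]
  [IsContMDiffRiemannianBundle 𝓘(ℝ, E) ∞ E (fun x : M ↦ TangentSpace 𝓘(ℝ, E) x)]
  [T2Space M] [MeasurableSpace M] {log : ∀ x : M, M → TangentSpace 𝓘(ℝ, E) x} {L : ℝ}

/-- A geodesic from `x` to `y` may be run backwards. -/
theorem norm_log_le_symm (hc : GeodesicallyComplete E M) (hlog : IsInverseExp log) (x y : M) :
    ‖log y x‖ ≤ ‖log x y‖ := by
  obtain ⟨γ, hγ⟩ := hc x (log x y)
  have hy : γ 1 = y := (expMap_eq hγ).symm.trans (hlog.exp_log x y)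
  obtain ⟨hγ', h0⟩ := hγ
  have hx : γ 0 = x := congrArg TotalSpace.proj h0
  subst hx
  have hv : velocity E γ 0 = log (γ 0) y := eq_of_heq (TotalSpace.mk.inj h0).2
  subst hy
  have hback := hγ'.expMap_smul 1 (-1)
  rw [add_neg_cancel] at hback
  calc ‖log (γ 1) (γ 0)‖ = ‖log (γ 1) (expMap (γ 1) ((-1 : ℝ) • velocity E γ 1))‖ := by rw [hback]
    _ ≤ ‖(-1 : ℝ) • velocity E γ 1‖ := hlog.norm_le _ _
    _ = ‖velocity E γ 0‖ := by rw [neg_one_smul, norm_neg, hγ'.norm_velocity 1 0]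
    _ = ‖log (γ 0) (γ 1)‖ := by rw [hv]

theorem norm_log_symm (hc : GeodesicallyComplete E M) (hlog : IsInverseExp log) (x y : M) :
    ‖log y x‖ = ‖log x y‖ :=
  (norm_log_le_symm hc hlog x y).antisymm (norm_log_le_symm hc hlog y x)

/-- `log` recovers the initial velocities of short pieces of a geodesic: its value has at most the
norm of that velocity and the same exponential, and the exponential map is injective near zero. -/
theorem IsGeodesic.eventually_log_eq (hc : GeodesicallyComplete E M) (hlog : IsInverseExp log)
    (hγ : IsGeodesic E γ) (s : ℝ) :
    ∀ᶠ t in 𝓝 s, log (γ s) (γ t) = (t - s) • velocity E γ s := by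
  obtain ⟨r, hr, hinj⟩ := expMap_injective_near_zero hc (γ s)
  have hlim : Tendsto (fun t : ℝ ↦ ‖(t - s) • velocity E γ s‖) (𝓝 s) (𝓝 0) := by
    have : Tendsto (fun t : ℝ ↦ |t - s| * ‖velocity E γ s‖) (𝓝 s)
        (𝓝 (|s - s| * ‖velocity E γ s‖)) := by
      exact Continuous.tendsto (by fun_prop) s
    simpa [norm_smul] using this
  filter_upwards [hlim.eventually (gt_mem_nhds hr)] with t ht
  have hexp := hγ.expMap_smul s (t - s)
  rw [add_sub_cancel] at hexp
  have hle := hlog.norm_le (γ s) ((t - s) • velocity E γ s)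
  rw [hexp] at hle
  exact hinj _ _ (hle.trans_lt ht) ht ((hlog.exp_log _ _).trans hexp.symm)

theorem exists_linearIsometry_transport (hc : GeodesicallyComplete E M) (hlog : IsInverseExp log)
    (x y : M) :
    ∃ T : TangentSpace 𝓘(ℝ, E) x →ₗᵢ[ℝ] TangentSpace 𝓘(ℝ, E) y, ∀ u, transport log x y u = T u :=
  exists_linearIsometry_transportAlong hc (hlog.exp_log x y)

/-- The directional derivative `⟪∇h(γ), γ'⟫` is locally Lipschitz at each time: on a short piece,
`transport` follows `γ` itself and carries `γ'(s)` to `γ'(t)`. -/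
theorem GeodesicallySmooth.inner_velocity_sub_le (hc : GeodesicallyComplete E M)
    (hlog : IsInverseExp log) (hh : GeodesicallySmooth log L h) (hγ : IsGeodesic E γ) (s : ℝ) :
    ∀ᶠ t in 𝓝 s, |inner ℝ (grad E h (γ t)) (velocity E γ t) -
      inner ℝ (grad E h (γ s)) (velocity E γ s)| ≤ L * ‖velocity E γ s‖ ^ 2 * |t - s| := by
  filter_upwards [hγ.eventually_log_eq hc hlog s] with t ht
  obtain ⟨A, hA⟩ := exists_linearIsometry_transport hc hlog (γ s) (γ t)
  have hvel : A (velocity E γ s) = velocity E γ t := by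
    rw [← hA, transport, ht]
    have h := hγ.transportAlong_smul hγ s (t - s)
    rw [add_sub_cancel] at h
    exact h
  have hL := hh.2 (γ t) (γ s)
  rw [hA, norm_log_symm hc hlog, ht, norm_smul, Real.norm_eq_abs] at hL
  have hinner : inner ℝ (grad E h (γ t)) (velocity E γ t) -
      inner ℝ (grad E h (γ s)) (velocity E γ s) =
      inner ℝ (grad E h (γ t) - A (grad E h (γ s))) (velocity E γ t) := by
    rw [inner_sub_left, ← hvel, A.inner_map_map]
  rw [hinner]
  calc |inner ℝ (grad E h (γ t) - A (grad E h (γ s))) (velocity E γ t)|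
      ≤ ‖grad E h (γ t) - A (grad E h (γ s))‖ * ‖velocity E γ t‖ := abs_real_inner_le_norm _ _
    _ ≤ L * (|t - s| * ‖velocity E γ s‖) * ‖velocity E γ t‖ := by gcongr
    _ = L * ‖velocity E γ s‖ ^ 2 * |t - s| := by rw [hγ.norm_velocity t s]; ring

/-- A function whose increments are locally bounded by `C * |t - s|` is `C`-Lipschitz from `0`. -/
theorem abs_sub_le_of_eventually {φ : ℝ → ℝ} {C : ℝ}
    (hφ : ∀ s, ∀ᶠ t in 𝓝 s, |φ t - φ s| ≤ C * |t - s|) {t : ℝ} (ht : 0 ≤ t) :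
    |φ t - φ 0| ≤ C * t := by
  have hcont : Continuous φ := continuous_iff_continuousAt.2 fun s ↦ by
    rw [ContinuousAt, tendsto_iff_norm_sub_tendsto_zero]
    refine squeeze_zero' (Eventually.of_forall fun _ ↦ norm_nonneg _) (hφ s) ?_
    have : Tendsto (fun t : ℝ ↦ C * |t - s|) (𝓝 s) (𝓝 (C * |s - s|)) :=
      Continuous.tendsto (by fun_prop) s
    simpa using this
  refine image_le_of_liminf_slope_right_le_deriv_boundary (f := fun t ↦ |φ t - φ 0|) (a := 0)
    (b := t) (B := fun t ↦ C * t) (B' := fun _ ↦ C) (by fun_prop) (by simp) (by fun_prop)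
    (fun x _ ↦ by simpa using ((hasDerivAt_id x).const_mul C).hasDerivWithinAt) ?_
    (right_mem_Icc.2 ht)
  intro x _ r hr
  refine Eventually.frequently ?_
  filter_upwards [nhdsWithin_le_nhds (hφ x), self_mem_nhdsWithin] with z hz hxz
  have hxz' : 0 < z - x := sub_pos.2 hxz
  rw [slope_def_field, div_lt_iff₀ hxz']
  rw [abs_of_pos hxz'] at hz
  have : |φ z - φ 0| ≤ |φ z - φ x| + |φ x - φ 0| := abs_sub_le _ _ _
  nlinarith

/-- The descent inequality, from both sides. It holds for every tangent vector `w`, not only for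
the values of `log`. -/
theorem GeodesicallySmooth.abs_expMap_sub_le (hc : GeodesicallyComplete E M)
    (hlog : IsInverseExp log) (hh : GeodesicallySmooth log L h) (x : M)
    (w : TangentSpace 𝓘(ℝ, E) x) :
    |h (expMap x w) - h x - inner ℝ (grad E h x) w| ≤ L / 2 * ‖w‖ ^ 2 := by
  obtain ⟨γ, hγ⟩ := hc x w
  rw [expMap_eq hγ]
  obtain ⟨hγ', h0⟩ := hγ
  cases h0
  set C := L * ‖velocity E γ 0‖ ^ 2 with hC
  set φ : ℝ → ℝ := fun t ↦ inner ℝ (grad E h (γ t)) (velocity E γ t) with hφ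
  have hder : ∀ t, HasDerivAt (fun t ↦ h (γ t) - h (γ 0) - t * φ 0) (φ t - φ 0) t := fun t ↦ by
    have h1 := ((hasDerivAt_comp_curve hh.1 hγ'.1 t).sub_const (h (γ 0))).sub
      ((hasDerivAt_id t).mul_const (φ 0))
    rwa [one_mul] at h1
  have hbound : ∀ t, 0 ≤ t → |φ t - φ 0| ≤ C * t := fun t ht ↦
    abs_sub_le_of_eventually (fun s ↦ by
      rw [hC, hγ'.norm_velocity 0 s]
      exact hh.inner_velocity_sub_le hc hlog hγ' s) ht
  have hend := image_norm_le_of_norm_deriv_right_le_deriv_boundary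
    (f := fun t ↦ h (γ t) - h (γ 0) - t * φ 0) (a := 0) (b := 1) (B := fun t ↦ C / 2 * t ^ 2)
    (B' := fun t ↦ C * t)
    (fun t _ ↦ (hder t).continuousAt.continuousWithinAt) (fun t _ ↦ (hder t).hasDerivWithinAt)
    (by simp) (fun t ↦ by
      have := ((hasDerivAt_id t).pow 2).const_mul (C / 2)
      refine this.congr_deriv ?_
      simp; ring)
    (fun t ht ↦ hbound t ht.1) (right_mem_Icc.2 zero_le_one)
  rw [one_mul, one_pow, mul_one, Real.norm_eq_abs] at hend
  calc _ ≤ C / 2 := hend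
    _ = _ := by rw [hC]; ring

end Descent

/-! ### Measurable maps into the tangent bundle -/

section TangentMeasurability

variable {E : Type*} [NormedAddCommGroup E] [NormedSpace ℝ E] [FiniteDimensional ℝ E]
  {M : Type*} [TopologicalSpace M] [ChartedSpace E M] [SecondCountableTopology M]

variable (E M) in
theorem exists_chart_sequence [Nonempty M] :
    ∃ p : ℕ → M, ∀ x, ∃ n, x ∈ (extChartAt 𝓘(ℝ, E) (p n)).source := by
  obtain ⟨s, hs, hU⟩ := TopologicalSpace.countable_cover_nhds
    (fun x : M ↦ extChartAt_source_mem_nhds (I := 𝓘(ℝ, E)) x)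
  have hne : s.Nonempty := by
    rw [nonempty_iff_ne_empty]
    rintro rfl
    simp only [mem_empty_iff_false, iUnion_of_empty, iUnion_empty] at hU
    exact empty_ne_univ hU
  obtain ⟨p, rfl⟩ := hs.exists_eq_range hne
  refine ⟨p, fun x ↦ ?_⟩
  have hx : x ∈ ⋃ y ∈ range p, (extChartAt 𝓘(ℝ, E) y).source := hU ▸ mem_univ x
  simpa only [mem_iUnion, exists_range_iff, exists_prop, biUnion_range] using hx

variable (E) in
open Classical in
/-- The center of the first chart, in a fixed sequence of charts that cover `M`, whose domain
contains `x`. -/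
def chartCenter [Nonempty M] (x : M) : M :=
  (exists_chart_sequence E M).choose (Nat.find ((exists_chart_sequence E M).choose_spec x))

open Classical in
theorem mem_source_chartCenter [Nonempty M] (x : M) :
    x ∈ (extChartAt 𝓘(ℝ, E) (chartCenter E x)).source :=
  Nat.find_spec ((exists_chart_sequence E M).choose_spec x)

/-- Measurability of a map `h c a` in `a`, where `c` is the center of the chart at `x(a)`, follows
from measurability for each fixed center. -/
theorem measurable_chartCenter {α β : Type*} [MeasurableSpace α] [MeasurableSpace β]
    [MeasurableSpace M] [OpensMeasurableSpace M] [Nonempty M] {x : α → M}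
    (hx : Measurable x) {h : M → α → β} (hh : ∀ p, Measurable (h p)) :
    Measurable fun a ↦ h (chartCenter E (x a)) a := by
  classical
  exact Measurable.find (f := fun n a ↦ h ((exists_chart_sequence E M).choose n) a) (fun n ↦ hh _)
    (fun n ↦ hx ((isOpen_extChartAt_source _).measurableSet))
    (fun a ↦ (exists_chart_sequence E M).choose_spec (x a))

variable [IsManifold 𝓘(ℝ, E) ∞ M]

/-- Pairs of measurable maps into the tangent bundle are measurable for the Borel σ-algebra of the
product only because of this instance. -/
instance : SecondCountableTopology (TangentBundle 𝓘(ℝ, E) M) := by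
  rcases isEmpty_or_nonempty M with h | h
  · have : IsEmpty (TangentBundle 𝓘(ℝ, E) M) := ⟨fun z ↦ h.false z.proj⟩
    infer_instance
  obtain ⟨p, hp⟩ := exists_chart_sequence E M
  set e := fun n ↦ (trivializationAt E (TangentSpace 𝓘(ℝ, E) (M := M)) (p n)) with he
  have hsc : ∀ n, SecondCountableTopology (e n).source := fun n ↦
    (e n).toOpenPartialHomeomorph.toHomeomorphSourceTarget.secondCountableTopology
  refine TopologicalSpace.secondCountableTopology_of_countable_cover
    (U := fun n ↦ (e n).source) (fun n ↦ (e n).open_source) ?_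
  refine eq_univ_of_forall fun z ↦ ?_
  obtain ⟨n, hn⟩ := hp z.proj
  refine mem_iUnion.2 ⟨n, ?_⟩
  rw [Trivialization.mem_source]
  simpa [he] using hn

/-- A measurable frame of the tangent bundle: the coordinates on `T_x M` given by the chart around
`chartCenter E x`. -/
def frame [Nonempty M] (x : M) : TangentSpace 𝓘(ℝ, E) x ≃ₗ[ℝ] E :=
  LinearEquiv.ofBijective (dchart (chartCenter E x) x).toLinearMap
    ⟨dchart_injective (mem_source_chartCenter x), dchart_surjective (mem_source_chartCenter x)⟩

theorem frame_apply [Nonempty M] (x : M) (v : TangentSpace 𝓘(ℝ, E) x) :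
    frame x v = dchart (chartCenter E x) x v := rfl

variable [Nonempty M] [MeasurableSpace M] [BorelSpace M] [MeasurableSpace E] [BorelSpace E]
  {α : Type*} [MeasurableSpace α]

/-- Measurability for the Borel σ-algebra of the tangent bundle can be tested on the base point and
on the coordinates in the measurable frame; this reduces fibrewise linear operations to `E`. -/
theorem measurableToTangent_iff {g : α → TangentBundle 𝓘(ℝ, E) M} :
    MeasurableToTangent g ↔ Measurable (fun a ↦ (g a).proj) ∧
      Measurable (fun a ↦ frame (g a).proj (g a).snd) := by
  classical
  let : MeasurableSpace (TangentBundle 𝓘(ℝ, E) M) := borel _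
  have : BorelSpace (TangentBundle 𝓘(ℝ, E) M) := ⟨rfl⟩
  have hsrc : ∀ p : M, (trivializationAt E (TangentSpace 𝓘(ℝ, E) (M := M)) p).baseSet =
      (extChartAt 𝓘(ℝ, E) p).source := fun p ↦ by simp
  constructor
  · intro hg
    replace hg : Measurable g := hg
    have hproj : Measurable (fun a ↦ (g a).proj) :=
      (FiberBundle.continuous_proj E (TangentSpace 𝓘(ℝ, E) (M := M))).measurable.comp hg
    refine ⟨hproj, ?_⟩
    have hcoord : ∀ p : M, Measurable fun a ↦ if (g a).proj ∈ (extChartAt 𝓘(ℝ, E) p).source then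
        (trivializationAt E (TangentSpace 𝓘(ℝ, E)) p (g a)).2 else 0 := fun p ↦ by
      set e := trivializationAt E (TangentSpace 𝓘(ℝ, E) (M := M)) p with he
      have h1 : Measurable (e.source.piecewise (fun z ↦ (e z).2) (fun _ ↦ (0 : E))) :=
        (continuous_snd.comp_continuousOn e.continuousOn_toFun).measurable_piecewise
          continuousOn_const e.open_source.measurableSet
      convert h1.comp hg using 2 with a
      have hiff : (g a).proj ∈ (extChartAt 𝓘(ℝ, E) p).source ↔ g a ∈ e.source := by
        rw [e.mem_source, hsrc]
      simp only [Function.comp, piecewise, hiff]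
    convert measurable_chartCenter hproj hcoord using 2 with a
    have ha := mem_source_chartCenter (E := E) (g a).proj
    rw [if_pos ha, frame_apply]
    exact (congrArg Prod.snd (trivializationAt_eq_dchart ha (g a).snd)).symm
  · rintro ⟨hx, hv⟩
    have z₀ : TangentBundle 𝓘(ℝ, E) M := ⟨Classical.arbitrary M, 0⟩
    have hpsi : ∀ p : M, Measurable fun a ↦
        if (g a).proj ∈ (extChartAt 𝓘(ℝ, E) p).source then
        (trivializationAt E (TangentSpace 𝓘(ℝ, E)) p).toOpenPartialHomeomorph.symm
          ((g a).proj, frame (g a).proj (g a).snd) else z₀ := fun p ↦ by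
      set e := trivializationAt E (TangentSpace 𝓘(ℝ, E) (M := M)) p with he
      have h1 : Measurable (e.target.piecewise e.toOpenPartialHomeomorph.symm (fun _ ↦ z₀)) :=
        e.toOpenPartialHomeomorph.continuousOn_symm.measurable_piecewise
          continuousOn_const e.open_target.measurableSet
      convert h1.comp (hx.prodMk hv) using 2 with a
      have hiff : (g a).proj ∈ (extChartAt 𝓘(ℝ, E) p).source ↔
          ((g a).proj, frame (g a).proj (g a).snd) ∈ e.target := by
        rw [e.mem_target, hsrc]
      simp only [Function.comp, piecewise, hiff]
    change Measurable g
    convert measurable_chartCenter hx hpsi using 2 with a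
    have ha := mem_source_chartCenter (E := E) (g a).proj
    rw [if_pos ha, frame_apply, ← trivializationAt_eq_dchart ha (g a).snd]
    exact ((trivializationAt E (TangentSpace 𝓘(ℝ, E) (M := M)) _).left_inv
      (by rw [Trivialization.mem_source, hsrc]; exact ha)).symm

end TangentMeasurability

/-! ### Measurability of vector operations, exponential map and transport -/

section TangentOperations

variable {E : Type*} [NormedAddCommGroup E] [NormedSpace ℝ E] [FiniteDimensional ℝ E]
  {M : Type*} [TopologicalSpace M] [ChartedSpace E M] [SecondCountableTopology M]
  [IsManifold 𝓘(ℝ, E) ∞ M]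

section Linear

variable [Nonempty M] [MeasurableSpace M] [BorelSpace M] [MeasurableSpace E] [BorelSpace E]
  {α : Type*} [MeasurableSpace α] {x : α → M} {v w : ∀ a, TangentSpace 𝓘(ℝ, E) (x a)}

theorem measurableToTangent_mk_iff :
    MeasurableToTangent (fun a ↦ (⟨x a, v a⟩ : TangentBundle 𝓘(ℝ, E) M)) ↔
      Measurable x ∧ Measurable fun a ↦ frame (x a) (v a) :=
  measurableToTangent_iff

theorem MeasurableToTangent.sub
    (hv : MeasurableToTangent (fun a ↦ (⟨x a, v a⟩ : TangentBundle 𝓘(ℝ, E) M)))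
    (hw : MeasurableToTangent (fun a ↦ (⟨x a, w a⟩ : TangentBundle 𝓘(ℝ, E) M))) :
    MeasurableToTangent (fun a ↦ (⟨x a, v a - w a⟩ : TangentBundle 𝓘(ℝ, E) M)) := by
  rw [measurableToTangent_mk_iff] at *
  refine ⟨hv.1, ?_⟩
  simp only [map_sub]
  exact hv.2.sub hw.2

theorem MeasurableToTangent.neg
    (hv : MeasurableToTangent (fun a ↦ (⟨x a, v a⟩ : TangentBundle 𝓘(ℝ, E) M))) :
    MeasurableToTangent (fun a ↦ (⟨x a, -v a⟩ : TangentBundle 𝓘(ℝ, E) M)) := by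
  rw [measurableToTangent_mk_iff] at *
  refine ⟨hv.1, ?_⟩
  simp only [map_neg]
  exact hv.2.neg

theorem MeasurableToTangent.smul {r : α → ℝ} (hr : Measurable r)
    (hv : MeasurableToTangent (fun a ↦ (⟨x a, v a⟩ : TangentBundle 𝓘(ℝ, E) M))) :
    MeasurableToTangent (fun a ↦ (⟨x a, r a • v a⟩ : TangentBundle 𝓘(ℝ, E) M)) := by
  rw [measurableToTangent_mk_iff] at *
  refine ⟨hv.1, ?_⟩
  simp only [map_smul]
  exact hr.smul hv.2

theorem MeasurableToTangent.sum {ι : Type*} {s : Finset ι}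
    {u : ι → ∀ a, TangentSpace 𝓘(ℝ, E) (x a)} (hx : Measurable x)
    (hu : ∀ i, MeasurableToTangent (fun a ↦ (⟨x a, u i a⟩ : TangentBundle 𝓘(ℝ, E) M))) :
    MeasurableToTangent (fun a ↦ (⟨x a, ∑ i ∈ s, u i a⟩ : TangentBundle 𝓘(ℝ, E) M)) := by
  rw [measurableToTangent_mk_iff]
  refine ⟨hx, ?_⟩
  simp only [map_sum]
  exact Finset.measurable_fun_sum _ fun i _ ↦ (measurableToTangent_mk_iff.1 (hu i)).2

end Linear

variable [RiemannianBundle (fun x : M ↦ TangentSpace 𝓘(ℝ, E) x)]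
  [IsContMDiffRiemannianBundle 𝓘(ℝ, E) ∞ E (fun x : M ↦ TangentSpace 𝓘(ℝ, E) x)]
  {α : Type*} [MeasurableSpace α]

theorem continuous_norm_tangent : Continuous fun z : TangentBundle 𝓘(ℝ, E) M ↦ ‖z.snd‖ := by
  have : IsContinuousRiemannianBundle E (fun x : M ↦ TangentSpace 𝓘(ℝ, E) x) := by
    obtain ⟨g, hg, h⟩ := IsContMDiffRiemannianBundle.exists_contMDiff (IB := 𝓘(ℝ, E)) (n := ∞)
      (F := E) (E := fun x : M ↦ TangentSpace 𝓘(ℝ, E) x)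
    exact ⟨g, hg.continuous, h⟩
  have h : Continuous fun z : TangentBundle 𝓘(ℝ, E) M ↦ inner ℝ z.snd z.snd :=
    Continuous.inner_bundle (F := E) (b := TotalSpace.proj) continuous_id continuous_id
  simp only [real_inner_self_eq_norm_sq] at h
  simpa using h.sqrt

theorem MeasurableToTangent.norm {g : α → TangentBundle 𝓘(ℝ, E) M} (hg : MeasurableToTangent g) :
    Measurable fun a ↦ ‖(g a).snd‖ := by
  let _ : MeasurableSpace (TangentBundle 𝓘(ℝ, E) M) := borel _
  have : BorelSpace (TangentBundle 𝓘(ℝ, E) M) := ⟨rfl⟩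
  exact continuous_norm_tangent.measurable.comp hg

variable [T2Space M]

theorem continuous_expMap (hc : GeodesicallyComplete E M) :
    Continuous fun z : TangentBundle 𝓘(ℝ, E) M ↦ expMap z.proj z.snd := by
  choose γ hγ h0 using fun z : TangentBundle 𝓘(ℝ, E) M ↦ hc z.proj z.snd
  refine continuous_iff_continuousAt.2 fun z ↦ ?_
  have hst : StateTendsto (𝓝 z) γ (fun z ↦ velocity E (γ z)) (γ z) (velocity E (γ z)) 0 := by
    simp only [StateTendsto, h0]
    exact ⟨tendsto_id, tendsto_id⟩
  have h1 := (FiberBundle.continuous_proj E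
    (TangentSpace 𝓘(ℝ, E) (M := M))).continuousAt.tendsto.comp (hst.all (hγ z) (hγ z) hγ hγ 1).1
  have hexp : ∀ z : TangentBundle 𝓘(ℝ, E) M, expMap z.proj z.snd = γ z 1 := fun z ↦
    expMap_eq ⟨hγ z, h0 z⟩
  rw [ContinuousAt, hexp]
  simp only [hexp]
  exact h1

theorem MeasurableToTangent.expMap [MeasurableSpace M] [BorelSpace M]
    (hc : GeodesicallyComplete E M) {g : α → TangentBundle 𝓘(ℝ, E) M}
    (hg : MeasurableToTangent g) : Measurable fun a ↦ expMap (g a).proj (g a).snd := by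
  let _ : MeasurableSpace (TangentBundle 𝓘(ℝ, E) M) := borel _
  have : BorelSpace (TangentBundle 𝓘(ℝ, E) M) := ⟨rfl⟩
  exact (continuous_expMap hc).measurable.comp hg

/-- Parallel transport along a geodesic depends continuously on the initial velocity and on the
transported vector. -/
theorem exists_continuous_transportAlong (hc : GeodesicallyComplete E M) :
    ∃ H : {z : TangentBundle 𝓘(ℝ, E) M × TangentBundle 𝓘(ℝ, E) M // z.1.proj = z.2.proj} →
      TangentBundle 𝓘(ℝ, E) M, Continuous H ∧
      ∀ (x : M) (w u : TangentSpace 𝓘(ℝ, E) x),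
        H ⟨(⟨x, w⟩, ⟨x, u⟩), rfl⟩ = ⟨expMap x w, transportAlong x (expMap x w) w u⟩ := by
  choose γ hγ h0 using fun z : TangentBundle 𝓘(ℝ, E) M ↦ hc z.proj z.snd
  have hV : ∀ z : {z : TangentBundle 𝓘(ℝ, E) M × TangentBundle 𝓘(ℝ, E) M // z.1.proj = z.2.proj},
      ∃ V : ∀ t, TangentSpace 𝓘(ℝ, E) (γ z.1.1 t),
        (⟨γ z.1.1 0, V 0⟩ : TangentBundle 𝓘(ℝ, E) M) = z.1.2 ∧ IsParallelAlong (γ z.1.1) V := by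
    rintro ⟨⟨z, x', u⟩, hz⟩
    have hx : γ z 0 = x' := (congrArg TotalSpace.proj (h0 z)).trans hz
    subst hx
    obtain ⟨V, hV0, hV⟩ := exists_isParallelAlong (hγ z) 0 u
    exact ⟨V, by rw [hV0], hV⟩
  choose V hV0 hV using hV
  refine ⟨fun z ↦ ⟨γ z.1.1 1, V z 1⟩, continuous_iff_continuousAt.2 fun z ↦ ?_, fun x w u ↦ ?_⟩
  · have hst : StateTendsto (𝓝 z) (fun z ↦ γ z.1.1) V (γ z.1.1) (V z) 0 := by
      simp only [StateTendsto, h0, hV0]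
      exact ⟨(continuous_fst.comp continuous_subtype_val).continuousAt,
        (continuous_snd.comp continuous_subtype_val).continuousAt⟩
    exact (hst.all (hγ _) (hV z) (fun z ↦ hγ _) hV 1).2
  · have hexp : expMap x w = γ ⟨x, w⟩ 1 := expMap_eq ⟨hγ ⟨x, w⟩, h0 ⟨x, w⟩⟩
    rw [hexp]
    exact congrArg (fun v ↦ (⟨γ ⟨x, w⟩ 1, v⟩ : TangentBundle 𝓘(ℝ, E) M))
      (transportAlong_eq ⟨hγ ⟨x, w⟩, h0 ⟨x, w⟩⟩ (hV ⟨(⟨x, w⟩, ⟨x, u⟩), rfl⟩)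
        (hV0 ⟨(⟨x, w⟩, ⟨x, u⟩), rfl⟩) rfl).symm

theorem MeasurableToTangent.transport [MeasurableSpace M] [BorelSpace M]
    (hc : GeodesicallyComplete E M) {log : ∀ x : M, M → TangentSpace 𝓘(ℝ, E) x}
    (hlog : IsInverseExp log) {x y : α → M} {u : ∀ a, TangentSpace 𝓘(ℝ, E) (x a)}
    (hx : Measurable x) (hy : Measurable y)
    (hu : MeasurableToTangent (fun a ↦ (⟨x a, u a⟩ : TangentBundle 𝓘(ℝ, E) M))) :
    MeasurableToTangent
      (fun a ↦ (⟨y a, transport log (x a) (y a) (u a)⟩ : TangentBundle 𝓘(ℝ, E) M)) := by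
  let _ : MeasurableSpace (TangentBundle 𝓘(ℝ, E) M) := borel _
  have : BorelSpace (TangentBundle 𝓘(ℝ, E) M) := ⟨rfl⟩
  obtain ⟨H, hH, hHeq⟩ := exists_continuous_transportAlong hc
  have hl : Measurable fun a ↦ (⟨x a, log (x a) (y a)⟩ : TangentBundle 𝓘(ℝ, E) M) :=
    Measurable.comp (g := fun z : M × M ↦ (⟨z.1, log z.1 z.2⟩ : TangentBundle 𝓘(ℝ, E) M))
      hlog.measurable (hx.prodMk hy)
  have hm := hH.measurable.comp ((hl.prodMk hu).subtype_mk (h := fun a ↦ rfl))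
  refine Eq.mp (congrArg _ (funext fun a ↦ ?_)) hm
  refine (hHeq _ _ _).trans ?_
  rw [hlog.exp_log]
  rfl

end TangentOperations

/-! ### Stochastic gradients are unbiased -/

section StochasticGradient

variable {E : Type*} [NormedAddCommGroup E] [NormedSpace ℝ E] [FiniteDimensional ℝ E]
  {M : Type*} [TopologicalSpace M] [T2Space M] [SecondCountableTopology M]
  [MeasurableSpace M] [BorelSpace M]
  [ChartedSpace E M] [IsManifold 𝓘(ℝ, E) ∞ M]
  [RiemannianBundle (fun x : M ↦ TangentSpace 𝓘(ℝ, E) x)]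
  [IsContMDiffRiemannianBundle 𝓘(ℝ, E) ∞ E (fun x : M ↦ TangentSpace 𝓘(ℝ, E) x)]

theorem MeasurableToTangent.stronglyMeasurable {α : Type*} [MeasurableSpace α] {x : M}
    {g : α → TangentSpace 𝓘(ℝ, E) x}
    (hg : MeasurableToTangent (fun a ↦ (⟨x, g a⟩ : TangentBundle 𝓘(ℝ, E) M))) :
    StronglyMeasurable g := by
  have : Nonempty M := ⟨x⟩
  borelize E
  have h1 : StronglyMeasurable fun a ↦ frame x (g a) :=
    (measurableToTangent_mk_iff.1 hg).2.stronglyMeasurable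
  have h2 := ((frame x).symm.toLinearMap.continuous_of_finiteDimensional).comp_stronglyMeasurable h1
  convert h2 using 2 with a
  exact ((frame x).symm_apply_apply (g a)).symm

variable {Ξ : Type*} [MeasurableSpace Ξ]

/-- The setting: `F` is the expectation of the `L`-smooth functions `f(·; ξ)`, whose gradients have
variance at most `σ²`, on a complete manifold with inverse exponential map `log`. -/
structure StochasticObjective (log : ∀ x : M, M → TangentSpace 𝓘(ℝ, E) x) (P : Measure Ξ)
    (f : M → Ξ → ℝ) (F : M → ℝ) (L σ : ℝ) : Prop where
  complete : GeodesicallyComplete E M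
  isInverseExp : IsInverseExp log
  integrable : ∀ x, Integrable (f x) P
  eq_integral : ∀ x, F x = ∫ ξ, f x ξ ∂P
  mdifferentiable : MDifferentiable 𝓘(ℝ, E) 𝓘(ℝ, ℝ) F
  measurable : MeasurableToTangent (fun z : M × Ξ ↦
    (⟨z.1, grad E (fun y ↦ f y z.2) z.1⟩ : TangentBundle 𝓘(ℝ, E) M))
  smooth : ∀ ξ, GeodesicallySmooth log L (fun x ↦ f x ξ)
  variance : ∀ x,
    ∫⁻ ξ, ‖grad E F x - grad E (fun y ↦ f y ξ) x‖ₑ ^ 2 ∂P ≤ ENNReal.ofReal (σ ^ 2)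

namespace StochasticObjective

variable {log : ∀ x : M, M → TangentSpace 𝓘(ℝ, E) x} {P : Measure Ξ} [IsProbabilityMeasure P]
  {f : M → Ξ → ℝ} {F : M → ℝ} {L σ : ℝ} (H : StochasticObjective log P f F L σ)

include H

theorem stronglyMeasurable_grad (x : M) :
    StronglyMeasurable fun ξ ↦ grad E (fun y ↦ f y ξ) x := by
  refine MeasurableToTangent.stronglyMeasurable ?_
  let _ : MeasurableSpace (TangentBundle 𝓘(ℝ, E) M) := borel _
  exact Measurable.comp (g := fun z : M × Ξ ↦
    (⟨z.1, grad E (fun y ↦ f y z.2) z.1⟩ : TangentBundle 𝓘(ℝ, E) M)) H.measurable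
    measurable_prodMk_left

theorem memLp_grad_sub (x : M) :
    MemLp (fun ξ ↦ grad E F x - grad E (fun y ↦ f y ξ) x) 2 P := by
  refine ⟨(stronglyMeasurable_const.sub (H.stronglyMeasurable_grad x)).aestronglyMeasurable, ?_⟩
  rw [eLpNorm_lt_top_iff_lintegral_rpow_enorm_lt_top (by simp) (by simp)]
  simpa using (H.variance x).trans_lt ENNReal.ofReal_lt_top

theorem integrable_grad (x : M) : Integrable (fun ξ ↦ grad E (fun y ↦ f y ξ) x) P := by
  have h := (integrable_const (grad E F x)).sub ((H.memLp_grad_sub x).integrable one_le_two)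
  exact h.congr (ae_of_all _ fun ξ ↦ sub_sub_cancel _ _)

/-- The stochastic gradients are unbiased: expectation and gradient commute, since the descent
inequality is uniform in the sample. -/
theorem integral_grad (x : M) : ∫ ξ, grad E (fun y ↦ f y ξ) x ∂P = grad E F x := by
  have : CompleteSpace (TangentSpace 𝓘(ℝ, E) x) :=
    FiniteDimensional.complete ℝ (TangentSpace 𝓘(ℝ, E) x)
  refine ext_inner_right ℝ fun u ↦ ?_
  obtain ⟨γ, hγ, h0⟩ := H.complete x u
  have hx : γ 0 = x := congrArg TotalSpace.proj h0
  subst hx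
  have hu : velocity E γ 0 = u := eq_of_heq (TotalSpace.mk.inj h0).2
  subst hu
  set G := ∫ ξ, grad E (fun y ↦ f y ξ) (γ 0) ∂P with hG
  have h1 := hasDerivAt_comp_curve H.mdifferentiable hγ.1 0
  refine HasDerivAt.unique (f := fun s ↦ F (γ s)) (x := 0) ?_ h1
  have hbound : ∀ t : ℝ, ‖F (γ t) - F (γ 0) - t * inner ℝ G (velocity E γ 0)‖ ≤
      L / 2 * ‖velocity E γ 0‖ ^ 2 * ‖t ^ 2‖ := fun t ↦ by
    have hint : Integrable (fun ξ ↦ inner ℝ (grad E (fun y ↦ f y ξ) (γ 0)) (velocity E γ 0)) P :=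
      (H.integrable_grad (γ 0)).inner_const _
    have hI : F (γ t) - F (γ 0) - t * inner ℝ G (velocity E γ 0) =
        ∫ ξ, (f (γ t) ξ - f (γ 0) ξ -
          t * inner ℝ (grad E (fun y ↦ f y ξ) (γ 0)) (velocity E γ 0)) ∂P := by
      rw [integral_sub (f := fun ξ ↦ f (γ t) ξ - f (γ 0) ξ)
          ((H.integrable _).sub (H.integrable _)) (hint.const_mul t),
        integral_sub (H.integrable _) (H.integrable _), integral_const_mul, H.eq_integral,
        H.eq_integral, hG, real_inner_comm, ← integral_inner (H.integrable_grad (γ 0))]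
      simp only [real_inner_comm]
    rw [hI]
    refine (norm_integral_le_of_norm_le_const (ae_of_all _ fun ξ ↦ ?_)).trans
      (b := L / 2 * ‖velocity E γ 0‖ ^ 2 * ‖t ^ 2‖ * P.real univ) (by simp)
    have h := (H.smooth ξ).abs_expMap_sub_le H.complete H.isInverseExp (γ 0) (t • velocity E γ 0)
    rw [hγ.expMap_smul 0 t, zero_add, inner_smul_right, norm_smul, mul_pow] at h
    rw [Real.norm_eq_abs, norm_pow]
    refine h.trans_eq (by ring)
  have ho : (fun t ↦ F (γ t) - F (γ 0) - t * inner ℝ G (velocity E γ 0)) =o[𝓝 0]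
      (fun t : ℝ ↦ t) :=
    (Asymptotics.IsBigO.of_bound _ (Eventually.of_forall hbound)).trans_isLittleO
      (Asymptotics.isLittleO_pow_id one_lt_two)
  rw [hasDerivAt_iff_isLittleO]
  simpa only [sub_zero, smul_eq_mul] using ho

/-- Transport, being linear, commutes with the expectation. -/
theorem grad_sub_transport_eq_integral (x y : M) :
    grad E F x - transport log y x (grad E F y) =
      ∫ ξ, (grad E (fun z ↦ f z ξ) x - transport log y x (grad E (fun z ↦ f z ξ) y)) ∂P := by
  have : CompleteSpace (TangentSpace 𝓘(ℝ, E) x) :=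
    FiniteDimensional.complete ℝ (TangentSpace 𝓘(ℝ, E) x)
  have : CompleteSpace (TangentSpace 𝓘(ℝ, E) y) :=
    FiniteDimensional.complete ℝ (TangentSpace 𝓘(ℝ, E) y)
  obtain ⟨A, hA⟩ := exists_linearIsometry_transport H.complete H.isInverseExp y x
  simp only [hA]
  rw [integral_sub (g := fun ξ ↦ A (grad E (fun z ↦ f z ξ) y)) (H.integrable_grad x)
    (A.toContinuousLinearMap.integrable_comp (H.integrable_grad y)), H.integral_grad x]
  congr 1
  have h := A.toContinuousLinearMap.integral_comp_comm (H.integrable_grad y)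
  rw [H.integral_grad y] at h
  exact h.symm

/-- The expectation inherits the smoothness of the functions `f(·; ξ)`. -/
theorem geodesicallySmooth : GeodesicallySmooth log L F := by
  refine ⟨H.mdifferentiable, fun x y ↦ ?_⟩
  rw [H.grad_sub_transport_eq_integral]
  exact (norm_integral_le_of_norm_le_const (ae_of_all _ fun ξ ↦ (H.smooth ξ).2 x y)).trans
    (by simp)

/-- The gradient of `F` is a measurable vector field, as the expectation of the jointly measurable
stochastic gradients; `F` is not assumed to be continuously differentiable. -/
theorem measurable_grad :
    MeasurableToTangent (fun x : M ↦ (⟨x, grad E F x⟩ : TangentBundle 𝓘(ℝ, E) M)) := by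
  rcases isEmpty_or_nonempty M with h | h
  · exact @measurable_of_empty _ _ _ (borel _) _ _
  borelize E
  rw [measurableToTangent_mk_iff]
  refine ⟨measurable_id, ?_⟩
  have h1 := (measurableToTangent_mk_iff.1 H.measurable).2
  have h2 : StronglyMeasurable fun x : M ↦ ∫ ξ, frame x (grad E (fun y ↦ f y ξ) x) ∂P :=
    h1.stronglyMeasurable.integral_prod_right
  convert h2.measurable using 2 with x
  have : CompleteSpace (TangentSpace 𝓘(ℝ, E) x) :=
    FiniteDimensional.complete ℝ (TangentSpace 𝓘(ℝ, E) x)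
  have : CompleteSpace E := FiniteDimensional.complete ℝ E
  rw [← H.integral_grad x]
  exact (ContinuousLinearMap.integral_comp_comm (𝕜 := ℝ) (E := TangentSpace 𝓘(ℝ, E) x) (Fₗ := E)
    (dchart (chartCenter E x) x) (H.integrable_grad x)).symm

end StochasticObjective

end StochasticGradient

/-! ### Averages of independent samples and conditioning on the past -/

section Probability

variable {Ω Ξ : Type*} [MeasurableSpace Ω] {μ : Measure Ω} [IsProbabilityMeasure μ]
  [MeasurableSpace Ξ] {P : Measure Ξ}

section Variance

variable {V : Type*} [NormedAddCommGroup V] [InnerProductSpace ℝ V] [CompleteSpace V]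

theorem MeasureTheory.MemLp.integrable_inner_of_two {X Y : Ω → V} (hX : MemLp X 2 μ)
    (hY : MemLp Y 2 μ) : Integrable (fun w ↦ (inner ℝ (X w) (Y w) : ℝ)) μ :=
  (hX.norm.integrable_mul hY.norm).mono' (hX.1.inner hY.1)
    (ae_of_all _ fun w ↦ norm_inner_le_norm (X w) (Y w))

/-- Averaging `S` independent centered vectors divides the variance by `S`. For `S = 0` both sides
reduce to `‖a‖²`. -/
theorem lintegral_enorm_add_average_sq_le {ζ : ℕ → Ω → Ξ} (hζ : ∀ i, Measurable (ζ i))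
    (hlaw : ∀ i, μ.map (ζ i) = P) (hind : ∀ i j, i ≠ j → IndepFun (ζ i) (ζ j) μ)
    {φ : Ξ → V} (hφ : MemLp φ 2 P) (h0 : ∫ x, φ x ∂P = 0) {C : ℝ}
    (hC : ∫ x, ‖φ x‖ ^ 2 ∂P ≤ C) (a : V) (S : ℕ) :
    ∫⁻ w, ‖a + (S : ℝ)⁻¹ • ∑ i ∈ Finset.range S, φ (ζ i w)‖ₑ ^ 2 ∂μ ≤
      ENNReal.ofReal (‖a‖ ^ 2 + C / S) := by
  have hY : ∀ i, MemLp (fun w ↦ φ (ζ i w)) 2 μ := fun i ↦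
    MemLp.comp_of_map (by rw [hlaw i]; exact hφ) (hζ i).aemeasurable
  have hZ : MemLp (fun w ↦ ∑ i ∈ Finset.range S, φ (ζ i w)) 2 μ :=
    memLp_finsetSum _ fun i _ ↦ hY i
  have hmean : ∀ i, ∫ w, φ (ζ i w) ∂μ = 0 := fun i ↦ by
    rw [← integral_map (hζ i).aemeasurable (by rw [hlaw i]; exact hφ.1), hlaw i, h0]
  have hcov : ∀ i j, ∫ w, inner ℝ (φ (ζ i w)) (φ (ζ j w)) ∂μ =
      if i = j then ∫ x, ‖φ x‖ ^ 2 ∂P else 0 := fun i j ↦ by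
    have : IsProbabilityMeasure P := hlaw 0 ▸ Measure.isProbabilityMeasure_map (hζ 0).aemeasurable
    split_ifs with hij
    · subst hij
      simp only [real_inner_self_eq_norm_sq]
      rw [← integral_map (f := fun x ↦ ‖φ x‖ ^ 2) (hζ i).aemeasurable
        (by rw [hlaw i]; exact hφ.1.norm.pow 2), hlaw i]
    · have h := (hind i j hij).integral_bilin_comp_comp (f := φ) (g := φ) (hζ i).aemeasurable
        (hζ j).aemeasurable (by rw [hlaw i]; exact hφ.integrable one_le_two)
        (by rw [hlaw j]; exact hφ.integrable one_le_two) (innerSL ℝ (E := V))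
      simp only [hmean, map_zero] at h
      exact h
  have hZ2 : ∫ w, ‖∑ i ∈ Finset.range S, φ (ζ i w)‖ ^ 2 ∂μ = S * ∫ x, ‖φ x‖ ^ 2 ∂P := by
    have hsq : ∀ w, ‖∑ i ∈ Finset.range S, φ (ζ i w)‖ ^ 2 =
        ∑ i ∈ Finset.range S, ∑ j ∈ Finset.range S, inner ℝ (φ (ζ i w)) (φ (ζ j w)) := fun w ↦ by
      rw [← real_inner_self_eq_norm_sq, sum_inner]
      exact Finset.sum_congr rfl fun i _ ↦ inner_sum _ _ _
    simp only [hsq]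
    rw [integral_finsetSum _ fun i _ ↦ integrable_finsetSum _ fun j _ ↦
      (hY _).integrable_inner_of_two (hY _)]
    have hrow : ∀ i, ∫ w, ∑ j ∈ Finset.range S, inner ℝ (φ (ζ i w)) (φ (ζ j w)) ∂μ =
        ∑ j ∈ Finset.range S, if i = j then ∫ x, ‖φ x‖ ^ 2 ∂P else 0 := fun i ↦ by
      rw [integral_finsetSum _ fun j _ ↦ (hY _).integrable_inner_of_two (hY j)]
      exact Finset.sum_congr rfl fun j _ ↦ hcov i j
    rw [Finset.sum_congr rfl fun i hi ↦ (hrow i).trans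
      ((Finset.sum_ite_eq _ _ _).trans (if_pos hi))]
    simp
  have hZ1 : ∫ w, inner ℝ a (∑ i ∈ Finset.range S, φ (ζ i w)) ∂μ = 0 := by
    rw [integral_inner (hZ.integrable one_le_two),
      integral_finsetSum _ fun i _ ↦ (hY i).integrable one_le_two]
    simp [hmean]
  set c : ℝ := (S : ℝ)⁻¹ with hc
  have hexp : ∀ w, ‖a + c • ∑ i ∈ Finset.range S, φ (ζ i w)‖ ^ 2 = ‖a‖ ^ 2 +
      2 * c * inner ℝ a (∑ i ∈ Finset.range S, φ (ζ i w)) +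
        c ^ 2 * ‖∑ i ∈ Finset.range S, φ (ζ i w)‖ ^ 2 := fun w ↦ by
    rw [norm_add_sq_real, inner_smul_right, norm_smul, mul_pow, Real.norm_eq_abs, sq_abs]
    ring
  have hi1 : Integrable (fun w ↦ 2 * c * inner ℝ a (∑ i ∈ Finset.range S, φ (ζ i w))) μ :=
    ((hZ.integrable one_le_two).const_inner a).const_mul _
  have hi2 : Integrable (fun w ↦ c ^ 2 * ‖∑ i ∈ Finset.range S, φ (ζ i w)‖ ^ 2) μ :=
    hZ.norm.integrable_sq.const_mul _
  have hi0 : Integrable (fun w ↦ ‖a‖ ^ 2 +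
      2 * c * inner ℝ a (∑ i ∈ Finset.range S, φ (ζ i w))) μ := (integrable_const _).add hi1
  have hint : ∫ w, ‖a + c • ∑ i ∈ Finset.range S, φ (ζ i w)‖ ^ 2 ∂μ ≤ ‖a‖ ^ 2 + C / S := by
    simp only [hexp]
    rw [integral_add hi0 hi2, integral_add (integrable_const _) hi1, integral_const_mul,
      integral_const_mul, hZ1, hZ2]
    simp only [integral_const, probReal_univ, one_smul, mul_zero, add_zero]
    have h3 : c ^ 2 * (S * ∫ x, ‖φ x‖ ^ 2 ∂P) = (∫ x, ‖φ x‖ ^ 2 ∂P) / S := by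
      rcases Nat.eq_zero_or_pos S with rfl | hS
      · simp
      · rw [hc]; field_simp
    rw [h3]
    gcongr
  refine le_trans (le_of_eq ?_) (ENNReal.ofReal_le_ofReal hint)
  rw [ofReal_integral_eq_lintegral_ofReal]
  · refine lintegral_congr fun w ↦ ?_
    rw [ENNReal.ofReal_pow (norm_nonneg _), ofReal_norm]
  · simp only [hexp]
    exact hi0.add hi2
  · exact ae_of_all _ fun w ↦ by positivity

end Variance

/-- Fubini's theorem for independent random variables. -/
theorem lintegral_of_indepFun {A B : Type*} [MeasurableSpace A] [MeasurableSpace B]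
    {Z : Ω → A} {R : Ω → B} (hZ : Measurable Z) (hR : Measurable R) (hind : IndepFun Z R μ)
    {h : A × B → ENNReal} (hh : Measurable h) :
    ∫⁻ w, h (Z w, R w) ∂μ = ∫⁻ a, ∫⁻ w', h (a, R w') ∂μ ∂(μ.map Z) := by
  have h1 := (indepFun_iff_map_prod_eq_prod_map_map hZ.aemeasurable hR.aemeasurable).1 hind
  have := Measure.isProbabilityMeasure_map (μ := μ) hR.aemeasurable
  rw [← lintegral_map hh (hZ.prodMk hR), h1, lintegral_prod _ hh.aemeasurable]
  refine lintegral_congr fun a ↦ ?_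
  exact lintegral_map (hh.comp measurable_prodMk_left) hR

/-- A bound on the conditional expectation given `Z` holds for the expectation. -/
theorem lintegral_le_of_indepFun {A B : Type*} [MeasurableSpace A] [MeasurableSpace B]
    {Z : Ω → A} {R : Ω → B} (hZ : Measurable Z) (hR : Measurable R) (hind : IndepFun Z R μ)
    {h : A × B → ENNReal} (hh : Measurable h) {G : A → ENNReal} (hG : Measurable G)
    (hle : ∀ a, ∫⁻ w', h (a, R w') ∂μ ≤ G a) :
    ∫⁻ w, h (Z w, R w) ∂μ ≤ ∫⁻ w, G (Z w) ∂μ := by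
  rw [lintegral_of_indepFun hZ hR hind hh, ← lintegral_map hG hZ]
  exact lintegral_mono hle

/-- The rows of samples before the row `k`; the other rows are replaced by a constant. The state
before the iteration `k` is a function of them, and they are independent of the row `k`. -/
def pastRows {Ξ : Type*} (ξ₀ : Ξ) (k : ℕ) (s : ℕ → ℕ → Ξ) (j i : ℕ) : Ξ :=
  if j < k then s j i else ξ₀

theorem measurable_pastRows (ξ₀ : Ξ) (k : ℕ) : Measurable (pastRows ξ₀ k) := by
  refine measurable_pi_iff.2 fun j ↦ measurable_pi_iff.2 fun i ↦ ?_
  unfold pastRows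
  split_ifs
  · fun_prop
  · exact measurable_const

theorem indepFun_pastRows {ξ : ℕ → ℕ → Ω → Ξ} (hξ : ∀ k i, Measurable (ξ k i))
    (hind : iIndepFun (fun (j : ℕ × ℕ) ↦ ξ j.1 j.2) μ) (ξ₀ : Ξ) (k : ℕ) :
    IndepFun (fun w ↦ pastRows ξ₀ k (fun j i ↦ ξ j i w)) (fun w i ↦ ξ k i w) μ := by
  have hdisj : Disjoint {j : ℕ × ℕ | j.1 < k} {j | j.1 = k} :=
    Set.disjoint_left.2 fun j hj hj' ↦ (ne_of_lt hj) hj'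
  have h := indep_iSup_of_disjoint (m := fun j : ℕ × ℕ ↦ MeasurableSpace.comap (ξ j.1 j.2) _)
    (fun j ↦ (hξ j.1 j.2).comap_le) hind hdisj
  refine indep_of_indep_of_le_left (indep_of_indep_of_le_right h ?_) ?_
  · simp only [MeasurableSpace.pi, MeasurableSpace.comap_iSup, MeasurableSpace.comap_comp]
    exact iSup_le fun i ↦ le_iSup₂_of_le (f := fun (j : ℕ × ℕ) (_ : j ∈ {j : ℕ × ℕ | j.1 = k}) ↦
      MeasurableSpace.comap (ξ j.1 j.2) _) (k, i) rfl le_rfl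
  · simp only [MeasurableSpace.pi, MeasurableSpace.comap_iSup, MeasurableSpace.comap_comp]
    refine iSup_le fun j ↦ iSup_le fun i ↦ ?_
    by_cases hj : j < k
    · refine le_iSup₂_of_le (f := fun (j : ℕ × ℕ) (_ : j ∈ {j : ℕ × ℕ | j.1 < k}) ↦
        MeasurableSpace.comap (ξ j.1 j.2) _) (j, i) hj (le_of_eq ?_)
      congr 1
      funext w
      simp [pastRows, hj]
    · refine (le_of_eq ?_).trans bot_le
      convert MeasurableSpace.comap_const (α := Ω) ξ₀ using 2
      funext w
      simp [pastRows, hj]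

end Probability

/-! ### The iterations of the algorithm -/

section Run

variable {E : Type*} [NormedAddCommGroup E] [NormedSpace ℝ E] [FiniteDimensional ℝ E]
  {M : Type*} [TopologicalSpace M] [ChartedSpace E M]
  [RiemannianBundle (fun x : M ↦ TangentSpace 𝓘(ℝ, E) x)] {Ξ : Type*}
  (log : ∀ x : M, M → TangentSpace 𝓘(ℝ, E) x) (f : M → Ξ → ℝ) (par : SpiderParams) (x₀ : M)

theorem spiderRun_iter (s : ℕ → ℕ → Ξ) (k : ℕ) :
    (spiderRun log f par x₀ s k).iter = min k par.T := by
  induction k with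
  | zero => simp [spiderRun]
  | succ k ih =>
    rw [spiderRun, spiderStep]
    split_ifs with h
    · rw [ih] at h
      change (spiderRun log f par x₀ s k).iter + 1 = _
      omega
    · omega

theorem spiderRun_succ {k : ℕ} (hk : k < par.T) (s : ℕ → ℕ → Ξ) :
    spiderRun log f par x₀ s (k + 1) =
      { iter := (spiderRun log f par x₀ s k).iter + 1
        prev := ⟨(spiderRun log f par x₀ s k).cur,
          estimator log f par (s k) (spiderRun log f par x₀ s k)⟩
        cur := expMap (spiderRun log f par x₀ s k).cur
          (-(par.η • estimator log f par (s k) (spiderRun log f par x₀ s k)))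
        calls := (spiderRun log f par x₀ s k).calls +
          iterCalls log par (spiderRun log f par x₀ s k) } := by
  rw [spiderRun, spiderStep, if_pos (by rw [spiderRun_iter]; omega)]

/-- The state after `k` iterations depends on the first `k` rows of samples only. -/
theorem spiderRun_congr {s s' : ℕ → ℕ → Ξ} {k : ℕ} (h : ∀ j < k, s j = s' j) :
    spiderRun log f par x₀ s k = spiderRun log f par x₀ s' k := by
  induction k with
  | zero => rfl
  | succ k ih =>
    rw [spiderRun, spiderRun, ih fun j hj ↦ h j (hj.trans k.lt_succ_self), h k k.lt_succ_self]

theorem spiderRun_pastRows (ξ₀ : Ξ) (s : ℕ → ℕ → Ξ) (k : ℕ) :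
    spiderRun log f par x₀ (pastRows ξ₀ k s) k = spiderRun log f par x₀ s k := by
  refine spiderRun_congr _ _ _ _ fun j hj ↦ ?_
  funext i
  simp [pastRows, hj]

end Run

/-! ### Measurability of the iterates -/

section MeasurableRun

variable {E : Type*} [NormedAddCommGroup E] [NormedSpace ℝ E] [FiniteDimensional ℝ E]
  {M : Type*} [TopologicalSpace M] [T2Space M] [SecondCountableTopology M]
  [MeasurableSpace M] [BorelSpace M]
  [ChartedSpace E M] [IsManifold 𝓘(ℝ, E) ∞ M]
  [RiemannianBundle (fun x : M ↦ TangentSpace 𝓘(ℝ, E) x)]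
  [IsContMDiffRiemannianBundle 𝓘(ℝ, E) ∞ E (fun x : M ↦ TangentSpace 𝓘(ℝ, E) x)]
  {Ξ : Type*} [MeasurableSpace Ξ]
  {log : ∀ x : M, M → TangentSpace 𝓘(ℝ, E) x} {P : Measure Ξ}
  {f : M → Ξ → ℝ} {F : M → ℝ} {L σ : ℝ} {α : Type*} [MeasurableSpace α]

theorem MeasurableToTangent.comp {β : Type*} [MeasurableSpace β]
    {g : β → TangentBundle 𝓘(ℝ, E) M} (hg : MeasurableToTangent g) {φ : α → β}
    (hφ : Measurable φ) : MeasurableToTangent (fun a ↦ g (φ a)) := by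
  let _ : MeasurableSpace (TangentBundle 𝓘(ℝ, E) M) := borel _
  exact Measurable.comp (g := g) hg hφ

theorem MeasurableToTangent.proj {g : α → TangentBundle 𝓘(ℝ, E) M} (hg : MeasurableToTangent g) :
    Measurable fun a ↦ (g a).proj := by
  let _ : MeasurableSpace (TangentBundle 𝓘(ℝ, E) M) := borel _
  have : BorelSpace (TangentBundle 𝓘(ℝ, E) M) := ⟨rfl⟩
  exact (FiberBundle.continuous_proj E (TangentSpace 𝓘(ℝ, E) (M := M))).measurable.comp hg

/-- Batch sizes are random, so averages with a random number of terms have to be measurable. -/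
theorem MeasurableToTangent.of_countable {g : ℕ → α → TangentBundle 𝓘(ℝ, E) M}
    (hg : ∀ n, MeasurableToTangent (g n)) {N : α → ℕ} (hN : Measurable N) :
    MeasurableToTangent (fun a ↦ g (N a) a) := by
  let _ : MeasurableSpace (TangentBundle 𝓘(ℝ, E) M) := borel _
  have h : Measurable fun z : α × ℕ ↦ g z.2 z.1 := measurable_from_prod_countable_left hg
  exact h.comp (measurable_id.prodMk hN)

theorem IsInverseExp.measurable_norm (hlog : IsInverseExp log) {x y : α → M} (hx : Measurable x)
    (hy : Measurable y) : Measurable fun a ↦ ‖log (x a) (y a)‖ :=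
  (hlog.measurable.comp (hx.prodMk hy)).norm

theorem IsInverseExp.measurable_smallBatch (hlog : IsInverseExp log) (par : SpiderParams)
    {x y : α → M} (hx : Measurable x) (hy : Measurable y) :
    Measurable fun a ↦ smallBatch log par (x a) (y a) := by
  have h := hlog.measurable_norm hx hy
  exact Nat.measurable_ceil.comp (by fun_prop)

namespace StochasticObjective

variable (H : StochasticObjective log P f F L σ) {x : α → M} {r : α → ℕ → Ξ}
  {st : α → SpiderState E M} {par : SpiderParams} {k : ℕ}

include H

theorem measurable_batchGrad (hx : Measurable x) (hr : Measurable r) {S : α → ℕ}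
    (hS : Measurable S) :
    MeasurableToTangent
      (fun a ↦ (⟨x a, batchGrad E f (r a) (S a) (x a)⟩ : TangentBundle 𝓘(ℝ, E) M)) := by
  rcases isEmpty_or_nonempty M with h | h
  · have : IsEmpty α := ⟨fun a ↦ h.false (x a)⟩
    exact @measurable_of_empty _ _ _ (borel _) _ _
  borelize E
  refine MeasurableToTangent.of_countable
    (g := fun n a ↦ (⟨x a, batchGrad E f (r a) n (x a)⟩ : TangentBundle 𝓘(ℝ, E) M))
    (fun n ↦ ?_) hS
  refine MeasurableToTangent.smul measurable_const (MeasurableToTangent.sum hx fun i ↦ ?_)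
  exact H.measurable.comp (hx.prodMk ((measurable_pi_apply i).comp hr))

theorem measurable_estimator (hiter : ∀ a, (st a).iter = k)
    (hprev : MeasurableToTangent fun a ↦ (st a).prev) (hcur : Measurable fun a ↦ (st a).cur)
    (hr : Measurable r) :
    MeasurableToTangent (fun a ↦
      (⟨(st a).cur, estimator log f par (r a) (st a)⟩ : TangentBundle 𝓘(ℝ, E) M)) := by
  rcases isEmpty_or_nonempty M with h | h
  · have : IsEmpty α := ⟨fun a ↦ h.false (st a).cur⟩
    exact @measurable_of_empty _ _ _ (borel _) _ _
  borelize E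
  simp only [estimator, hiter]
  split_ifs
  · exact H.measurable_batchGrad hcur hr measurable_const
  · have hS := H.isInverseExp.measurable_smallBatch par hprev.proj hcur
    exact (H.measurable_batchGrad hcur hr hS).sub
      (MeasurableToTangent.transport H.complete H.isInverseExp hprev.proj hcur
        ((H.measurable_batchGrad hprev.proj hr hS).sub hprev))

theorem measurable_spiderRun (x₀ : M) (k : ℕ) :
    MeasurableToTangent (fun s : ℕ → ℕ → Ξ ↦ (spiderRun log f par x₀ s k).prev) ∧
      Measurable (fun s : ℕ → ℕ → Ξ ↦ (spiderRun log f par x₀ s k).cur) ∧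
      Measurable (fun s : ℕ → ℕ → Ξ ↦ (spiderRun log f par x₀ s k).calls) := by
  have : Nonempty M := ⟨x₀⟩
  borelize E
  induction k with
  | zero => exact ⟨@measurable_const _ _ (borel _) _ _, measurable_const, measurable_const⟩
  | succ k ih =>
    rcases lt_or_ge k par.T with hk | hk
    · have hest := H.measurable_estimator (par := par) (r := fun s : ℕ → ℕ → Ξ ↦ s k)
        (fun s ↦ spiderRun_iter log f par x₀ s k) ih.1 ih.2.1 (measurable_pi_apply k)
      simp only [spiderRun_succ log f par x₀ hk]
      refine ⟨hest, MeasurableToTangent.expMap H.complete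
        (hest.smul (r := fun _ ↦ par.η) measurable_const).neg, ih.2.2.add ?_⟩
      simp only [iterCalls, spiderRun_iter]
      split_ifs
      · exact measurable_const
      · exact (H.isInverseExp.measurable_smallBatch par ih.1.proj ih.2.1).const_mul 2
    · have hidle : ∀ s, spiderRun log f par x₀ s (k + 1) = spiderRun log f par x₀ s k := fun s ↦ by
        rw [spiderRun, spiderStep, if_neg (by rw [spiderRun_iter]; omega)]
      simpa only [hidle] using ih

end StochasticObjective

end MeasurableRun

/-! ### The error of one gradient estimator, given the past -/

section EstimatorError

/-- The variance is at most the second moment. -/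
theorem integral_norm_sub_integral_sq_le {Ξ V : Type*} [MeasurableSpace Ξ] {P : Measure Ξ}
    [IsProbabilityMeasure P] [NormedAddCommGroup V] [InnerProductSpace ℝ V] [CompleteSpace V]
    {D : Ξ → V} (hD : MemLp D 2 P) : ∫ ξ, ‖D ξ - ∫ ζ, D ζ ∂P‖ ^ 2 ∂P ≤ ∫ ξ, ‖D ξ‖ ^ 2 ∂P := by
  set m := ∫ ζ, D ζ ∂P with hm
  have hi := hD.integrable one_le_two
  have h1 : Integrable (fun ξ ↦ 2 * inner ℝ m (D ξ)) P := (hi.const_inner m).const_mul 2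
  have h2 : Integrable (fun ξ ↦ ‖D ξ‖ ^ 2 - 2 * inner ℝ m (D ξ)) P := hD.norm.integrable_sq.sub h1
  have hexp : ∀ ξ, ‖D ξ - m‖ ^ 2 = ‖D ξ‖ ^ 2 - 2 * inner ℝ m (D ξ) + ‖m‖ ^ 2 := fun ξ ↦ by
    rw [norm_sub_sq_real, real_inner_comm]
  simp only [hexp]
  rw [integral_add h2 (integrable_const _), integral_sub hD.norm.integrable_sq h1,
    integral_const_mul, integral_inner hi, ← hm, real_inner_self_eq_norm_sq]
  simp only [integral_const, probReal_univ, one_smul]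
  nlinarith [sq_nonneg ‖m‖]

variable {E : Type*} [NormedAddCommGroup E] [NormedSpace ℝ E] [FiniteDimensional ℝ E]
  {M : Type*} [TopologicalSpace M] [T2Space M] [SecondCountableTopology M]
  [MeasurableSpace M] [BorelSpace M]
  [ChartedSpace E M] [IsManifold 𝓘(ℝ, E) ∞ M]
  [RiemannianBundle (fun x : M ↦ TangentSpace 𝓘(ℝ, E) x)]
  [IsContMDiffRiemannianBundle 𝓘(ℝ, E) ∞ E (fun x : M ↦ TangentSpace 𝓘(ℝ, E) x)]
  {Ξ : Type*} [MeasurableSpace Ξ]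
  {log : ∀ x : M, M → TangentSpace 𝓘(ℝ, E) x} {P : Measure Ξ} [IsProbabilityMeasure P]
  {f : M → Ξ → ℝ} {F : M → ℝ} {L σ : ℝ}
  {Ω : Type*} [MeasurableSpace Ω] {μ : Measure Ω} [IsProbabilityMeasure μ]

namespace StochasticObjective

variable (H : StochasticObjective log P f F L σ)

include H

theorem integral_norm_grad_sub_sq_le (x : M) :
    ∫ ξ, ‖grad E (fun y ↦ f y ξ) x - grad E F x‖ ^ 2 ∂P ≤ σ ^ 2 := by
  have h : ∫ ξ, ‖grad E (fun y ↦ f y ξ) x - grad E F x‖ ^ 2 ∂P =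
      (∫⁻ ξ, ‖grad E F x - grad E (fun y ↦ f y ξ) x‖ₑ ^ 2 ∂P).toReal := by
    simp only [fun ξ ↦ norm_sub_rev (grad E (fun y ↦ f y ξ) x) (grad E F x)]
    rw [integral_eq_lintegral_of_nonneg_ae (ae_of_all _ fun ξ ↦ sq_nonneg _)
      (H.memLp_grad_sub x).norm.integrable_sq.aestronglyMeasurable]
    congr 1
    refine lintegral_congr fun ξ ↦ ?_
    rw [ENNReal.ofReal_pow (norm_nonneg _), ofReal_norm]
  rw [h]
  exact ENNReal.toReal_le_of_le_ofReal (sq_nonneg σ) (H.variance x)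

variable {ζ : ℕ → Ω → Ξ} (hζ : ∀ i, Measurable (ζ i)) (hlaw : ∀ i, μ.map (ζ i) = P)
  (hind : ∀ i j, i ≠ j → IndepFun (ζ i) (ζ j) μ) {par : SpiderParams} {st : SpiderState E M}

include hζ hlaw hind

/-- The mean square error of the estimator from a large batch, for a fixed state. -/
theorem lintegral_estimator_error_of_large (hS : 0 < par.S₁) (hst : st.iter % par.q = 0) :
    ∫⁻ w, ‖estimator log f par (fun i ↦ ζ i w) st - grad E F st.cur‖ₑ ^ 2 ∂μ ≤
      ENNReal.ofReal (σ ^ 2 / par.S₁) := by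
  have : CompleteSpace (TangentSpace 𝓘(ℝ, E) st.cur) :=
    FiniteDimensional.complete ℝ (TangentSpace 𝓘(ℝ, E) st.cur)
  have hmem : MemLp (fun ξ ↦ grad E (fun y ↦ f y ξ) st.cur - grad E F st.cur) 2 P := by
    have h := (H.memLp_grad_sub st.cur).neg
    refine h.ae_eq (ae_of_all _ fun ξ ↦ neg_sub _ _)
  have h0 : ∫ ξ, (grad E (fun y ↦ f y ξ) st.cur - grad E F st.cur) ∂P = 0 := by
    rw [integral_sub (H.integrable_grad _) (integrable_const _), H.integral_grad]
    simp
  have h := lintegral_enorm_add_average_sq_le hζ hlaw hind hmem h0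
    (H.integral_norm_grad_sub_sq_le st.cur) 0 par.S₁
  rw [norm_zero, zero_pow two_ne_zero, zero_add] at h
  refine le_trans (le_of_eq (lintegral_congr fun w ↦ ?_)) h
  rw [estimator, if_pos hst, batchGrad, zero_add, Finset.sum_sub_distrib, smul_sub,
    Finset.sum_const, Finset.card_range, ← Nat.cast_smul_eq_nsmul ℝ, smul_smul,
    inv_mul_cancel₀ (by positivity), one_smul]

/-- The mean square error of the estimator from a small batch, for a fixed state. The error is the
transported error of the previous estimator plus an average of centered vectors of norm at most
`L ‖log x' x‖`, before centering. -/
theorem lintegral_estimator_error_of_small (hL : 0 < L) (hparL : par.L = L) (hε : 0 < par.ε)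
    (hq : 0 < par.q) (hst : st.iter % par.q ≠ 0) :
    ∫⁻ w, ‖estimator log f par (fun i ↦ ζ i w) st - grad E F st.cur‖ₑ ^ 2 ∂μ ≤
      ENNReal.ofReal (‖st.prev.snd - grad E F st.prev.proj‖ ^ 2 + 2 * par.ε ^ 2 / par.q) := by
  obtain ⟨iter, ⟨x', v'⟩, x, calls⟩ := st
  simp only at hst ⊢
  have : CompleteSpace (TangentSpace 𝓘(ℝ, E) x) :=
    FiniteDimensional.complete ℝ (TangentSpace 𝓘(ℝ, E) x)
  obtain ⟨A, hA⟩ := exists_linearIsometry_transport H.complete H.isInverseExp x' x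
  set D : Ξ → TangentSpace 𝓘(ℝ, E) x := fun ξ ↦
    grad E (fun y ↦ f y ξ) x - A (grad E (fun y ↦ f y ξ) x') with hD
  set ℓ := ‖log x' x‖ with hℓ
  have hDb : ∀ ξ, ‖D ξ‖ ≤ L * ℓ := fun ξ ↦ by
    have h := (H.smooth ξ).2 x x'
    rwa [hA, norm_log_symm H.complete H.isInverseExp] at h
  have hDm : MemLp D 2 P := by
    refine MemLp.of_bound ?_ (L * ℓ) (ae_of_all _ hDb)
    exact ((H.stronglyMeasurable_grad x).sub
      (A.continuous.comp_stronglyMeasurable (H.stronglyMeasurable_grad x'))).aestronglyMeasurable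
  have hDI : ∫ ξ, D ξ ∂P = grad E F x - A (grad E F x') := by
    have h := H.grad_sub_transport_eq_integral x x'
    simp only [hA] at h
    exact h.symm
  set φ : Ξ → TangentSpace 𝓘(ℝ, E) x := fun ξ ↦ D ξ - ∫ ζ, D ζ ∂P with hφ
  have hφm : MemLp φ 2 P := hDm.sub (memLp_const _)
  have h0 : ∫ ξ, φ ξ ∂P = 0 := by
    rw [hφ, integral_sub (hDm.integrable one_le_two) (integrable_const _)]
    simp
  have hC : ∫ ξ, ‖φ ξ‖ ^ 2 ∂P ≤ L ^ 2 * ℓ ^ 2 := by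
    refine (integral_norm_sub_integral_sq_le hDm).trans ?_
    calc ∫ ξ, ‖D ξ‖ ^ 2 ∂P ≤ ∫ _, L ^ 2 * ℓ ^ 2 ∂P := by
          refine integral_mono hDm.norm.integrable_sq (integrable_const _) fun ξ ↦ ?_
          have := pow_le_pow_left₀ (norm_nonneg _) (hDb ξ) 2
          rwa [mul_pow] at this
      _ = L ^ 2 * ℓ ^ 2 := by simp
  set S := smallBatch log par x' x with hS
  have h := lintegral_enorm_add_average_sq_le hζ hlaw hind hφm h0 hC (A (v' - grad E F x')) S
  have hSle : (par.q : ℝ) * L ^ 2 * ℓ ^ 2 / (2 * par.ε ^ 2) ≤ S := by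
    rw [hS, smallBatch, hparL]
    exact Nat.le_ceil _
  have hq' : (0 : ℝ) < par.q := by exact_mod_cast hq
  have hrate : L ^ 2 * ℓ ^ 2 / S ≤ 2 * par.ε ^ 2 / par.q := by
    -- for an empty batch the left-hand side is a division by zero, with value `0`
    rcases Nat.eq_zero_or_pos S with h0 | hpos
    · rw [h0, Nat.cast_zero, div_zero]
      positivity
    · have hpos' : (0 : ℝ) < S := by exact_mod_cast hpos
      rw [div_le_div_iff₀ hpos' hq']
      rw [div_le_iff₀ (by positivity)] at hSle
      linarith
  refine le_trans (le_of_eq (lintegral_congr fun w ↦ ?_))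
    (h.trans (ENNReal.ofReal_le_ofReal (by rw [A.norm_map]; linarith)))
  congr 2
  rw [estimator, if_neg hst]
  simp only [← hS, hA, batchGrad, map_sub, map_smul, map_sum]
  rw [hφ]
  simp only [hDI]
  rw [Finset.sum_sub_distrib, smul_sub, Finset.sum_const, Finset.card_range,
    ← Nat.cast_smul_eq_nsmul ℝ, smul_smul, hD]
  simp only [Finset.sum_sub_distrib, smul_sub]
  rcases Nat.eq_zero_or_pos S with h0 | hpos
  · -- An empty batch is drawn only if `log x' x = 0`; then smoothness with a vanishing right-hand
    -- side says that transport carries one gradient of `F` to the other.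
    have hℓ0 : ℓ = 0 := by
      rw [h0, Nat.cast_zero, div_le_iff₀ (by positivity), zero_mul] at hSle
      have : (par.q : ℝ) * L ^ 2 * ℓ ^ 2 = 0 := hSle.antisymm (by positivity)
      have h3 : ℓ ^ 2 = 0 := (mul_eq_zero.1 this).resolve_left (by positivity)
      exact pow_eq_zero_iff two_ne_zero |>.1 h3
    have hF := H.geodesicallySmooth.2 x x'
    rw [hA, norm_log_symm H.complete H.isInverseExp, ← hℓ, hℓ0, mul_zero] at hF
    have hF' : grad E F x = A (grad E F x') := sub_eq_zero.1 (norm_le_zero_iff.1 hF)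
    rw [h0, hF']
    simp
  · rw [inv_mul_cancel₀ (by positivity), one_smul, one_smul]
    abel

end StochasticObjective

end EstimatorError

/-! ### The mean square error of the gradient estimators along a run -/

section ErrorAlongRun

variable {E : Type*} [NormedAddCommGroup E] [NormedSpace ℝ E] [FiniteDimensional ℝ E]
  {M : Type*} [TopologicalSpace M] [T2Space M] [SecondCountableTopology M]
  [MeasurableSpace M] [BorelSpace M]
  [ChartedSpace E M] [IsManifold 𝓘(ℝ, E) ∞ M]
  [RiemannianBundle (fun x : M ↦ TangentSpace 𝓘(ℝ, E) x)]
  [IsContMDiffRiemannianBundle 𝓘(ℝ, E) ∞ E (fun x : M ↦ TangentSpace 𝓘(ℝ, E) x)]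
  {Ξ : Type*} [MeasurableSpace Ξ]
  {log : ∀ x : M, M → TangentSpace 𝓘(ℝ, E) x} {P : Measure Ξ} [IsProbabilityMeasure P]
  {f : M → Ξ → ℝ} {F : M → ℝ} {L σ : ℝ} {par : SpiderParams} {x₀ : M}
  {Ω : Type*} [MeasurableSpace Ω] {μ : Measure Ω} [IsProbabilityMeasure μ]

variable (log f par x₀) in
/-- The error `‖v_k - ∇F(x_k)‖` of the gradient estimator in the iteration `k`. -/
def estimatorError (F : M → ℝ) (k : ℕ) (s : ℕ → ℕ → Ξ) : ℝ :=
  ‖estimator log f par (s k) (spiderRun log f par x₀ s k) -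
    grad E F (spiderRun log f par x₀ s k).cur‖

/-- A nonnegative measurable function whose square has a finite Lebesgue integral is square
integrable. -/
theorem integrable_sq_of_lintegral_le {X : Ω → ℝ} (hX : Measurable X) {B : ℝ} (hB : 0 ≤ B)
    (h : ∫⁻ w, ‖X w‖ₑ ^ 2 ∂μ ≤ ENNReal.ofReal B) :
    Integrable (fun w ↦ X w ^ 2) μ ∧ ∫ w, X w ^ 2 ∂μ ≤ B := by
  have heq : ∀ w, ENNReal.ofReal (X w ^ 2) = ‖X w‖ₑ ^ 2 := fun w ↦ by
    rw [← sq_abs, ENNReal.ofReal_pow (abs_nonneg _), ← Real.norm_eq_abs, ofReal_norm]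
  have hm : AEStronglyMeasurable (fun w ↦ X w ^ 2) μ := (hX.pow_const 2).aestronglyMeasurable
  refine ⟨⟨hm, ?_⟩, ?_⟩
  · rw [hasFiniteIntegral_iff_ofReal (ae_of_all _ fun w ↦ sq_nonneg _)]
    simp only [heq]
    exact h.trans_lt ENNReal.ofReal_lt_top
  · rw [integral_eq_lintegral_of_nonneg_ae (ae_of_all _ fun w ↦ sq_nonneg _) hm]
    simp only [heq]
    exact ENNReal.toReal_le_of_le_ofReal hB h

namespace StochasticObjective

variable (H : StochasticObjective log P f F L σ)

include H

theorem measurable_estimatorError (k : ℕ) :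
    Measurable (estimatorError log f par x₀ F k) := by
  have : Nonempty M := ⟨x₀⟩
  borelize E
  have h := H.measurable_spiderRun (par := par) x₀ k
  have hest := H.measurable_estimator (par := par) (r := fun s : ℕ → ℕ → Ξ ↦ s k)
    (fun s ↦ spiderRun_iter log f par x₀ s k) h.1 h.2.1 (measurable_pi_apply k)
  exact (hest.sub (H.measurable_grad.comp h.2.1)).norm

variable {ξ : ℕ → ℕ → Ω → Ξ} (hξ : ∀ k i, Measurable (ξ k i)) (hlaw : ∀ k i, μ.map (ξ k i) = P)
  (hind : iIndepFun (fun (j : ℕ × ℕ) ↦ ξ j.1 j.2) μ)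

include hξ hlaw hind

/-- The mean square error of the gradient estimator grows by at most `2 ε² / q` in each iteration
since the last large batch, because the samples of an iteration are independent of its state. -/
theorem lintegral_estimatorError_sq_le (hL : 0 < L) (hparL : par.L = L) (hε : 0 < par.ε)
    (hq : 0 < par.q) (hS : 0 < par.S₁) {k : ℕ} (hk : k < par.T) :
    ∫⁻ w, ‖estimatorError log f par x₀ F k (fun j i ↦ ξ j i w)‖ₑ ^ 2 ∂μ ≤
      ENNReal.ofReal (σ ^ 2 / par.S₁ + (k % par.q : ℕ) * (2 * par.ε ^ 2 / par.q)) := by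
  have : Nonempty M := ⟨x₀⟩
  borelize E
  obtain ⟨ξ₀⟩ : Nonempty Ξ := P.nonempty_of_neZero
  -- The error in iteration `k`, as a function of the past rows and of the current row.
  set h : (ℕ → ℕ → Ξ) × (ℕ → Ξ) → ENNReal := fun z ↦
    ‖‖estimator log f par z.2 (spiderRun log f par x₀ z.1 k) -
      grad E F (spiderRun log f par x₀ z.1 k).cur‖‖ₑ ^ 2 with hh
  have hmeas : ∀ n, MeasurableToTangent (fun s : ℕ → ℕ → Ξ ↦ (spiderRun log f par x₀ s n).prev) ∧
      Measurable (fun s : ℕ → ℕ → Ξ ↦ (spiderRun log f par x₀ s n).cur) ∧ _ :=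
    fun n ↦ H.measurable_spiderRun (par := par) x₀ n
  have hhm : Measurable h := by
    have hest := H.measurable_estimator (par := par) (r := Prod.snd)
      (fun z : (ℕ → ℕ → Ξ) × (ℕ → Ξ) ↦ spiderRun_iter log f par x₀ z.1 k)
      ((hmeas k).1.comp measurable_fst) ((hmeas k).2.1.comp measurable_fst) measurable_snd
    exact ((hest.sub (H.measurable_grad.comp
      ((hmeas k).2.1.comp measurable_fst))).norm.enorm).pow_const 2
  have hZ : Measurable fun w ↦ pastRows ξ₀ k (fun j i ↦ ξ j i w) :=
    (measurable_pastRows ξ₀ k).comp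
      (measurable_pi_iff.2 fun j ↦ measurable_pi_iff.2 fun i ↦ hξ j i)
  have hR : Measurable fun w i ↦ ξ k i w := measurable_pi_iff.2 fun i ↦ hξ k i
  have hpair : ∀ i j, i ≠ j → IndepFun (ξ k i) (ξ k j) μ := fun i j hij ↦
    hind.indepFun (i := (k, i)) (j := (k, j)) (by simpa using hij)
  have hstart : ∫⁻ w, ‖estimatorError log f par x₀ F k (fun j i ↦ ξ j i w)‖ₑ ^ 2 ∂μ =
      ∫⁻ w, h (pastRows ξ₀ k (fun j i ↦ ξ j i w), fun i ↦ ξ k i w) ∂μ := by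
    refine lintegral_congr fun w ↦ ?_
    simp only [hh]
    rw [spiderRun_pastRows]
    rfl
  have hiter : ∀ a, (spiderRun log f par x₀ a k).iter = k := fun a ↦ by
    rw [spiderRun_iter]; omega
  rw [hstart]
  by_cases hkq : k % par.q = 0
  · refine (lintegral_le_of_indepFun hZ hR (indepFun_pastRows hξ hind ξ₀ k) hhm
      (G := fun _ ↦ ENNReal.ofReal (σ ^ 2 / par.S₁)) measurable_const fun a ↦ ?_).trans ?_
    · simp only [hh, enorm_norm]
      exact H.lintegral_estimator_error_of_large (hξ k) (hlaw k) hpair hS (by rw [hiter, hkq])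
    · simp [hkq]
  · obtain ⟨j, rfl⟩ : ∃ j, k = j + 1 := Nat.exists_eq_succ_of_ne_zero (by rintro rfl; simp at hkq)
    have hmod : (j + 1) % par.q = j % par.q + 1 := by
      rw [Nat.add_mod_eq_ite] at hkq ⊢
      have h1 : 1 % par.q = 1 := Nat.mod_eq_of_lt (by
        rcases Nat.lt_or_ge 1 par.q with h | h
        · exact h
        · interval_cases hqq : par.q
          simp [Nat.mod_one] at hkq)
      rw [h1] at hkq ⊢
      have := Nat.mod_lt j hq
      split_ifs at hkq ⊢ with hc <;> omega
    set c : ℝ := 2 * par.ε ^ 2 / par.q with hc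
    have hc0 : 0 ≤ c := by positivity
    have ih := lintegral_estimatorError_sq_le hL hparL hε hq hS ((Nat.lt_succ_self j).trans hk)
    have hGm : Measurable fun a : ℕ → ℕ → Ξ ↦ ‖(spiderRun log f par x₀ a (j + 1)).prev.snd -
        grad E F (spiderRun log f par x₀ a (j + 1)).prev.proj‖ :=
      (MeasurableToTangent.sub (hmeas (j + 1)).1
        (H.measurable_grad.comp (hmeas (j + 1)).1.proj)).norm
    refine (lintegral_le_of_indepFun hZ hR (indepFun_pastRows hξ hind ξ₀ (j + 1)) hhm
      (G := fun a ↦ ENNReal.ofReal (‖(spiderRun log f par x₀ a (j + 1)).prev.snd -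
        grad E F (spiderRun log f par x₀ a (j + 1)).prev.proj‖ ^ 2 + c))
      (by fun_prop) fun a ↦ ?_).trans ?_
    · simp only [hh, enorm_norm]
      exact H.lintegral_estimator_error_of_small (hξ _) (hlaw _) hpair hL hparL hε hq
        (by rw [hiter]; exact hkq)
    · have hG : ∀ w, ENNReal.ofReal (‖(spiderRun log f par x₀ (pastRows ξ₀ (j + 1)
          (fun j i ↦ ξ j i w)) (j + 1)).prev.snd - grad E F (spiderRun log f par x₀ (pastRows ξ₀
          (j + 1) (fun j i ↦ ξ j i w)) (j + 1)).prev.proj‖ ^ 2 + c) =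
          ‖estimatorError log f par x₀ F j (fun j i ↦ ξ j i w)‖ₑ ^ 2 + ENNReal.ofReal c :=
        fun w ↦ by
          rw [spiderRun_pastRows, ENNReal.ofReal_add (sq_nonneg _) hc0,
            ENNReal.ofReal_pow (norm_nonneg _), ofReal_norm,
            spiderRun_succ log f par x₀ ((Nat.lt_succ_self j).trans hk)]
          simp only [estimatorError, enorm_norm]
      simp only [hG]
      rw [lintegral_add_right _ measurable_const, lintegral_const, measure_univ, mul_one]
      refine (add_le_add_left ih _).trans ?_
      rw [← ENNReal.ofReal_add (by positivity) hc0, hmod]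
      refine ENNReal.ofReal_le_ofReal (le_of_eq ?_)
      push_cast
      ring
termination_by k

/-- The large batch contributes `ε² / 2` and the at most `q` small batches after it `2 ε²`. -/
theorem integral_estimatorError_sq_le (hL : 0 < L) (hparL : par.L = L) (hε : 0 < par.ε)
    (hq : 0 < par.q) (hS : 0 < par.S₁) (hS' : 2 * σ ^ 2 / par.ε ^ 2 ≤ par.S₁) {k : ℕ}
    (hk : k < par.T) :
    Integrable (fun w ↦ estimatorError log f par x₀ F k (fun j i ↦ ξ j i w) ^ 2) μ ∧
      ∫ w, estimatorError log f par x₀ F k (fun j i ↦ ξ j i w) ^ 2 ∂μ ≤ 5 / 2 * par.ε ^ 2 := by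
  have hm : Measurable fun w ↦ estimatorError log f par x₀ F k (fun j i ↦ ξ j i w) :=
    (H.measurable_estimatorError k).comp
      (measurable_pi_iff.2 fun j ↦ measurable_pi_iff.2 fun i ↦ hξ j i)
  refine integrable_sq_of_lintegral_le hm (by positivity)
    ((H.lintegral_estimatorError_sq_le hξ hlaw hind hL hparL hε hq hS hk).trans
      (ENNReal.ofReal_le_ofReal ?_))
  have hq' : (0 : ℝ) < par.q := by exact_mod_cast hq
  have hS'' : (0 : ℝ) < par.S₁ := by exact_mod_cast hS
  have h1 : σ ^ 2 / par.S₁ ≤ par.ε ^ 2 / 2 := by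
    rw [div_le_iff₀ (by positivity)] at hS'
    rw [div_le_div_iff₀ hS'' two_pos]
    linarith
  have h2 : ((k % par.q : ℕ) : ℝ) * (2 * par.ε ^ 2 / par.q) ≤ 2 * par.ε ^ 2 := by
    have : ((k % par.q : ℕ) : ℝ) ≤ par.q := by exact_mod_cast (Nat.mod_lt k hq).le
    calc ((k % par.q : ℕ) : ℝ) * (2 * par.ε ^ 2 / par.q)
        ≤ par.q * (2 * par.ε ^ 2 / par.q) := by gcongr
      _ = 2 * par.ε ^ 2 := by field_simp
  linarith

end StochasticObjective

end ErrorAlongRun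

/-! ### The descent inequality in expectation -/

section ExpectedDescent

variable {E : Type*} [NormedAddCommGroup E] [NormedSpace ℝ E] [FiniteDimensional ℝ E]
  {M : Type*} [TopologicalSpace M] [T2Space M] [SecondCountableTopology M]
  [MeasurableSpace M] [BorelSpace M]
  [ChartedSpace E M] [IsManifold 𝓘(ℝ, E) ∞ M]
  [RiemannianBundle (fun x : M ↦ TangentSpace 𝓘(ℝ, E) x)]
  [IsContMDiffRiemannianBundle 𝓘(ℝ, E) ∞ E (fun x : M ↦ TangentSpace 𝓘(ℝ, E) x)]
  {Ξ : Type*} [MeasurableSpace Ξ]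
  {log : ∀ x : M, M → TangentSpace 𝓘(ℝ, E) x} {P : Measure Ξ} [IsProbabilityMeasure P]
  {f : M → Ξ → ℝ} {F : M → ℝ} {L σ : ℝ} {par : SpiderParams} {x₀ : M}
  {Ω : Type*} [MeasurableSpace Ω] {μ : Measure Ω} [IsProbabilityMeasure μ]

/-- One step of length `1 / (2L)` along any vector `v`; the inner product of `v` and the gradient is
expressed through `‖v - ∇F(x)‖²`. -/
theorem GeodesicallySmooth.descent (hc : GeodesicallyComplete E M) (hlog : IsInverseExp log)
    (hF : GeodesicallySmooth log L F) (hL : 0 < L) (x : M) (v : TangentSpace 𝓘(ℝ, E) x) :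
    F (expMap x (-((1 / (2 * L)) • v))) + 1 / (4 * L) * ‖grad E F x‖ ^ 2 + 1 / (8 * L) * ‖v‖ ^ 2 ≤
      F x + 1 / (4 * L) * ‖v - grad E F x‖ ^ 2 := by
  have h := (abs_le.1 (hF.abs_expMap_sub_le hc hlog x (-((1 / (2 * L)) • v)))).2
  rw [inner_neg_right, inner_smul_right, norm_neg, norm_smul, Real.norm_of_nonneg (by positivity),
    mul_pow] at h
  rw [norm_sub_sq_real, real_inner_comm]
  have h1 : L / 2 * ((1 / (2 * L)) ^ 2 * ‖v‖ ^ 2) = 1 / (8 * L) * ‖v‖ ^ 2 := by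
    field_simp; ring
  have h2 : 1 / (4 * L) * ‖v‖ ^ 2 = 1 / (8 * L) * ‖v‖ ^ 2 + 1 / (8 * L) * ‖v‖ ^ 2 := by
    field_simp; ring
  have h3 : 1 / (4 * L) * (‖v‖ ^ 2 - 2 * inner ℝ (grad E F x) v + ‖grad E F x‖ ^ 2) =
      1 / (4 * L) * ‖v‖ ^ 2 - 1 / (2 * L) * inner ℝ (grad E F x) v +
        1 / (4 * L) * ‖grad E F x‖ ^ 2 := by
    field_simp; ring
  rw [h1] at h
  linarith

theorem GeodesicallySmooth.norm_grad_expMap_le (hc : GeodesicallyComplete E M)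
    (hlog : IsInverseExp log) (hF : GeodesicallySmooth log L F) (hL : 0 < L) (x : M)
    (w : TangentSpace 𝓘(ℝ, E) x) : ‖grad E F (expMap x w)‖ ≤ ‖grad E F x‖ + L * ‖w‖ := by
  obtain ⟨A, hA⟩ := exists_linearIsometry_transport hc hlog x (expMap x w)
  have h := hF.2 (expMap x w) x
  rw [hA, norm_log_symm hc hlog] at h
  calc ‖grad E F (expMap x w)‖
      ≤ ‖A (grad E F x)‖ + ‖grad E F (expMap x w) - A (grad E F x)‖ := by
        rw [add_comm]; exact norm_le_norm_sub_add _ _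
    _ ≤ ‖grad E F x‖ + L * ‖w‖ := by
        rw [A.norm_map]
        have := mul_le_mul_of_nonneg_left (hlog.norm_le x w) hL.le
        linarith

theorem integral_add_add_le {a' g v a e : Ω → ℝ} {c d : ℝ} (ha' : Integrable a' μ)
    (hg : Integrable g μ) (hv : Integrable v μ) (ha : Integrable a μ) (he : Integrable e μ)
    (h : ∀ w, a' w + c * g w + d * v w ≤ a w + c * e w) :
    ∫ w, a' w ∂μ + c * ∫ w, g w ∂μ + d * ∫ w, v w ∂μ ≤ ∫ w, a w ∂μ + c * ∫ w, e w ∂μ := by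
  have h1 : Integrable (fun w ↦ a' w + c * g w) μ := ha'.add (hg.const_mul c)
  rw [← integral_const_mul, ← integral_const_mul, ← integral_const_mul,
    ← integral_add ha' (hg.const_mul c), ← integral_add h1 (hv.const_mul d),
    ← integral_add ha (he.const_mul c)]
  exact integral_mono (h1.add (hv.const_mul d)) (ha.add (he.const_mul c)) h

variable (log f par x₀) in
/-- The estimator `v_k`, as a tangent vector at the iterate `x_k`. -/
def runEstimator (k : ℕ) (s : ℕ → ℕ → Ξ) :
    TangentSpace 𝓘(ℝ, E) (spiderRun log f par x₀ s k).cur :=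
  estimator log f par (s k) (spiderRun log f par x₀ s k)

namespace StochasticObjective

variable (H : StochasticObjective log P f F L σ)

include H

theorem measurable_norm_runEstimator (k : ℕ) :
    Measurable fun s ↦ ‖runEstimator log f par x₀ k s‖ := by
  have h := H.measurable_spiderRun (par := par) x₀ k
  exact (H.measurable_estimator (par := par) (r := fun s : ℕ → ℕ → Ξ ↦ s k)
    (fun s ↦ spiderRun_iter log f par x₀ s k) h.1 h.2.1 (measurable_pi_apply k)).norm

theorem measurable_norm_grad_cur (k : ℕ) :
    Measurable fun s ↦ ‖grad E F (spiderRun log f par x₀ s k).cur‖ :=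
  (H.measurable_grad.comp (H.measurable_spiderRun (par := par) x₀ k).2.1).norm

theorem measurable_cur (k : ℕ) : Measurable fun s ↦ F (spiderRun log f par x₀ s k).cur :=
  H.mdifferentiable.continuous.measurable.comp (H.measurable_spiderRun (par := par) x₀ k).2.1

variable {k : ℕ}

theorem run_descent (hL : 0 < L) (hη : par.η = 1 / (2 * L)) (hk : k < par.T) (s : ℕ → ℕ → Ξ) :
    F (spiderRun log f par x₀ s (k + 1)).cur +
        1 / (4 * L) * ‖grad E F (spiderRun log f par x₀ s k).cur‖ ^ 2 +
        1 / (8 * L) * ‖runEstimator log f par x₀ k s‖ ^ 2 ≤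
      F (spiderRun log f par x₀ s k).cur + 1 / (4 * L) * estimatorError log f par x₀ F k s ^ 2 := by
  rw [spiderRun_succ log f par x₀ hk, hη]
  exact H.geodesicallySmooth.descent H.complete H.isInverseExp hL _ _

/-- The output is chosen among `x_1, …, x_T`, whereas the descent inequality bounds the gradients at
`x_0, …, x_{T-1}`; this inequality makes up for the shift. -/
theorem run_norm_grad_sq_le (hL : 0 < L) (hη : par.η = 1 / (2 * L)) (hk : k < par.T)
    (s : ℕ → ℕ → Ξ) :
    ‖grad E F (spiderRun log f par x₀ s (k + 1)).cur‖ ^ 2 ≤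
      2 * ‖grad E F (spiderRun log f par x₀ s k).cur‖ ^ 2 +
        1 / 2 * ‖runEstimator log f par x₀ k s‖ ^ 2 := by
  rw [spiderRun_succ log f par x₀ hk, hη]
  have h := H.geodesicallySmooth.norm_grad_expMap_le H.complete H.isInverseExp hL
    (spiderRun log f par x₀ s k).cur (-((1 / (2 * L)) • runEstimator log f par x₀ k s))
  rw [norm_neg, norm_smul, Real.norm_of_nonneg (by positivity), ← mul_assoc,
    show L * (1 / (2 * L)) = 1 / 2 by field_simp] at h
  have h2 := pow_le_pow_left₀ (norm_nonneg _) h 2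
  refine h2.trans ?_
  nlinarith [sq_nonneg (‖grad E F (spiderRun log f par x₀ s k).cur‖ -
    1 / 2 * ‖runEstimator log f par x₀ k s‖)]

variable {ξ : ℕ → ℕ → Ω → Ξ} (hξ : ∀ k i, Measurable (ξ k i)) (hlaw : ∀ k i, μ.map (ξ k i) = P)
  (hind : iIndepFun (fun (j : ℕ × ℕ) ↦ ξ j.1 j.2) μ)

include hξ hlaw hind

variable (hL : 0 < L) (hparL : par.L = L) (hη : par.η = 1 / (2 * L)) (hε : 0 < par.ε)
    (hq : 0 < par.q) (hS : 0 < par.S₁) (hS' : 2 * σ ^ 2 / par.ε ^ 2 ≤ par.S₁)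
    (hbdd : BddBelow (range F))

include hL hparL hη hε hq hS hS' hbdd

/-- All quantities in the descent inequality are integrable. There is no a priori bound on the
growth of `F`, so integrability is carried along by that inequality itself, with `F` bounded below. -/
theorem integrable_run (hk : k ≤ par.T) :
    Integrable (fun w ↦ F (spiderRun log f par x₀ (fun j i ↦ ξ j i w) k).cur) μ ∧
    (k < par.T →
      Integrable (fun w ↦ ‖grad E F (spiderRun log f par x₀ (fun j i ↦ ξ j i w) k).cur‖ ^ 2) μ ∧
      Integrable (fun w ↦ ‖runEstimator log f par x₀ k (fun j i ↦ ξ j i w)‖ ^ 2) μ) := by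
  have hs : Measurable fun w (j i : ℕ) ↦ ξ j i w :=
    measurable_pi_iff.2 fun j ↦ measurable_pi_iff.2 fun i ↦ hξ j i
  obtain ⟨b, hb⟩ := hbdd
  have hb' : ∀ x, b ≤ F x := fun x ↦ hb ⟨x, rfl⟩
  -- Below `T`, all terms of the descent inequality are dominated by its right-hand side.
  have hstep : ∀ k, k < par.T →
      Integrable (fun w ↦ F (spiderRun log f par x₀ (fun j i ↦ ξ j i w) k).cur) μ →
      Integrable (fun w ↦ F (spiderRun log f par x₀ (fun j i ↦ ξ j i w) (k + 1)).cur) μ ∧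
      Integrable (fun w ↦ ‖grad E F (spiderRun log f par x₀ (fun j i ↦ ξ j i w) k).cur‖ ^ 2) μ ∧
      Integrable (fun w ↦ ‖runEstimator log f par x₀ k (fun j i ↦ ξ j i w)‖ ^ 2) μ := by
    intro k hk hF
    have herr :=
      (H.integral_estimatorError_sq_le (x₀ := x₀) hξ hlaw hind hL hparL hε hq hS hS' hk).1
    set R : Ω → ℝ := fun w ↦ F (spiderRun log f par x₀ (fun j i ↦ ξ j i w) k).cur +
      1 / (4 * L) * estimatorError log f par x₀ F k (fun j i ↦ ξ j i w) ^ 2 - b with hR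
    have hRi : Integrable R μ := (hF.add (herr.const_mul _)).sub (integrable_const b)
    have hdesc : ∀ w, F (spiderRun log f par x₀ (fun j i ↦ ξ j i w) (k + 1)).cur - b +
        1 / (4 * L) * ‖grad E F (spiderRun log f par x₀ (fun j i ↦ ξ j i w) k).cur‖ ^ 2 +
        1 / (8 * L) * ‖runEstimator log f par x₀ k (fun j i ↦ ξ j i w)‖ ^ 2 ≤ R w := fun w ↦ by
      have := H.run_descent (x₀ := x₀) hL hη hk (fun j i ↦ ξ j i w)
      simp only [hR]
      linarith
    have p1 : ∀ w, 0 ≤ F (spiderRun log f par x₀ (fun j i ↦ ξ j i w) (k + 1)).cur - b :=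
      fun w ↦ sub_nonneg.2 (hb' _)
    have p2 : ∀ w, 0 ≤ 1 / (4 * L) *
        ‖grad E F (spiderRun log f par x₀ (fun j i ↦ ξ j i w) k).cur‖ ^ 2 :=
      fun w ↦ by positivity
    have p3 : ∀ w, 0 ≤ 1 / (8 * L) * ‖runEstimator log f par x₀ k (fun j i ↦ ξ j i w)‖ ^ 2 :=
      fun w ↦ by positivity
    have m1 := (H.measurable_cur (par := par) (x₀ := x₀) (k + 1)).comp hs
    have m2 := ((H.measurable_norm_grad_cur (par := par) (x₀ := x₀) k).comp hs).pow_const 2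
    have m3 := ((H.measurable_norm_runEstimator (par := par) (x₀ := x₀) k).comp hs).pow_const 2
    refine ⟨?_, ?_, ?_⟩
    · have : Integrable
          (fun w ↦ F (spiderRun log f par x₀ (fun j i ↦ ξ j i w) (k + 1)).cur - b) μ :=
        hRi.mono' (m1.sub measurable_const).aestronglyMeasurable (ae_of_all _ fun w ↦ by
          rw [Real.norm_of_nonneg (p1 w)]
          linarith [hdesc w, p2 w, p3 w])
      exact (this.add (integrable_const b)).congr (ae_of_all _ fun w ↦ sub_add_cancel _ _)
    · refine (hRi.const_mul (4 * L)).mono' m2.aestronglyMeasurable (ae_of_all _ fun w ↦ ?_)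
      rw [Real.norm_of_nonneg (by positivity)]
      have h := hdesc w
      have : 1 / (4 * L) * ‖grad E F (spiderRun log f par x₀ (fun j i ↦ ξ j i w) k).cur‖ ^ 2 ≤
        R w := by linarith [p1 w, p3 w]
      rwa [div_mul_eq_mul_div, one_mul, div_le_iff₀ (by positivity), mul_comm] at this
    · refine (hRi.const_mul (8 * L)).mono' m3.aestronglyMeasurable (ae_of_all _ fun w ↦ ?_)
      rw [Real.norm_of_nonneg (by positivity)]
      have h := hdesc w
      have : 1 / (8 * L) * ‖runEstimator log f par x₀ k (fun j i ↦ ξ j i w)‖ ^ 2 ≤ R w := by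
        linarith [p1 w, p2 w]
      rwa [div_mul_eq_mul_div, one_mul, div_le_iff₀ (by positivity), mul_comm] at this
  have hF : ∀ k, k ≤ par.T →
      Integrable (fun w ↦ F (spiderRun log f par x₀ (fun j i ↦ ξ j i w) k).cur) μ := by
    intro k
    induction k with
    | zero => exact fun _ ↦ integrable_const (F x₀)
    | succ k ih => exact fun hk ↦ (hstep k hk (ih (Nat.le_of_succ_le hk))).1
  exact ⟨hF k hk, fun hk' ↦ (hstep k hk' (hF k hk)).2⟩

/-- The descent inequality, summed over the first `n` iterations and averaged over the samples. -/
theorem sum_integral_le {n : ℕ} (hn : n ≤ par.T) :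
    ∑ k ∈ Finset.range n,
      (2 * ∫ w, ‖grad E F (spiderRun log f par x₀ (fun j i ↦ ξ j i w) k).cur‖ ^ 2 ∂μ +
        ∫ w, ‖runEstimator log f par x₀ k (fun j i ↦ ξ j i w)‖ ^ 2 ∂μ) ≤
      8 * L * (F x₀ - ⨅ x, F x) + 5 * par.ε ^ 2 * n := by
  have hmain : ∀ n, n ≤ par.T → ∑ k ∈ Finset.range n,
      (2 * ∫ w, ‖grad E F (spiderRun log f par x₀ (fun j i ↦ ξ j i w) k).cur‖ ^ 2 ∂μ +
        ∫ w, ‖runEstimator log f par x₀ k (fun j i ↦ ξ j i w)‖ ^ 2 ∂μ) ≤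
      8 * L * (F x₀ - ∫ w, F (spiderRun log f par x₀ (fun j i ↦ ξ j i w) n).cur ∂μ) +
        5 * par.ε ^ 2 * n := by
    intro n
    induction n with
    | zero => intro _; simp [spiderRun]
    | succ n ih =>
      intro hn
      have hn' : n < par.T := hn
      rw [Finset.sum_range_succ]
      have h1 := H.integrable_run (x₀ := x₀) hξ hlaw hind hL hparL hη hε hq hS hS' hbdd hn'.le
      have h2 := (H.integrable_run (x₀ := x₀) hξ hlaw hind hL hparL hη hε hq hS hS' hbdd hn).1
      have herr := H.integral_estimatorError_sq_le (x₀ := x₀) hξ hlaw hind hL hparL hε hq hS hS' hn'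
      have hle := integral_add_add_le h2 (h1.2 hn').1 (h1.2 hn').2 h1.1 herr.1
        fun w ↦ H.run_descent (x₀ := x₀) hL hη hn' (fun j i ↦ ξ j i w)
      have ih' := ih hn'.le
      have he := herr.2
      set a := ∫ w, F (spiderRun log f par x₀ (fun j i ↦ ξ j i w) n).cur ∂μ
      set a' := ∫ w, F (spiderRun log f par x₀ (fun j i ↦ ξ j i w) (n + 1)).cur ∂μ
      set g := ∫ w, ‖grad E F (spiderRun log f par x₀ (fun j i ↦ ξ j i w) n).cur‖ ^ 2 ∂μ
      set v := ∫ w, ‖runEstimator log f par x₀ n (fun j i ↦ ξ j i w)‖ ^ 2 ∂μ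
      set e := ∫ w, estimatorError log f par x₀ F n (fun j i ↦ ξ j i w) ^ 2 ∂μ
      have hscaled : 8 * L * a' + 2 * g + v ≤ 8 * L * a + 2 * e := by
        have := mul_le_mul_of_nonneg_left hle (by positivity : 0 ≤ 8 * L)
        have e1 : 8 * L * (a' + 1 / (4 * L) * g + 1 / (8 * L) * v) = 8 * L * a' + 2 * g + v := by
          field_simp; ring
        have e2 : 8 * L * (a + 1 / (4 * L) * e) = 8 * L * a + 2 * e := by field_simp; ring
        linarith
      push_cast
      linarith
  refine (hmain n hn).trans ?_
  have hinf : (⨅ x, F x) ≤ ∫ w, F (spiderRun log f par x₀ (fun j i ↦ ξ j i w) n).cur ∂μ := by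
    have h := integral_mono (integrable_const (⨅ x, F x)) (H.integrable_run (x₀ := x₀) hξ hlaw hind
      hL hparL hη hε hq hS hS' hbdd hn).1 fun w ↦ ciInf_le hbdd _
    simpa using h
  have := mul_le_mul_of_nonneg_left hinf (by positivity : 0 ≤ 8 * L)
  linarith

end StochasticObjective

end ExpectedDescent

/-! ### The gradient at the output and the number of oracle calls -/

section OutputAndCost

theorem lintegral_uniformOn_Icc (T : ℕ) (g : ℕ → ENNReal) :
    ∫⁻ n, g n ∂(uniformOn (Icc 1 T)) = (T : ENNReal)⁻¹ * ∑ n ∈ Finset.Icc 1 T, g n := by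
  rw [uniformOn, ProbabilityTheory.cond, lintegral_smul_measure, ← Finset.coe_Icc, lintegral_finset,
    Measure.count_apply_finset]
  simp

/-- The number of large batches in `T` iterations. -/
theorem card_filter_mod_eq_zero_le (T : ℕ) {q : ℕ} (hq : 0 < q) :
    ((Finset.range T).filter (fun k ↦ k % q = 0)).card ≤ ⌈(T : ℝ) / q⌉₊ := by
  have hq' : (0 : ℝ) < q := by exact_mod_cast hq
  calc ((Finset.range T).filter (fun k ↦ k % q = 0)).card
      ≤ (Finset.range ⌈(T : ℝ) / q⌉₊).card := by
        refine Finset.card_le_card_of_injOn (fun k ↦ k / q) (fun k hk ↦ ?_) fun k hk l hl hkl ↦ ?_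
        · obtain ⟨hkT, hkq⟩ := Finset.mem_filter.1 hk
          have hkq' : k = q * (k / q) := (Nat.mul_div_cancel' (Nat.dvd_of_mod_eq_zero hkq)).symm
          refine Finset.mem_coe.2 (Finset.mem_range.2 (Nat.lt_ceil.2 ?_))
          rw [lt_div_iff₀ hq']
          have : k / q * q < T := by rw [mul_comm, ← hkq']; exact Finset.mem_range.1 hkT
          exact_mod_cast this
        · rw [← Nat.mul_div_cancel' (Nat.dvd_of_mod_eq_zero (Finset.mem_filter.1 hk).2),
            ← Nat.mul_div_cancel' (Nat.dvd_of_mod_eq_zero (Finset.mem_filter.1 hl).2)]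
          exact congrArg _ hkl
    _ = ⌈(T : ℝ) / q⌉₊ := Finset.card_range _

variable {E : Type*} [NormedAddCommGroup E] [NormedSpace ℝ E] [FiniteDimensional ℝ E]
  {M : Type*} [TopologicalSpace M] [T2Space M] [SecondCountableTopology M]
  [MeasurableSpace M] [BorelSpace M]
  [ChartedSpace E M] [IsManifold 𝓘(ℝ, E) ∞ M]
  [RiemannianBundle (fun x : M ↦ TangentSpace 𝓘(ℝ, E) x)]
  [IsContMDiffRiemannianBundle 𝓘(ℝ, E) ∞ E (fun x : M ↦ TangentSpace 𝓘(ℝ, E) x)]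
  {Ξ : Type*} [MeasurableSpace Ξ]
  {log : ∀ x : M, M → TangentSpace 𝓘(ℝ, E) x} {P : Measure Ξ} [IsProbabilityMeasure P]
  {f : M → Ξ → ℝ} {F : M → ℝ} {L σ : ℝ} {par : SpiderParams} {x₀ : M}
  {Ω : Type*} [MeasurableSpace Ω] {μ : Measure Ω} [IsProbabilityMeasure μ]

/-- The size of a small batch is controlled by the norm of the previous estimator, since `log`
does not lengthen the step `-η v_{k-1}`. -/
theorem iterCalls_le_of_small (hlog : IsInverseExp log) (hL : 0 < L) (hparL : par.L = L)
    (hη : par.η = 1 / (2 * L)) (hε : 0 < par.ε) {k : ℕ} (hk : k < par.T)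
    {s : ℕ → ℕ → Ξ} (hkq : (k + 1) % par.q ≠ 0) :
    (iterCalls log par (spiderRun log f par x₀ s (k + 1)) : ℝ) ≤
      par.q / (4 * par.ε ^ 2) * ‖runEstimator log f par x₀ k s‖ ^ 2 + 2 := by
  have hiter : (spiderRun log f par x₀ s (k + 1)).iter = k + 1 := by
    rw [spiderRun_iter]; omega
  rw [iterCalls, hiter, if_neg hkq, smallBatch, spiderRun_succ log f par x₀ hk]
  set x := (spiderRun log f par x₀ s k).cur
  set v := runEstimator log f par x₀ k s with hv
  change ((2 * ⌈(par.q : ℝ) * par.L ^ 2 * ‖log x (expMap x (-(par.η • v)))‖ ^ 2 /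
    (2 * par.ε ^ 2)⌉₊ : ℕ) : ℝ) ≤ _
  have hnorm : ‖log x (expMap x (-(par.η • v)))‖ ≤ 1 / (2 * L) * ‖v‖ := by
    refine (hlog.norm_le x _).trans ?_
    rw [norm_neg, norm_smul, hη, Real.norm_of_nonneg (by positivity)]
  have hsq := pow_le_pow_left₀ (norm_nonneg _) hnorm 2
  have hceil := (Nat.ceil_lt_add_one (a := (par.q : ℝ) * par.L ^ 2 *
    ‖log x (expMap x (-(par.η • v)))‖ ^ 2 / (2 * par.ε ^ 2)) (by positivity)).le
  have hbound : (par.q : ℝ) * par.L ^ 2 * ‖log x (expMap x (-(par.η • v)))‖ ^ 2 /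
      (2 * par.ε ^ 2) ≤ par.q * L ^ 2 * (1 / (2 * L) * ‖v‖) ^ 2 / (2 * par.ε ^ 2) := by
    rw [hparL]; gcongr
  have hval : par.q * L ^ 2 * (1 / (2 * L) * ‖v‖) ^ 2 / (2 * par.ε ^ 2) =
      par.q / (4 * par.ε ^ 2) * ‖v‖ ^ 2 / 2 := by
    field_simp; ring
  push_cast
  linarith

/-- The cost of the first `m + 1` iterations. For `q = 1` there are no small batches. -/
theorem calls_le (hlog : IsInverseExp log) (hL : 0 < L) (hparL : par.L = L)
    (hη : par.η = 1 / (2 * L)) (hε : 0 < par.ε) (s : ℕ → ℕ → Ξ)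
    {m : ℕ} (hm : m < par.T) :
    ((spiderRun log f par x₀ s (m + 1)).calls : ℝ) ≤
      ((Finset.range (m + 1)).filter (fun k ↦ k % par.q = 0)).card * par.S₁ +
        ∑ j ∈ Finset.range m, if par.q = 1 then 0 else
          (par.q / (4 * par.ε ^ 2) * ‖runEstimator log f par x₀ j s‖ ^ 2 + 2) := by
  induction m with
  | zero =>
    rw [spiderRun_succ log f par x₀ hm]
    simp [spiderRun, iterCalls, Finset.filter_singleton]
  | succ m ih =>
    have ih' := ih (Nat.lt_of_succ_lt hm)
    have hiter : (spiderRun log f par x₀ s (m + 1)).iter = m + 1 := by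
      rw [spiderRun_iter]; omega
    rw [spiderRun_succ log f par x₀ hm, Finset.sum_range_succ, Finset.range_add_one (n := m + 1),
      Finset.filter_insert]
    change (((spiderRun log f par x₀ s (m + 1)).calls +
      iterCalls log par (spiderRun log f par x₀ s (m + 1)) : ℕ) : ℝ) ≤ _
    by_cases hmq : (m + 1) % par.q = 0
    · rw [if_pos hmq, Finset.card_insert_of_notMem (by simp), iterCalls, hiter, if_pos hmq]
      have hnn : (0 : ℝ) ≤ if par.q = 1 then 0 else
          (par.q / (4 * par.ε ^ 2) * ‖runEstimator log f par x₀ m s‖ ^ 2 + 2) := by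
        split_ifs <;> positivity
      push_cast
      linarith
    · have hq1 : par.q ≠ 1 := by
        rintro h
        exact hmq (by rw [h, Nat.mod_one])
      rw [if_neg hmq, if_neg hq1]
      have := iterCalls_le_of_small (f := f) (x₀ := x₀) (s := s) hlog hL hparL hη hε
        (Nat.lt_of_succ_lt hm) hmq
      push_cast
      linarith

namespace StochasticObjective

variable (H : StochasticObjective log P f F L σ)
  {ξ : ℕ → ℕ → Ω → Ξ} (hξ : ∀ k i, Measurable (ξ k i)) (hlaw : ∀ k i, μ.map (ξ k i) = P)
  (hind : iIndepFun (fun (j : ℕ × ℕ) ↦ ξ j.1 j.2) μ)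
  (hL : 0 < L) (hparL : par.L = L) (hη : par.η = 1 / (2 * L)) (hε : 0 < par.ε)
  (hq : 0 < par.q) (hS : 0 < par.S₁) (hS' : 2 * σ ^ 2 / par.ε ^ 2 ≤ par.S₁)
  (hbdd : BddBelow (range F))

include H hξ hlaw hind hL hparL hη hε hq hS hS' hbdd

/-- The sum of the mean square gradients over the possible outputs `x_1, …, x_T`. -/
theorem sum_integral_norm_grad_sq_le :
    (∀ k, k < par.T → Integrable
      (fun w ↦ ‖grad E F (spiderRun log f par x₀ (fun j i ↦ ξ j i w) (k + 1)).cur‖ ^ 2) μ) ∧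
    ∑ k ∈ Finset.range par.T,
      ∫ w, ‖grad E F (spiderRun log f par x₀ (fun j i ↦ ξ j i w) (k + 1)).cur‖ ^ 2 ∂μ ≤
      8 * L * (F x₀ - ⨅ x, F x) + 5 * par.ε ^ 2 * par.T := by
  have hs : Measurable fun w (j i : ℕ) ↦ ξ j i w :=
    measurable_pi_iff.2 fun j ↦ measurable_pi_iff.2 fun i ↦ hξ j i
  have hrun : ∀ k, k < par.T → _ := fun k hk ↦ (H.integrable_run (x₀ := x₀) hξ hlaw hind hL hparL
    hη hε hq hS hS' hbdd hk.le).2 hk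
  have hint : ∀ k, k < par.T → Integrable
      (fun w ↦ ‖grad E F (spiderRun log f par x₀ (fun j i ↦ ξ j i w) (k + 1)).cur‖ ^ 2) μ :=
    fun k hk ↦ (((hrun k hk).1.const_mul 2).add ((hrun k hk).2.const_mul (1 / 2))).mono'
      (((H.measurable_norm_grad_cur (par := par) (x₀ := x₀) (k + 1)).comp
        hs).pow_const 2).aestronglyMeasurable (ae_of_all _ fun w ↦ by
          rw [Real.norm_of_nonneg (sq_nonneg _)]
          exact H.run_norm_grad_sq_le hL hη hk _)
  refine ⟨hint, le_trans (Finset.sum_le_sum fun k hk ↦ ?_)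
    (H.sum_integral_le (x₀ := x₀) hξ hlaw hind hL hparL hη hε hq hS hS' hbdd le_rfl)⟩
  have hk' := Finset.mem_range.1 hk
  have h := integral_mono (hint k hk')
    (((hrun k hk').1.const_mul 2).add ((hrun k hk').2.const_mul (1 / 2)))
    fun w ↦ H.run_norm_grad_sq_le hL hη hk' _
  have hadd := integral_add ((hrun k hk').1.const_mul 2) ((hrun k hk').2.const_mul (1 / 2))
  rw [integral_const_mul, integral_const_mul] at hadd
  have h0 : 0 ≤ ∫ w, ‖runEstimator log f par x₀ k (fun j i ↦ ξ j i w)‖ ^ 2 ∂μ :=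
    integral_nonneg fun w ↦ sq_nonneg _
  have h' := h.trans_eq hadd
  linarith

/-- The mean square gradient at a uniformly chosen iterate. Here `T ≥ 4 Δ L / ε²` turns the term
`8 L Δ / T` into `2 ε²`. -/
theorem integral_output_le (hT : 4 * (F x₀ - ⨅ x, F x) * L / par.ε ^ 2 ≤ par.T) (hT0 : 0 < par.T)
    {τ : Ω → ℕ} (hτ : Measurable τ) (hτ_law : μ.map τ = uniformOn (Icc 1 par.T))
    (hτ_indep : IndepFun τ (fun w (k i : ℕ) ↦ ξ k i w) μ) :
    Integrable
      (fun w ↦ ‖grad E F (spiderRun log f par x₀ (fun j i ↦ ξ j i w) (τ w)).cur‖ ^ 2) μ ∧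
    ∫ w, ‖grad E F (spiderRun log f par x₀ (fun j i ↦ ξ j i w) (τ w)).cur‖ ^ 2 ∂μ ≤
      7 * par.ε ^ 2 := by
  have hs : Measurable fun w (j i : ℕ) ↦ ξ j i w :=
    measurable_pi_iff.2 fun j ↦ measurable_pi_iff.2 fun i ↦ hξ j i
  have hm : Measurable fun z : ℕ × (ℕ → ℕ → Ξ) ↦ ‖grad E F (spiderRun log f par x₀ z.2 z.1).cur‖ :=
    measurable_from_prod_countable_right fun k ↦ H.measurable_norm_grad_cur k
  obtain ⟨hint, hsum⟩ := H.sum_integral_norm_grad_sq_le (x₀ := x₀) hξ hlaw hind hL hparL hη hε hq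
    hS hS' hbdd
  have hT' : (0 : ℝ) < par.T := by exact_mod_cast hT0
  refine integrable_sq_of_lintegral_le (hm.comp (hτ.prodMk hs)) (by positivity) ?_
  have hfub := lintegral_of_indepFun hτ hs hτ_indep (hm.enorm.pow_const 2)
  refine hfub.trans_le ?_
  rw [hτ_law, lintegral_uniformOn_Icc]
  have hterm : ∀ k, k < par.T → ∫⁻ w, ‖‖grad E F (spiderRun log f par x₀
      (fun j i ↦ ξ j i w) (k + 1)).cur‖‖ₑ ^ 2 ∂μ = ENNReal.ofReal (∫ w, ‖grad E F (spiderRun log f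
      par x₀ (fun j i ↦ ξ j i w) (k + 1)).cur‖ ^ 2 ∂μ) := fun k hk ↦ by
    rw [ofReal_integral_eq_lintegral_ofReal (hint k hk) (ae_of_all _ fun w ↦ sq_nonneg _)]
    refine lintegral_congr fun w ↦ ?_
    rw [ENNReal.ofReal_pow (norm_nonneg _), ofReal_norm, enorm_norm]
  have hIcc : ∑ n ∈ Finset.Icc 1 par.T, ∫⁻ w, ‖‖grad E F (spiderRun log f par x₀
      (fun j i ↦ ξ j i w) n).cur‖‖ₑ ^ 2 ∂μ = ENNReal.ofReal (∑ k ∈ Finset.range par.T,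
      ∫ w, ‖grad E F (spiderRun log f par x₀ (fun j i ↦ ξ j i w) (k + 1)).cur‖ ^ 2 ∂μ) := by
    rw [ENNReal.ofReal_sum_of_nonneg fun k _ ↦ integral_nonneg fun w ↦ sq_nonneg _,
      ← Finset.sum_congr rfl fun k hk ↦ hterm k (Finset.mem_range.1 hk)]
    exact (Finset.sum_bij (fun k _ ↦ k + 1) (fun k hk ↦ by simp at hk ⊢; omega)
      (fun _ _ _ _ h ↦ Nat.succ_injective h)
      (fun n hn ↦ ⟨n - 1, by simp at hn ⊢; omega, by simp at hn; omega⟩) fun _ _ ↦ rfl).symm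
  rw [hIcc, ← ENNReal.ofReal_natCast, ← ENNReal.ofReal_inv_of_pos hT',
    ← ENNReal.ofReal_mul (by positivity)]
  refine ENNReal.ofReal_le_ofReal ?_
  rw [inv_mul_le_iff₀ hT']
  rw [div_le_iff₀ (by positivity)] at hT
  linarith

/-- The expected cost. In `T` iterations at most `T - 1` small batches are drawn, which matters for
`T = 1`, where `T` may be much larger than `4 Δ L / ε²`; there are none for `q = 1`. -/
theorem integral_calls_le (hT0 : 0 < par.T) :
    Integrable (fun w ↦ ((spiderRun log f par x₀ (fun j i ↦ ξ j i w) par.T).calls : ℝ)) μ ∧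
    ∫ w, ((spiderRun log f par x₀ (fun j i ↦ ξ j i w) par.T).calls : ℝ) ∂μ ≤
      (⌈(par.T : ℝ) / par.q⌉₊ : ℝ) * par.S₁ + if par.q = 1 then 0 else
        (par.q / (4 * par.ε ^ 2) * (8 * L * (F x₀ - ⨅ x, F x) + 5 * par.ε ^ 2 * (par.T - 1)) +
          2 * (par.T - 1)) := by
  obtain ⟨m, hm⟩ : ∃ m, par.T = m + 1 := Nat.exists_eq_succ_of_ne_zero hT0.ne'
  have hmT : m < par.T := by omega
  have hs : Measurable fun w (j i : ℕ) ↦ ξ j i w :=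
    measurable_pi_iff.2 fun j ↦ measurable_pi_iff.2 fun i ↦ hξ j i
  set N : ℝ := ((Finset.range par.T).filter (fun k ↦ k % par.q = 0)).card * par.S₁ with hN
  have hNle : N ≤ (⌈(par.T : ℝ) / par.q⌉₊ : ℝ) * par.S₁ := by
    rw [hN]
    gcongr
    exact card_filter_mod_eq_zero_le par.T hq
  have hv : ∀ j ∈ Finset.range m,
      Integrable (fun w ↦ ‖runEstimator log f par x₀ j (fun j i ↦ ξ j i w)‖ ^ 2) μ := fun j hj ↦
    ((H.integrable_run (x₀ := x₀) hξ hlaw hind hL hparL hη hε hq hS hS' hbdd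
      ((Finset.mem_range.1 hj).trans hmT).le).2 ((Finset.mem_range.1 hj).trans hmT)).2
  have hterm : ∀ j ∈ Finset.range m, Integrable (fun w ↦ if par.q = 1 then 0 else
      (par.q / (4 * par.ε ^ 2) * ‖runEstimator log f par x₀ j (fun j i ↦ ξ j i w)‖ ^ 2 + 2)) μ :=
    fun j hj ↦ by
      split_ifs
      · exact integrable_const _
      · exact ((hv j hj).const_mul _).add (integrable_const _)
  have hU := (integrable_const (μ := μ) N).add (integrable_finsetSum _ hterm)
  have hle : ∀ w, ((spiderRun log f par x₀ (fun j i ↦ ξ j i w) par.T).calls : ℝ) ≤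
      N + ∑ j ∈ Finset.range m, if par.q = 1 then 0 else
        (par.q / (4 * par.ε ^ 2) * ‖runEstimator log f par x₀ j (fun j i ↦ ξ j i w)‖ ^ 2 + 2) :=
    fun w ↦ by
      have h := calls_le (f := f) (x₀ := x₀) H.isInverseExp hL hparL hη hε
        (fun j i ↦ ξ j i w) hmT
      rwa [← hm] at h
  have hmeas : Measurable fun w ↦
      ((spiderRun log f par x₀ (fun j i ↦ ξ j i w) par.T).calls : ℝ) :=
    measurable_from_nat.comp ((H.measurable_spiderRun (par := par) x₀ par.T).2.2.comp hs)
  have hint : Integrable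
      (fun w ↦ ((spiderRun log f par x₀ (fun j i ↦ ξ j i w) par.T).calls : ℝ)) μ :=
    hU.mono' hmeas.aestronglyMeasurable (ae_of_all _ fun w ↦ by
      rw [Real.norm_of_nonneg (Nat.cast_nonneg _)]
      exact hle w)
  refine ⟨hint, (integral_mono hint hU hle).trans ?_⟩
  have hadd := integral_add (integrable_const (μ := μ) N) (integrable_finsetSum _ hterm)
  refine hadd.le.trans ?_
  rw [integral_finsetSum _ hterm]
  simp only [integral_const, probReal_univ, one_smul]
  refine add_le_add hNle ?_
  split_ifs with hq1
  · simp
  · have hcalc : ∀ j ∈ Finset.range m, ∫ w, (par.q / (4 * par.ε ^ 2) *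
        ‖runEstimator log f par x₀ j (fun j i ↦ ξ j i w)‖ ^ 2 + 2) ∂μ = par.q / (4 * par.ε ^ 2) *
        ∫ w, ‖runEstimator log f par x₀ j (fun j i ↦ ξ j i w)‖ ^ 2 ∂μ + 2 := fun j hj ↦ by
      rw [integral_add ((hv j hj).const_mul _) (integrable_const _), integral_const_mul]
      simp
    rw [Finset.sum_congr rfl hcalc, Finset.sum_add_distrib, ← Finset.mul_sum]
    have hsum := H.sum_integral_le (x₀ := x₀) hξ hlaw hind hL hparL hη hε hq hS hS' hbdd hmT.le
    have hVle : ∑ j ∈ Finset.range m,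
        ∫ w, ‖runEstimator log f par x₀ j (fun j i ↦ ξ j i w)‖ ^ 2 ∂μ ≤
        8 * L * (F x₀ - ⨅ x, F x) + 5 * par.ε ^ 2 * m :=
      le_trans (Finset.sum_le_sum fun j _ ↦ le_add_of_nonneg_left
        (mul_nonneg two_pos.le (integral_nonneg fun w ↦ sq_nonneg _))) hsum
    have hmcast : (par.T : ℝ) - 1 = m := by rw [hm]; push_cast; ring
    rw [hmcast]
    have := mul_le_mul_of_nonneg_left hVle (by positivity : (0 : ℝ) ≤ par.q / (4 * par.ε ^ 2))
    simp only [Finset.sum_const, Finset.card_range, nsmul_eq_mul]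
    linarith

end StochasticObjective

/-- The arithmetic behind the cost of the small batches: `T - 1` is less than `4 Δ L / ε²`, and
`q < 1 / ε + 1` where `ε < 1` unless `q = 1`. -/
theorem smallBatch_cost_lt {L ε Δ : ℝ} (hL : 0 < L) (hε : 0 < ε) (hΔ : 0 < Δ) :
    (if ⌈1 / ε⌉₊ = 1 then 0 else ((⌈1 / ε⌉₊ : ℝ) / (4 * ε ^ 2) *
      (8 * L * Δ + 5 * ε ^ 2 * ((⌈4 * Δ * L / ε ^ 2⌉₊ : ℝ) - 1)) +
        2 * ((⌈4 * Δ * L / ε ^ 2⌉₊ : ℝ) - 1))) < 24 * Δ * L / ε ^ 3 := by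
  split_ifs with hq
  · positivity
  set B := 4 * Δ * L / ε ^ 2 with hB
  have hB0 : 0 < B := by positivity
  have hT : (⌈B⌉₊ : ℝ) - 1 < B := by linarith [Nat.ceil_lt_add_one hB0.le]
  set t := (⌈B⌉₊ : ℝ) - 1 with ht
  set q := (⌈1 / ε⌉₊ : ℝ) with hqdef
  have hq1 : q < 1 / ε + 1 := Nat.ceil_lt_add_one (by positivity)
  have hq0 : 0 ≤ q := Nat.cast_nonneg _
  have hε1 : 1 < 1 / ε := by
    by_contra! hle
    have h1 : ⌈1 / ε⌉₊ ≤ 1 := Nat.ceil_le.2 (by simpa using hle)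
    have h2 : 0 < ⌈1 / ε⌉₊ := Nat.ceil_pos.2 (by positivity)
    exact hq (by omega)
  have hLΔ : 8 * L * Δ = 2 * B * ε ^ 2 := by rw [hB]; field_simp; ring
  have hgoal : 24 * Δ * L / ε ^ 3 = 6 * B * (1 / ε) := by rw [hB]; field_simp; ring
  have hfirst : q / (4 * ε ^ 2) * (8 * L * Δ + 5 * ε ^ 2 * t) = q / 4 * (2 * B + 5 * t) := by
    rw [hLΔ]; field_simp
  rw [hgoal, hfirst]
  have h1 : q / 4 * (2 * B + 5 * t) ≤ q / 4 * (7 * B) := by gcongr; linarith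
  have h2 : q * B ≤ (1 / ε + 1) * B := by gcongr
  have h3 : B < 1 / ε * B := by nlinarith
  nlinarith

end OutputAndCost

end

theorem theorem1
    {E : Type*} [NormedAddCommGroup E] [NormedSpace ℝ E] [FiniteDimensional ℝ E]
    -- a complete Riemannian manifold
    {M : Type*} [TopologicalSpace M] [T2Space M] [SecondCountableTopology M]
    [MeasurableSpace M] [BorelSpace M]
    [ChartedSpace E M] [IsManifold 𝓘(ℝ, E) ∞ M]
    [RiemannianBundle (fun x : M ↦ TangentSpace 𝓘(ℝ, E) x)]
    [IsContMDiffRiemannianBundle 𝓘(ℝ, E) ∞ E (fun x : M ↦ TangentSpace 𝓘(ℝ, E) x)]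
    (hcomplete : GeodesicallyComplete E M)
    (log : ∀ x : M, M → TangentSpace 𝓘(ℝ, E) x) (hlog : IsInverseExp log)
    -- the stochastic objective
    {Ξ : Type*} [MeasurableSpace Ξ] (P : Measure Ξ) [IsProbabilityMeasure P]
    (f : M → Ξ → ℝ) (F : M → ℝ)
    (hf_int : ∀ x, Integrable (f x) P)
    (hF : ∀ x, F x = ∫ ξ, f x ξ ∂P)
    (hF_diff : MDifferentiable 𝓘(ℝ, E) 𝓘(ℝ, ℝ) F)
    (hf_meas : MeasurableToTangent (fun z : M × Ξ ↦
      (⟨z.1, grad E (fun y ↦ f y z.2) z.1⟩ : TangentBundle 𝓘(ℝ, E) M)))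
    -- the three assumptions
    (L σ : ℝ) (hL : 0 < L) (hσ : 0 < σ)
    (hsmooth : ∀ ξ, GeodesicallySmooth log L (fun x ↦ f x ξ))
    (hbdd : BddBelow (Set.range F))
    (hvar : ∀ x, ∫⁻ ξ, ‖grad E F x - grad E (fun y ↦ f y ξ) x‖ₑ ^ 2 ∂P ≤ ENNReal.ofReal (σ ^ 2))
    -- initial point, accuracy, parameters
    (x₀ : M) (ε : ℝ) (hε : 0 < ε)
    (Δ : ℝ) (hΔ : Δ = F x₀ - ⨅ x, F x) (hΔ_pos : 0 < Δ)
    (par : SpiderParams) (hpar : par = spiderParams L σ ε Δ)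
    -- the randomness: i.i.d. samples, and an independent uniform index of the output
    {Ω : Type*} [MeasurableSpace Ω] (μ : Measure Ω) [IsProbabilityMeasure μ]
    (ξ : ℕ → ℕ → Ω → Ξ) (hξ_meas : ∀ k i, Measurable (ξ k i))
    (hξ_law : ∀ k i, Measure.map (ξ k i) μ = P)
    (hξ_indep : iIndepFun (fun (j : ℕ × ℕ) ↦ ξ j.1 j.2) μ)
    (τ : Ω → ℕ) (hτ_meas : Measurable τ)
    (hτ_law : Measure.map τ μ = uniformOn (Set.Icc 1 par.T))
    (hτ_indep : IndepFun τ (fun w (k i : ℕ) ↦ ξ k i w) μ)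
    (run : Ω → ℕ → SpiderState E M)
    (hrun : ∀ w, run w = spiderRun log f par x₀ (fun k i ↦ ξ k i w)) :
    -- the algorithm terminates after exactly `T` iterations
    (∀ w, IsLeast {n | par.T ≤ (run w n).iter} par.T) ∧
    -- the output `x_τ` satisfies `𝔼 ‖∇F(x_τ)‖² ≤ 10 ε²`
    (Integrable (fun w ↦ ‖grad E F (run w (τ w)).cur‖ ^ 2) μ ∧
      ∫ w, ‖grad E F (run w (τ w)).cur‖ ^ 2 ∂μ ≤ 10 * ε ^ 2) ∧
    -- the expected number of IFO calls
    Integrable (fun w ↦ ((run w par.T).calls : ℝ)) μ ∧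
    ∫ w, ((run w par.T).calls : ℝ) ∂μ <
      (⌈(par.T : ℝ) / par.q⌉₊ : ℝ) * par.S₁ + 24 * Δ * L / ε ^ 3 ∧
    ((par.S₁ : ℝ) = 2 * σ ^ 2 / ε ^ 2 → (par.q : ℝ) = 1 / ε → (par.T : ℝ) = 4 * Δ * L / ε ^ 2 →
      par.q ∣ par.T →
      ∫ w, ((run w par.T).calls : ℝ) ∂μ < 8 * Δ * L * (σ ^ 2 + 3) / ε ^ 3) := by
  have H : StochasticObjective log P f F L σ :=
    ⟨hcomplete, hlog, hf_int, hF, hF_diff, hf_meas, hsmooth, hvar⟩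
  subst hpar
  set par := spiderParams L σ ε Δ with hpar
  have hq : 0 < par.q := Nat.ceil_pos.2 (by positivity)
  have hS : 0 < par.S₁ := Nat.ceil_pos.2 (by positivity)
  have hS' : 2 * σ ^ 2 / par.ε ^ 2 ≤ par.S₁ := Nat.le_ceil _
  have hT0 : 0 < par.T := Nat.ceil_pos.2 (by positivity)
  have hT : 4 * (F x₀ - ⨅ x, F x) * L / par.ε ^ 2 ≤ par.T := by
    rw [← hΔ]
    exact Nat.le_ceil _
  have hout := H.integral_output_le (x₀ := x₀) hξ_meas hξ_law hξ_indep hL (par := par) rfl rfl hε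
    hq hS hS' hbdd hT hT0 hτ_meas hτ_law hτ_indep
  have hcalls := H.integral_calls_le (x₀ := x₀) hξ_meas hξ_law hξ_indep hL (par := par) rfl rfl hε
    hq hS hS' hbdd hT0
  have hlt : ∫ w, ((spiderRun log f par x₀ (fun k i ↦ ξ k i w) par.T).calls : ℝ) ∂μ <
      (⌈(par.T : ℝ) / par.q⌉₊ : ℝ) * par.S₁ + 24 * Δ * L / ε ^ 3 := by
    refine hcalls.2.trans_lt (add_lt_add_of_le_of_lt le_rfl ?_)
    rw [← hΔ]
    exact smallBatch_cost_lt hL hε hΔ_pos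
  obtain rfl : run = fun w ↦ spiderRun log f par x₀ (fun k i ↦ ξ k i w) := funext hrun
  refine ⟨fun w ↦ ⟨?_, fun n hn ↦ ?_⟩, ⟨hout.1, hout.2.trans ?_⟩, hcalls.1, hlt, ?_⟩
  · simp [spiderRun_iter]
  · have hn' : par.T ≤ min n par.T := by simpa only [spiderRun_iter] using! hn
    omega
  · have hε' : par.ε = ε := rfl
    rw [hε']
    nlinarith [sq_nonneg ε]
  · intro hS₁ hq₁ hT₁ hdvd
    have hceil : (⌈(par.T : ℝ) / par.q⌉₊ : ℝ) = par.T / par.q := by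
      obtain ⟨c, hc⟩ := hdvd
      have hq' : (par.q : ℝ) ≠ 0 := by exact_mod_cast hq.ne'
      have hdiv : (par.T : ℝ) / par.q = c := by
        rw [hc, Nat.cast_mul, mul_div_cancel_left₀ _ hq']
      rw [hdiv, Nat.ceil_natCast]
    refine hlt.trans_eq ?_
    rw [hceil, hS₁, hq₁, hT₁]
    field_simp
    ring
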